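/- Let $\mathbb S=\{e^{i\theta}\}$ be the unit circle, $D=-i\,\frac{d}{d\theta}$, and let $\Lambda:C^\infty(\mathbb S)\to C^\infty(\mathbb S)$ be the Dirichlet-to-Neumann operator of the unit disk $\mathbb D$, i.e. $\Lambda e^{in\theta}=|n|e^{in\theta}$ for $n\in\mathbb Z$. Let $a\in C^\infty(\mathbb S)$ be a positive function satisfying the normalization condition $$\frac1{2\pi}\int_0^{2\pi}\frac{d\theta}{a(\theta)}=1 .$$ Put $\Lambda_a=a^{1/2}\Lambda a^{1/2}$ and $D_a=a^{1/2}Da^{1/2}$, and let $P_0$ be the orthogonal projection of $L^2(\mathbb S)$ onto the line spanned by $\phi_0=(2\pi)^{-1/2}a^{-1/2}$. Real powers of the positive operator $\Lambda_a+P_0$, which has discrete spectrum, are defined spectrally. Then for every $s\in\mathbb R$ the operator $(\Lambda_a+P_0)^{s-1}(\Lambda_a^2-D_a^2)$, defined on $C^\infty(\mathbb S)$, extends to a trace class operator on $L^2(\mathbb S)$ with real trace, and $$\mathrm{Tr}\big[(\Lambda_a+P_0)^{s-1}(\Lambda_a^2-D_a^2)\big]\ge0\quad\text{when } s>0,$$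 $$\mathrm{Tr}\big[(\Lambda_a+P_0)^{s-1}(\Lambda_a^2-D_a^2)\big]\le0\quad\text{when } s<0.$$ Moreover, the equality $\mathrm{Tr}\big[(\Lambda_a+P_0)^{s-1}(\Lambda_a^2-D_a^2)\big]=0$ holds for some real $s\neq0$ if and only if $a$ is conformally equivalent to the constant function $\mathbf 1$. Here $a,b\in C^\infty(\mathbb S)$ are called conformally equivalent if $b=|d\psi/d\theta|^{-1}\,a\circ\psi$ for some conformal or anticonformal transformation $\Psi$ of the disk $\mathbb D$, where the function $\psi(\theta)$ is defined by $e^{i\psi(\theta)}=\Psi(e^{i\theta})$. -/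

import Mathlib

noncomputable section

namespace SteklovCircle

open MeasureTheory
open scoped ContDiff InnerProductSpace

instance fact_two_pi_pos : Fact ((0 : ℝ) < 2 * Real.pi) := ⟨Real.two_pi_pos⟩

/-- The circle `ℝ / 2πℤ`, with coordinate `θ` standing for the point `exp (iθ)`. Its `volume` is
the measure `dθ` of total mass `2π`. -/
abbrev Circ : Type := AddCircle (2 * Real.pi)

/-- The Hilbert space of square integrable complex functions on the circle with respect to `dθ`. -/
abbrev L2S : Type := Lp ℂ 2 (volume : Measure Circ)

/-- The algebra of smooth complex functions on the circle. -/
def Smooth : Subalgebra ℂ (Circ → ℂ) where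
  carrier := {f | ContDiff ℝ ∞ fun θ : ℝ => f (θ : Circ)}
  mul_mem' {f g} hf hg := by
    simp only [Set.mem_ofPred_eq] at hf hg ⊢
    exact hf.mul hg
  add_mem' {f g} hf hg := by
    simp only [Set.mem_ofPred_eq] at hf hg ⊢
    exact hf.add hg
  algebraMap_mem' c := by
    change ContDiff ℝ ∞ fun _ : ℝ => c
    exact contDiff_const

theorem mem_smooth {f : Circ → ℂ} :
    f ∈ Smooth ↔ ContDiff ℝ ∞ fun θ : ℝ => f (θ : Circ) := Iff.rfl

theorem Smooth.continuous {f : Circ → ℂ} (hf : f ∈ Smooth) : Continuous f := by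
  have h : Continuous fun θ : ℝ => f (θ : Circ) := (mem_smooth.1 hf).continuous
  exact isQuotientMap_quotient_mk'.continuous_iff.2 h

/-- The inclusion of smooth functions into `L²`. -/
def toL2 : Smooth →ₗ[ℂ] L2S where
  toFun f := ContinuousMap.toLp 2 volume ℂ ⟨f.1, Smooth.continuous f.2⟩
  map_add' f g := (ContinuousMap.toLp (E := ℂ) 2 (volume : Measure Circ) ℂ).map_add
    ⟨f.1, Smooth.continuous f.2⟩ ⟨g.1, Smooth.continuous g.2⟩
  map_smul' c f := (ContinuousMap.toLp (E := ℂ) 2 (volume : Measure Circ) ℂ).map_smul c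
    ⟨f.1, Smooth.continuous f.2⟩

/-! ### The operators `D` and `Λ` -/

/-- The derivative `df/dθ` of a function on the circle. -/
def circleDeriv (f : Circ → ℂ) (x : Circ) : ℂ :=
  deriv (fun h : ℝ => f (x + (h : Circ))) 0

theorem circleDeriv_coe (f : Circ → ℂ) (θ : ℝ) :
    circleDeriv f (θ : Circ) = deriv (fun t : ℝ => f (t : Circ)) θ := by
  have h := deriv_comp_const_add (fun t : ℝ => f (t : Circ)) θ 0
  simpa [circleDeriv] using h

theorem circleDeriv_mem {f : Circ → ℂ} (hf : f ∈ Smooth) : circleDeriv f ∈ Smooth := by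
  have h : ContDiff ℝ ∞ (deriv fun t : ℝ => f (t : Circ)) :=
    (contDiff_infty_iff_deriv.1 hf).2
  change ContDiff ℝ ∞ fun θ : ℝ => circleDeriv f (θ : Circ)
  simpa only [circleDeriv_coe] using h

theorem Smooth.hasDerivAt {f : Circ → ℂ} (hf : f ∈ Smooth) (θ : ℝ) :
    HasDerivAt (fun t : ℝ => f (t : Circ)) (circleDeriv f (θ : Circ)) θ := by
  rw [circleDeriv_coe]
  exact ((contDiff_infty_iff_deriv.1 hf).1 θ).hasDerivAt

/-- The operator `D = -i d/dθ` on smooth functions. -/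
def D : Smooth →ₗ[ℂ] Smooth where
  toFun f := ⟨fun x => -Complex.I * circleDeriv f.1 x,
    (Smooth.smul_mem (circleDeriv_mem f.2) (-Complex.I) :)⟩
  map_add' f g := by
    ext x
    induction x using QuotientAddGroup.induction_on with
    | H θ =>
      have h : circleDeriv (f.1 + g.1) (θ : Circ)
          = circleDeriv f.1 (θ : Circ) + circleDeriv g.1 (θ : Circ) :=
        ((Smooth.hasDerivAt (f + g).2 θ).unique
          ((Smooth.hasDerivAt f.2 θ).add (Smooth.hasDerivAt g.2 θ)))
      change -Complex.I * circleDeriv (f.1 + g.1) (θ : Circ)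
        = -Complex.I * circleDeriv f.1 (θ : Circ) + -Complex.I * circleDeriv g.1 (θ : Circ)
      rw [h, mul_add]
  map_smul' c f := by
    ext x
    induction x using QuotientAddGroup.induction_on with
    | H θ =>
      have h : circleDeriv (c • f.1) (θ : Circ) = c * circleDeriv f.1 (θ : Circ) :=
        ((Smooth.hasDerivAt (c • f).2 θ).unique ((Smooth.hasDerivAt f.2 θ).const_mul c))
      change -Complex.I * circleDeriv (c • f.1) (θ : Circ)
        = c * (-Complex.I * circleDeriv f.1 (θ : Circ))
      rw [h]; ring

theorem Smooth.integrable {f : Circ → ℂ} (hf : f ∈ Smooth) :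
    Integrable f (AddCircle.haarAddCircle : Measure Circ) :=
  (Smooth.continuous hf).integrable_of_hasCompactSupport (HasCompactSupport.of_compactSpace f)

theorem fourierCoeff_circleDeriv {f : Circ → ℂ} (hf : f ∈ Smooth) (n : ℤ) :
    fourierCoeff (circleDeriv f) n = Complex.I * n * fourierCoeff f n := by
  have hi : (2 * Real.pi : ℂ) ≠ 0 := by exact_mod_cast Real.two_pi_pos.ne'
  have hc : Continuous fun θ : ℝ => circleDeriv f (θ : Circ) :=
    (Smooth.continuous (circleDeriv_mem hf)).comp (AddCircle.continuous_mk' _)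
  have hff : Continuous fun θ : ℝ => @fourier (2 * Real.pi) (-n) (θ : Circ) :=
    (map_continuous _).comp (AddCircle.continuous_mk' _)
  have h := intervalIntegral.integral_mul_deriv_eq_deriv_mul (a := 0) (b := 0 + 2 * Real.pi)
    (u := fun θ : ℝ => @fourier (2 * Real.pi) (-n) (θ : Circ))
    (v := fun θ : ℝ => f (θ : Circ))
    (u' := fun θ : ℝ => -Complex.I * n * @fourier (2 * Real.pi) (-n) (θ : Circ))
    (v' := fun θ : ℝ => circleDeriv f (θ : Circ))
    (fun x _ => by
      have h1 := hasDerivAt_fourier_neg (2 * Real.pi) n x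
      have e : -2 * (Real.pi : ℂ) * Complex.I * n / ((2 * Real.pi : ℝ) : ℂ) = -Complex.I * n := by
        push_cast
        rw [div_eq_iff hi]
        ring
      rw [e] at h1
      exact h1)
    (fun x _ => Smooth.hasDerivAt hf x)
    ((hff.const_mul _).intervalIntegrable _ _) (hc.intervalIntegrable _ _)
  rw [fourierCoeff_eq_intervalIntegral _ n 0, fourierCoeff_eq_intervalIntegral _ n 0]
  simp only [smul_eq_mul]
  rw [h]
  have e : ((0 + 2 * Real.pi : ℝ) : Circ) = ((0 : ℝ) : Circ) := by
    simp
  rw [e, sub_self, zero_sub]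
  simp only [mul_assoc]
  rw [intervalIntegral.integral_const_mul, intervalIntegral.integral_const_mul]
  simp only [Complex.real_smul]
  ring

/-- Fourier coefficients of a smooth function decay rapidly. -/
theorem Smooth.decay {f : Circ → ℂ} (hf : f ∈ Smooth) (k : ℕ) :
    ∃ C : ℝ, ∀ n : ℤ, |(n : ℝ)| ^ k * ‖fourierCoeff f n‖ ≤ C := by
  induction k generalizing f with
  | zero =>
    refine ⟨∫ t, ‖f t‖ ∂(AddCircle.haarAddCircle : Measure Circ), fun n => ?_⟩
    rw [pow_zero, one_mul]
    refine (norm_integral_le_integral_norm _).trans (le_of_eq ?_)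
    refine integral_congr_ae (Filter.Eventually.of_forall fun t => ?_)
    simp only [norm_smul, fourier_apply, Circle.norm_coe, one_mul]
  | succ k ih =>
    obtain ⟨C, hC⟩ := ih (circleDeriv_mem hf)
    refine ⟨C, fun n => ?_⟩
    have := hC n
    rw [fourierCoeff_circleDeriv hf, norm_mul, norm_mul, Complex.norm_I, one_mul,
      Complex.norm_intCast] at this
    rw [pow_succ, mul_assoc]
    exact this

theorem summable_of_decay {c : ℤ → ℂ}
    (hc : ∀ k : ℕ, ∃ C : ℝ, ∀ n : ℤ, |(n : ℝ)| ^ k * ‖c n‖ ≤ C) (k : ℕ) :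
    Summable fun n : ℤ => |(n : ℝ)| ^ k * ‖c n‖ := by
  obtain ⟨C, hC⟩ := hc (k + 2)
  have hs : Summable fun n : ℤ => C * (1 / (n : ℝ) ^ 2) :=
    (Real.summable_one_div_int_pow.2 one_lt_two).mul_left C
  refine hs.of_norm_bounded_eventually ?_
  rw [Filter.eventually_cofinite]
  refine (Set.finite_singleton (0 : ℤ)).subset fun n hn => ?_
  by_contra h0
  apply hn
  have h0' : (n : ℝ) ≠ 0 := by exact_mod_cast h0
  have hpos : 0 < (n : ℝ) ^ 2 := by positivity
  rw [Real.norm_of_nonneg (by positivity), mul_one_div, le_div_iff₀ hpos, ← sq_abs]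
  calc _ = |(n : ℝ)| ^ (k + 2) * ‖c n‖ := by ring
    _ ≤ C := hC n

theorem fourier_iteratedDeriv (n : ℤ) (k : ℕ) :
    iteratedDeriv k (fun θ : ℝ => @fourier (2 * Real.pi) n (θ : Circ))
      = fun θ : ℝ => (Complex.I * n) ^ k * @fourier (2 * Real.pi) n (θ : Circ) := by
  have hi : (2 * Real.pi : ℂ) ≠ 0 := by exact_mod_cast Real.two_pi_pos.ne'
  induction k with
  | zero => simp
  | succ k ih =>
    rw [iteratedDeriv_succ, ih]
    funext θ
    rw [((hasDerivAt_fourier (2 * Real.pi) n θ).const_mul _).deriv]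
    push_cast
    have : (Real.pi : ℂ) ≠ 0 := by exact_mod_cast Real.pi_ne_zero
    field_simp
    ring

/-- Trigonometric series with rapidly decaying coefficients are smooth. -/
theorem fourierSeries_mem {c : ℤ → ℂ}
    (hc : ∀ k : ℕ, ∃ C : ℝ, ∀ n : ℤ, |(n : ℝ)| ^ k * ‖c n‖ ≤ C) :
    (fun x : Circ => ∑' n : ℤ, c n * fourier n x) ∈ Smooth := by
  have hd (n : ℤ) : ContDiff ℝ ∞ fun θ : ℝ => @fourier (2 * Real.pi) n (θ : Circ) := by
    simp_rw [fourier_coe_apply]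
    refine ContDiff.cexp ?_
    exact (contDiff_const.mul Complex.ofRealCLM.contDiff).div_const _
  change ContDiff ℝ ∞ fun θ : ℝ => ∑' n : ℤ, c n * @fourier (2 * Real.pi) n (θ : Circ)
  refine contDiff_tsum (v := fun (k : ℕ) (n : ℤ) => |(n : ℝ)| ^ k * ‖c n‖)
    (fun n => contDiff_const.mul (hd n)) (fun k _ => summable_of_decay hc k) ?_
  intro k n θ _
  rw [norm_iteratedFDeriv_eq_norm_iteratedDeriv,
    iteratedDeriv_const_mul_field, fourier_iteratedDeriv]
  simp only [norm_mul, norm_pow, Complex.norm_I, one_mul, Complex.norm_intCast, fourier_apply,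
    Circle.norm_coe, mul_one]
  rw [mul_comm]

theorem Λ_decay {f : Circ → ℂ} (hf : f ∈ Smooth) (k : ℕ) :
    ∃ C : ℝ, ∀ n : ℤ, |(n : ℝ)| ^ k * ‖((|(n : ℝ)| : ℝ) : ℂ) * fourierCoeff f n‖ ≤ C := by
  obtain ⟨C, hC⟩ := Smooth.decay hf (k + 1)
  refine ⟨C, fun n => ?_⟩
  rw [norm_mul, Complex.norm_real, Real.norm_of_nonneg (abs_nonneg _), ← mul_assoc, ← pow_succ]
  exact hC n

theorem Λ_summable {f : Circ → ℂ} (hf : f ∈ Smooth) (x : Circ) :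
    Summable fun n : ℤ => ((|(n : ℝ)| : ℝ) : ℂ) * fourierCoeff f n * fourier n x := by
  refine Summable.of_norm ?_
  have h := summable_of_decay (Λ_decay hf) 0
  simpa only [pow_zero, one_mul, norm_mul, fourier_apply, Circle.norm_coe, mul_one] using h

/-- The Dirichlet-to-Neumann operator `Λ` of the unit disk: the operator on smooth functions with
`Λ exp (inθ) = |n| exp (inθ)`. -/
def Λ : Smooth →ₗ[ℂ] Smooth where
  toFun f := ⟨fun x => ∑' n : ℤ, ((|(n : ℝ)| : ℝ) : ℂ) * fourierCoeff f.1 n * fourier n x,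
    fourierSeries_mem (Λ_decay f.2)⟩
  map_add' f g := by
    ext x
    change ∑' n : ℤ, ((|(n : ℝ)| : ℝ) : ℂ) * fourierCoeff (f.1 + g.1) n * fourier n x
      = (∑' n : ℤ, ((|(n : ℝ)| : ℝ) : ℂ) * fourierCoeff f.1 n * fourier n x)
        + ∑' n : ℤ, ((|(n : ℝ)| : ℝ) : ℂ) * fourierCoeff g.1 n * fourier n x
    rw [← (Λ_summable f.2 x).tsum_add (Λ_summable g.2 x),
      fourierCoeff.add (Smooth.integrable f.2) (Smooth.integrable g.2)]
    simp only [Pi.add_apply]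
    exact tsum_congr fun n => by ring
  map_smul' c f := by
    ext x
    change ∑' n : ℤ, ((|(n : ℝ)| : ℝ) : ℂ) * fourierCoeff (c • f.1) n * fourier n x
      = c * ∑' n : ℤ, ((|(n : ℝ)| : ℝ) : ℂ) * fourierCoeff f.1 n * fourier n x
    rw [← tsum_mul_left]
    refine tsum_congr fun n => ?_
    rw [fourierCoeff.const_smul]
    simp only [smul_eq_mul]
    ring

/-! ### The operators attached to a positive smooth function -/

/-- A positive smooth function on the circle. -/
structure PosSmooth where
  toFun : Circ → ℝ
  smooth : ContDiff ℝ ∞ fun θ : ℝ => toFun (θ : Circ)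
  pos : ∀ x, 0 < toFun x

/-- The smooth function `a ^ r`. -/
def PosSmooth.power (a : PosSmooth) (r : ℝ) : Smooth :=
  ⟨fun x => ((a.toFun x ^ r : ℝ) : ℂ),
    Complex.ofRealCLM.contDiff.comp (a.smooth.rpow_const_of_ne fun θ => (a.pos θ).ne')⟩

/-- `Λ_a = a^{1/2} Λ a^{1/2}`. -/
def Λop (a : PosSmooth) : Smooth →ₗ[ℂ] Smooth :=
  LinearMap.mulLeft ℂ (a.power (1 / 2)) ∘ₗ Λ ∘ₗ LinearMap.mulLeft ℂ (a.power (1 / 2))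

/-- `D_a = a^{1/2} D a^{1/2}`. -/
def Dop (a : PosSmooth) : Smooth →ₗ[ℂ] Smooth :=
  LinearMap.mulLeft ℂ (a.power (1 / 2)) ∘ₗ D ∘ₗ LinearMap.mulLeft ℂ (a.power (1 / 2))

/-- `P₀`: the orthogonal projection of `L²` onto the line spanned by
`φ₀ = (2π)^{-1/2} a^{-1/2}`. -/
def P₀ (a : PosSmooth) : L2S →L[ℂ] L2S :=
  (Submodule.span ℂ
    {toL2 ((((2 * Real.pi) ^ (-(1 / 2) : ℝ) : ℝ) : ℂ) • a.power (-(1 / 2)))}).starProjection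

/-- `Λ_a + P₀`, as an operator in `L²` with domain the smooth functions. -/
def ΛP (a : PosSmooth) : Smooth →ₗ[ℂ] L2S :=
  toL2 ∘ₗ Λop a + (P₀ a).toLinearMap ∘ₗ toL2

/-! ### Powers of an operator with discrete spectrum, trace class operators -/

section Abstract

variable {V H : Type} [AddCommGroup V] [Module ℂ V] [NormedAddCommGroup H]
  [InnerProductSpace ℂ H] [CompleteSpace H]

/-- For an operator `A` in `H` with domain `V` (included in `H` by `j`), the closed linear span in
`H` of the eigenvectors with eigenvalue `μ`. -/
def eigenspace (j A : V →ₗ[ℂ] H) (μ : ℝ) : Submodule ℂ H :=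
  ((LinearMap.ker (A - (μ : ℂ) • j)).map j).topologicalClosure

instance (j A : V →ₗ[ℂ] H) (μ : ℝ) : CompleteSpace (eigenspace j A μ) :=
  inferInstanceAs (CompleteSpace ((LinearMap.ker (A - (μ : ℂ) • j)).map j).topologicalClosure)

/-- `IsPower j A r u v` says that `u` is in the domain of `A ^ r` and `A ^ r u = v`, for a positive
operator `A` in `H` with domain `V` whose eigenvectors span a dense subspace:
`A ^ r u = ∑ μ ^ r E_μ u`, where `E_μ` is the orthogonal projection onto the eigenspace of `μ`. -/
def IsPower (j A : V →ₗ[ℂ] H) (r : ℝ) (u v : H) : Prop :=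
  HasSum (fun μ : ℝ => ((μ ^ r : ℝ) : ℂ) • (eigenspace j A μ).starProjection u) v

/-- Trace class operators in a Hilbert space: the operators `∑ ⟨·, yₙ⟩ xₙ` with
`∑ ‖xₙ‖ ‖yₙ‖ < ∞`. -/
def IsTraceClass (T : H →L[ℂ] H) : Prop :=
  ∃ x y : ℕ → H, (Summable fun n => ‖x n‖ * ‖y n‖) ∧
    ∀ u, HasSum (fun n => ⟪y n, u⟫_ℂ • x n) (T u)

/-- `T` is trace class and has trace `t`: the diagonal of the matrix of `T` in every orthonormal
basis sums to `t`. -/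
def HasTrace (T : H →L[ℂ] H) (t : ℂ) : Prop :=
  IsTraceClass T ∧
    ∀ (ι : Type) (b : HilbertBasis ι ℂ H), HasSum (fun i => ⟪b i, T (b i)⟫_ℂ) t

end Abstract

/-- The bounded operator `T` in `L²` is the operator `(Λ_a + P₀)^{s-1} (Λ_a² - D_a²)`, that is,
agrees with it on the dense subspace of smooth functions. -/
def IsSteklovProduct (a : PosSmooth) (s : ℝ) (T : L2S →L[ℂ] L2S) : Prop :=
  ∀ f : Smooth, IsPower toL2 (ΛP a) (s - 1)
    (toL2 ((Λop a ∘ₗ Λop a - Dop a ∘ₗ Dop a) f)) (T (toL2 f))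

/-! ### Conformal equivalence -/

/-- A conformal transformation of the closed unit disk: a biholomorphic transformation of the open
disk, continuous up to the boundary. -/
def IsConformalDisk (Ψ : ℂ → ℂ) : Prop :=
  ContinuousOn Ψ (Metric.closedBall 0 1) ∧ DifferentiableOn ℂ Ψ (Metric.ball 0 1) ∧
    Set.BijOn Ψ (Metric.ball 0 1) (Metric.ball 0 1)

/-- An anticonformal transformation of the closed unit disk. -/
def IsAnticonformalDisk (Ψ : ℂ → ℂ) : Prop :=
  IsConformalDisk fun z => (starRingEnd ℂ) (Ψ z)

/-- `a` and `b` are conformally equivalent: `b = |dψ/dθ|⁻¹ a ∘ ψ` where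
`exp (iψ(θ)) = Ψ (exp (iθ))` for a conformal or anticonformal transformation `Ψ` of the disk. -/
def ConformallyEquivalent (a b : Circ → ℝ) : Prop :=
  ∃ (Ψ : ℂ → ℂ) (ψ : ℝ → ℝ), (IsConformalDisk Ψ ∨ IsAnticonformalDisk Ψ) ∧
    Differentiable ℝ ψ ∧
    (∀ θ : ℝ, Complex.exp (Complex.I * ψ θ) = Ψ (Complex.exp (Complex.I * θ))) ∧
    ∀ θ : ℝ, b (θ : Circ) = |deriv ψ θ|⁻¹ * a (ψ θ : Circ)

end SteklovCircle

end

/-!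
Write `A = Λ_a + P₀` and `E = D_a + P₀`. The normalization says that `φ₀` is a unit vector, so `A` and
`E` fix it. The operators `Λ_a`, `D_a` annihilate `φ₀` and map into its orthogonal
complement, so that `Λ_a² - D_a² = A² - E²` and `[D_a, Λ_a] = [E, A]`. On the complement of the
constants `D Λ⁻¹ D = Λ`, and conjugation with `a^{1/2}` turns this into `E A⁻¹ E = A`
(`inner_Eop_qOp_Eop`).

*Spectral theory.* The inverse of `A` is written down explicitly as `qOp`: a compact symmetric
Hilbert–Schmidt operator, whose eigenvectors are smooth by elliptic regularity, proved with weighted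
`ℓ¹` norms of Fourier coefficients. This provides an orthonormal basis `φ_n` of smooth eigenfunctions
of `A`, with eigenvalues `λ_n` such that `∑ λ_n⁻² < ∞` (`exists_eigenData`).

*Trace class.* The matrices of `Λ a Λ - D a D` and `D a Λ - Λ a D` in the basis of exponentials have
entries `(|m n| - m n) â(m - n)` and `(m |n| - |m| n) â(m - n)`. These vanish when `m` and `n` have
the same sign, and otherwise `|m - n| = |m| + |n|`, so they decay rapidly in both indices. Therefore
`Λ_a² - D_a²` and `[D_a, Λ_a]` are smoothing, and `A^{s-1} (Λ_a² - D_a²)` is an absolutely convergent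
sum of operators of rank one (`EigenData.exists_traceClass`).

*Sign of the trace.* Put `w_{mn} = |⟨φ_m, E φ_n⟩|² / (λ_m λ_n)`. The identity `E A⁻¹ E = A` says that
`w` is a symmetric, doubly stochastic matrix (`EigenData.hasSum_weight`), hence the `n`-th diagonal
entry of `A^{s-1} (A² - E²)` is
`λ_n^{s+1} - λ_n^{s-1} ‖E φ_n‖² = ∑_m w_{mn} λ_n^s (λ_n - λ_m)`.
The double series converges absolutely because `⟨φ_m, E φ_n⟩ (λ_n - λ_m)` is a matrix entry of the
smoothing operator `[E, A]`, and symmetrization gives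
`2 Tr = ∑_{m,n} w_{mn} (λ_n^s - λ_m^s) (λ_n - λ_m)` (`EigenData.hasSum_symmetrized`),
in which all terms have the sign of `s`.

*Equality.* If the trace vanishes for some `s ≠ 0` then `w_{mn} = 0` whenever `λ_m ≠ λ_n`, which means
`[D_a, Λ_a] = 0`. Applied to `a^{-1/2} e^{-iθ}` this gives `â(k) = 0` for `k ≥ 2`. Conversely, if
`â(k) = 0` for `|k| ≥ 2` then all entries `(|m n| - m n) â(m - n)` are zero and `Λ_a² = D_a²`. Finally,
a positive trigonometric polynomial of degree at most one is a multiple of some `|1 - γ e^{iθ}|²` with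
`|γ| < 1`, the normalization makes the multiple `(1 - |γ|²)⁻¹`, and these functions are exactly the
ones conformally equivalent to `1`, because conformal transformations of the disk are Möbius
transformations (`exists_eq_mob`).
-/

noncomputable section

namespace SteklovCircle

open MeasureTheory
open scoped ContDiff InnerProductSpace ENNReal ComplexConjugate


/-! ### The Fourier basis of `L²(dθ)` -/

theorem inner_toL2 (f g : Smooth) :
    ⟪toL2 f, toL2 g⟫_ℂ = ∫ x : Circ, g.1 x * conj (f.1 x) :=
  ContinuousMap.inner_toLp (volume : Measure Circ) _ _

theorem coeFn_toL2 (f : Smooth) : toL2 f =ᵐ[(volume : Measure Circ)] f.1 :=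
  ContinuousMap.coeFn_toLp (𝕜 := ℂ) (p := 2) (volume : Measure Circ)
    ⟨f.1, Smooth.continuous f.2⟩

theorem toL2_injective : Function.Injective toL2 := by
  intro f g h
  have h' := ContinuousMap.toLp_injective (𝕜 := ℂ) (p := 2) (volume : Measure Circ) h
  ext x
  exact DFunLike.congr_fun h' x

theorem integral_volume_eq (f : Circ → ℂ) :
    ∫ x : Circ, f x = (2 * Real.pi : ℂ) * ∫ x, f x ∂AddCircle.haarAddCircle := by
  have hi : (2 * Real.pi : ℂ) ≠ 0 := by exact_mod_cast Real.two_pi_pos.ne'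
  rw [AddCircle.integral_haarAddCircle, Complex.real_smul]
  push_cast
  rw [mul_inv_cancel_left₀ hi]

/-- The normalizing constant `(2π)^{-1/2}` of the orthonormal exponentials. -/
def nrm : ℝ := (2 * Real.pi) ^ (-(1 / 2) : ℝ)

theorem nrm_pos : 0 < nrm := Real.rpow_pos_of_pos Real.two_pi_pos _

theorem nrm_sq : nrm * nrm * (2 * Real.pi) = 1 := by
  unfold nrm
  rw [← Real.rpow_add Real.two_pi_pos, ← Real.rpow_add_one Real.two_pi_pos.ne']
  norm_num

theorem nrm_sq_complex : (nrm : ℂ) * nrm * (2 * Real.pi) = 1 := by exact_mod_cast nrm_sq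

theorem fourier_mem_smooth (n : ℤ) : ((fourier n : C(Circ, ℂ)) : Circ → ℂ) ∈ Smooth := by
  change ContDiff ℝ ∞ fun θ : ℝ => @fourier (2 * Real.pi) n (θ : Circ)
  simp_rw [fourier_coe_apply]
  exact ContDiff.cexp ((contDiff_const.mul Complex.ofRealCLM.contDiff).div_const _)

/-- The normalized exponential `(2π)^{-1/2} exp (inθ)`. -/
def es (n : ℤ) : Smooth := (nrm : ℂ) • ⟨fourier n, fourier_mem_smooth n⟩

theorem es_apply (n : ℤ) (x : Circ) : (es n).1 x = nrm * fourier n x := rfl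

/-- The Fourier coefficient `⟨e_n, u⟩` with respect to the orthonormal exponentials. -/
def coef (u : L2S) (n : ℤ) : ℂ := ⟪toL2 (es n), u⟫_ℂ

theorem coef_toL2 (f : Smooth) (n : ℤ) :
    coef (toL2 f) n = (2 * Real.pi * nrm : ℂ) * fourierCoeff f.1 n := by
  unfold coef fourierCoeff
  rw [inner_toL2, integral_volume_eq, mul_assoc (2 * Real.pi : ℂ),
    ← integral_const_mul (nrm : ℂ) (fun t : Circ => fourier (-n) t • f.1 t)]
  congr 1
  refine integral_congr_ae (Filter.Eventually.of_forall fun x => ?_)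
  simp only [es_apply, map_mul, Complex.conj_ofReal, smul_eq_mul, fourier_neg]
  ring

theorem coef_es (m n : ℤ) : coef (toL2 (es m)) n = if n = m then 1 else 0 := by
  rw [coef_toL2]
  have h : fourierCoeff (es m).1 n = (nrm : ℂ) * fourierCoeff (fourier m : C(Circ, ℂ)) n :=
    fourierCoeff.const_mul (fourier m : C(Circ, ℂ)) (nrm : ℂ) n
  rw [h]
  have h2 := congrFun (fourierCoeff_fourier (T := 2 * Real.pi) m) n
  rw [h2]
  by_cases hmn : n = m
  · subst hmn
    simp only [Pi.single_eq_same, if_true, mul_one]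
    rw [← nrm_sq_complex]; ring
  · simp [hmn]

theorem orthonormal_es : Orthonormal ℂ fun n => toL2 (es n) := by
  rw [orthonormal_iff_ite]
  intro i j
  exact coef_es j i

theorem span_es_dense :
    (Submodule.span ℂ (Set.range fun n => toL2 (es n))).topologicalClosure = ⊤ := by
  have h := (ContinuousMap.toLp_denseRange ℂ (volume : Measure Circ) ℂ
    (ENNReal.ofNat_ne_top (n := 2))).topologicalClosure_map_submodule
      (span_fourier_closure_eq_top (T := 2 * Real.pi))
  rw [Submodule.map_span] at h
  refine eq_top_iff.2 (h.ge.trans (Submodule.topologicalClosure_mono ?_))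
  rw [Submodule.span_le]
  rintro _ ⟨_, ⟨n, rfl⟩, rfl⟩
  have : toL2 ((nrm : ℂ)⁻¹ • es n) ∈ Submodule.span ℂ (Set.range fun n => toL2 (es n)) := by
    rw [map_smul]
    exact Submodule.smul_mem _ _ (Submodule.subset_span ⟨n, rfl⟩)
  have e : (nrm : ℂ)⁻¹ • es n = ⟨fourier n, fourier_mem_smooth n⟩ := by
    unfold es
    rw [inv_smul_smul₀]
    exact_mod_cast nrm_pos.ne'
  rw [e] at this
  exact this

/-- The orthonormal exponentials, as a Hilbert basis of `L²(dθ)`. -/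
def fourierHB : HilbertBasis ℤ ℂ L2S :=
  HilbertBasis.mk orthonormal_es span_es_dense.ge

theorem fourierHB_apply (n : ℤ) : fourierHB n = toL2 (es n) := by
  unfold fourierHB
  rw [HilbertBasis.coe_mk]

theorem ext_of_inner {H ι : Type*} [NormedAddCommGroup H] [InnerProductSpace ℂ H]
    (b : HilbertBasis ι ℂ H) {u v : H} (h : ∀ i, ⟪b i, u⟫_ℂ = ⟪b i, v⟫_ℂ) : u = v := by
  apply b.repr.injective
  ext i
  rw [b.repr_apply_apply, b.repr_apply_apply, h]

theorem ext_coef {u v : L2S} (h : ∀ n, coef u n = coef v n) : u = v :=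
  ext_of_inner fourierHB fun n => by
    simp only [fourierHB_apply]
    exact h n

theorem hasSum_coef (u : L2S) : HasSum (fun n => coef u n • toL2 (es n)) u := by
  have h := fourierHB.hasSum_repr u
  simp only [fourierHB.repr_apply_apply, fourierHB_apply] at h
  exact h

theorem hasSum_coef_mul_coef (u v : L2S) :
    HasSum (fun n => conj (coef u n) * coef v n) ⟪u, v⟫_ℂ := by
  have h := fourierHB.hasSum_inner_mul_inner u v
  simpa only [fourierHB_apply, coef, inner_conj_symm] using h

theorem coef_add (u v : L2S) (n : ℤ) : coef (u + v) n = coef u n + coef v n := inner_add_right _ _ _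

theorem coef_sub (u v : L2S) (n : ℤ) : coef (u - v) n = coef u n - coef v n := inner_sub_right _ _ _

theorem coef_smul (c : ℂ) (u : L2S) (n : ℤ) : coef (c • u) n = c * coef u n := inner_smul_right _ _ _

/-- The Fourier coefficients of the sum of an absolutely convergent trigonometric series. -/
theorem coef_toL2_of_series {c : ℤ → ℂ} (hc : Summable fun n => ‖c n‖) {F : Smooth}
    (hF : F.1 = fun x => ∑' n : ℤ, c n * fourier n x) (n : ℤ) :
    coef (toL2 F) n = (2 * Real.pi * nrm : ℂ) * c n := by
  have h1 : Summable fun n : ℤ => c n • (fourier n : C(Circ, ℂ)) := by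
    refine Summable.of_norm ?_
    simpa only [norm_smul, fourier_norm, mul_one] using hc
  have h2 : toL2 F = ContinuousMap.toLp 2 volume ℂ (∑' n : ℤ, c n • (fourier n : C(Circ, ℂ))) := by
    change ContinuousMap.toLp 2 volume ℂ _ = _
    congr 1
    ext x
    exact (congrFun hF x).trans (ContinuousMap.tsum_apply h1 x)
  have h3 : HasSum (fun m : ℤ => c m * coef (toL2 ⟨fourier m, fourier_mem_smooth m⟩) n)
      (coef (toL2 F) n) := by
    rw [h2]
    have h4 := h1.hasSum.mapL (ContinuousMap.toLp (E := ℂ) 2 (volume : Measure Circ) ℂ)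
    have h5 := h4.mapL (innerSL ℂ (toL2 (es n)))
    simp only [map_smul, smul_eq_mul] at h5
    exact h5
  have h6 : ∀ m : ℤ, coef (toL2 ⟨fourier m, fourier_mem_smooth m⟩) n
      = if n = m then (2 * Real.pi * nrm : ℂ) else 0 := by
    intro m
    rw [coef_toL2]
    have := congrFun (fourierCoeff_fourier (T := 2 * Real.pi) m) n
    change _ * fourierCoeff (fourier m : C(Circ, ℂ)) n = _
    rw [this]
    by_cases hmn : n = m
    · subst hmn; simp
    · simp [hmn]
  simp only [h6] at h3
  have h7 : HasSum (fun m : ℤ => c m * if n = m then (2 * Real.pi * nrm : ℂ) else 0)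
      (c n * if n = n then (2 * Real.pi * nrm : ℂ) else 0) :=
    hasSum_single n fun m hm => by simp [Ne.symm hm]
  rw [h3.unique h7, if_pos rfl, mul_comm]

theorem coef_Λ (f : Smooth) (n : ℤ) :
    coef (toL2 (Λ f)) n = ((|(n : ℝ)| : ℝ) : ℂ) * coef (toL2 f) n := by
  have h := summable_of_decay (Λ_decay f.2) 0
  simp only [pow_zero, one_mul] at h
  rw [coef_toL2_of_series h (F := Λ f) rfl, coef_toL2]
  ring

theorem coef_D (f : Smooth) (n : ℤ) : coef (toL2 (D f)) n = (n : ℂ) * coef (toL2 f) n := by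
  rw [coef_toL2, coef_toL2]
  have h : fourierCoeff (D f).1 n = -Complex.I * fourierCoeff (circleDeriv f.1) n :=
    fourierCoeff.const_mul _ _ _
  rw [h, fourierCoeff_circleDeriv f.2]
  linear_combination (2 * Real.pi * nrm * n * fourierCoeff f.1 n : ℂ) * (-Complex.I_mul_I)

theorem denseRange_toL2 : DenseRange toL2 := by
  have h : Dense ((Submodule.span ℂ (Set.range fun n => toL2 (es n)) : Submodule ℂ L2S) : Set L2S) :=
    Submodule.dense_iff_topologicalClosure_eq_top.2 span_es_dense
  refine h.mono ?_
  have h' : Submodule.span ℂ (Set.range fun n => toL2 (es n)) ≤ LinearMap.range toL2 := by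
    rw [Submodule.span_le]
    rintro _ ⟨n, rfl⟩
    exact ⟨_, rfl⟩
  exact h'

/-- An element of `L²` whose Fourier coefficients decay rapidly is a smooth function. -/
theorem exists_toL2_eq {u : L2S} (hu : ∀ k : ℕ, ∃ C : ℝ, ∀ n : ℤ, |(n : ℝ)| ^ k * ‖coef u n‖ ≤ C) :
    ∃ f : Smooth, toL2 f = u := by
  have hd : ∀ k : ℕ, ∃ C : ℝ, ∀ n : ℤ, |(n : ℝ)| ^ k * ‖(nrm : ℂ) * coef u n‖ ≤ C := by
    intro k
    obtain ⟨C, hC⟩ := hu k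
    refine ⟨nrm * C, fun n => ?_⟩
    rw [norm_mul, Complex.norm_real, Real.norm_of_nonneg nrm_pos.le, mul_left_comm]
    exact mul_le_mul_of_nonneg_left (hC n) nrm_pos.le
  refine ⟨⟨_, fourierSeries_mem hd⟩, ext_coef fun n => ?_⟩
  have h := summable_of_decay hd 0
  simp only [pow_zero, one_mul] at h
  rw [coef_toL2_of_series h rfl, ← mul_assoc]
  rw [show (2 * Real.pi * nrm * nrm : ℂ) = nrm * nrm * (2 * Real.pi) by ring, nrm_sq_complex,
    one_mul]

/-! ### Multiplication operators -/

/-- The operator of multiplication by a smooth function in `L²`. -/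
def mulOp (b : Smooth) : L2S →L[ℂ] L2S :=
  (ContinuousLinearMap.mul ℂ ℂ).holderL (volume : Measure Circ) ∞ 2 2
    (ContinuousMap.toLp ∞ volume ℂ ⟨b.1, Smooth.continuous b.2⟩)

theorem mulOp_toL2 (b f : Smooth) : mulOp b (toL2 f) = toL2 (b * f) := by
  apply Lp.ext
  have h1 := ContinuousLinearMap.coeFn_holder (r := 2) (B := ContinuousLinearMap.mul ℂ ℂ)
    (ContinuousMap.toLp ∞ (volume : Measure Circ) ℂ ⟨b.1, Smooth.continuous b.2⟩) (toL2 f)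
  have h2 := ContinuousMap.coeFn_toLp (𝕜 := ℂ) (p := ∞) (volume : Measure Circ)
    ⟨b.1, Smooth.continuous b.2⟩
  have h3 := coeFn_toL2 f
  have h4 := coeFn_toL2 (b * f)
  filter_upwards [h1, h2, h3, h4] with x h1 h2 h3 h4
  rw [h4]
  refine h1.trans ?_
  rw [h2, h3]
  rfl

theorem mulOp_mulOp (b c : Smooth) (u : L2S) : mulOp b (mulOp c u) = mulOp (b * c) u := by
  refine denseRange_toL2.induction_on u ?_ fun f => ?_
  · exact isClosed_eq (by fun_prop) (by fun_prop)
  · rw [mulOp_toL2, mulOp_toL2, mulOp_toL2, mul_assoc]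

theorem mulOp_one (u : L2S) : mulOp 1 u = u := by
  refine denseRange_toL2.induction_on u ?_ fun f => ?_
  · exact isClosed_eq (by fun_prop) (by fun_prop)
  · rw [mulOp_toL2, one_mul]

/-- Multiplication by a real function is symmetric. -/
theorem inner_mulOp {b : Smooth} (hb : ∀ x, conj (b.1 x) = b.1 x) (u v : L2S) :
    ⟪mulOp b u, v⟫_ℂ = ⟪u, mulOp b v⟫_ℂ := by
  refine denseRange_toL2.induction_on₂ (p := fun u v => ⟪mulOp b u, v⟫_ℂ = ⟪u, mulOp b v⟫_ℂ)
    ?_ (fun f g => ?_) u v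
  · exact isClosed_eq (by fun_prop) (by fun_prop)
  · rw [mulOp_toL2, mulOp_toL2, inner_toL2, inner_toL2]
    refine integral_congr_ae (Filter.Eventually.of_forall fun x => ?_)
    change g.1 x * conj (b.1 x * f.1 x) = b.1 x * g.1 x * conj (f.1 x)
    rw [map_mul, hb]
    ring

theorem coef_mul_es (b : Smooth) (m n : ℤ) :
    coef (toL2 (b * es m)) n = fourierCoeff b.1 (n - m) := by
  rw [coef_toL2, fourierCoeff, fourierCoeff, ← integral_const_mul]
  refine integral_congr_ae (Filter.Eventually.of_forall fun x => ?_)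
  change (2 * Real.pi * nrm : ℂ) * (fourier (-n) x * (b.1 x * (nrm * fourier m x)))
    = fourier (-(n - m)) x * b.1 x
  rw [show -(n - m) = -n + m by ring, fourier_add]
  linear_combination (fourier (-n) x * b.1 x * fourier m x) * nrm_sq_complex

/-- The Fourier coefficients of a product are given by convolution. -/
theorem hasSum_coef_mulOp {b : Smooth} (u : L2S) (n : ℤ) :
    HasSum (fun m => fourierCoeff b.1 (n - m) * coef u m) (coef (mulOp b u) n) := by
  have h := ((hasSum_coef u).mapL (mulOp b)).mapL (innerSL ℂ (toL2 (es n)))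
  have e : ∀ m, innerSL ℂ (toL2 (es n)) (mulOp b (coef u m • toL2 (es m)))
      = fourierCoeff b.1 (n - m) * coef u m := by
    intro m
    rw [map_smul, mulOp_toL2, map_smul, smul_eq_mul, mul_comm, ← coef_mul_es]
    rfl
  simp only [e] at h
  exact h

/-! ### Weighted `ℓ¹` norms of Fourier coefficients -/

/-- The weight `1 + |n|`. -/
def wf (n : ℤ) : ℝ≥0∞ := ENNReal.ofReal (1 + |(n : ℝ)|)

theorem one_le_wf (n : ℤ) : 1 ≤ wf n := by
  rw [wf, ENNReal.one_le_ofReal]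
  linarith [abs_nonneg (n : ℝ)]

theorem wf_add_le (m n : ℤ) : wf (m + n) ≤ wf m * wf n := by
  unfold wf
  rw [← ENNReal.ofReal_mul (by positivity)]
  refine ENNReal.ofReal_le_ofReal ?_
  push_cast
  have h1 := abs_add_le (m : ℝ) n
  have h2 := mul_nonneg (abs_nonneg (m : ℝ)) (abs_nonneg (n : ℝ))
  nlinarith

/-- The weighted norm `∑ (1 + |n|) ^ k |⟨e_n, u⟩|`, possibly infinite. -/
def wt (k : ℕ) (u : L2S) : ℝ≥0∞ := ∑' n, wf n ^ k * ‖coef u n‖ₑ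

/-- The weighted norm `∑ (1 + |n|) ^ k |b̂(n)|` of the Fourier coefficients of a function. -/
def fwt (k : ℕ) (b : Smooth) : ℝ≥0∞ := ∑' n, wf n ^ k * ‖fourierCoeff b.1 n‖ₑ

theorem tsum_wf_mul_ne_top {c : ℤ → ℂ}
    (hc : ∀ k : ℕ, ∃ C : ℝ, ∀ n : ℤ, |(n : ℝ)| ^ k * ‖c n‖ ≤ C) (k : ℕ) :
    ∑' n, wf n ^ k * ‖c n‖ₑ ≠ ⊤ := by
  have h0 := summable_of_decay hc 0
  have hk := summable_of_decay hc k
  have hs : Summable fun n : ℤ => (1 + |(n : ℝ)|) ^ k * ‖c n‖ := by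
    refine Summable.of_nonneg_of_le (fun n => by positivity) (fun n => ?_)
      ((h0.add hk).mul_left (2 ^ (k - 1)))
    have h := add_pow_le zero_le_one (abs_nonneg (n : ℝ)) k
    rw [one_pow] at h
    calc _ ≤ 2 ^ (k - 1) * (1 + |(n : ℝ)| ^ k) * ‖c n‖ :=
          mul_le_mul_of_nonneg_right h (norm_nonneg _)
      _ = _ := by ring
  have h := hs.tsum_ofReal_ne_top
  convert h using 3 with n
  rw [ENNReal.ofReal_mul (by positivity), ofReal_norm, ENNReal.ofReal_pow (by positivity), wf]

theorem wt_toL2_ne_top (k : ℕ) (f : Smooth) : wt k (toL2 f) ≠ ⊤ := by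
  refine tsum_wf_mul_ne_top (fun k => ?_) k
  obtain ⟨C, hC⟩ := Smooth.decay f.2 k
  refine ⟨‖(2 * Real.pi * nrm : ℂ)‖ * C, fun n => ?_⟩
  rw [coef_toL2, norm_mul, mul_left_comm]
  exact mul_le_mul_of_nonneg_left (hC n) (norm_nonneg _)

theorem fwt_ne_top (k : ℕ) (b : Smooth) : fwt k b ≠ ⊤ :=
  tsum_wf_mul_ne_top (Smooth.decay b.2) k

theorem exists_toL2_eq_of_wt {u : L2S} (hu : ∀ k, wt k u ≠ ⊤) : ∃ f : Smooth, toL2 f = u := by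
  refine exists_toL2_eq fun k => ⟨(wt k u).toReal, fun n => ?_⟩
  rw [← ENNReal.ofReal_le_iff_le_toReal (hu k), ENNReal.ofReal_mul (by positivity), ofReal_norm,
    ENNReal.ofReal_pow (by positivity)]
  refine le_trans ?_ (ENNReal.le_tsum n)
  gcongr
  exact ENNReal.ofReal_le_ofReal (by linarith [abs_nonneg (n : ℝ)])

theorem wt_mono {k l : ℕ} (h : k ≤ l) (u : L2S) : wt k u ≤ wt l u :=
  ENNReal.tsum_le_tsum fun n => mul_le_mul_left (pow_le_pow_right₀ (one_le_wf n) h) _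

theorem wt_add_le (k : ℕ) (u v : L2S) : wt k (u + v) ≤ wt k u + wt k v := by
  unfold wt
  rw [← ENNReal.tsum_add]
  refine ENNReal.tsum_le_tsum fun n => ?_
  rw [coef_add, ← mul_add]
  gcongr
  exact enorm_add_le _ _

theorem wt_smul (k : ℕ) (c : ℂ) (u : L2S) : wt k (c • u) = ‖c‖ₑ * wt k u := by
  unfold wt
  rw [← ENNReal.tsum_mul_left]
  refine tsum_congr fun n => ?_
  rw [coef_smul, enorm_mul]
  ring

theorem enorm_le_wt (k : ℕ) (u : L2S) : ‖u‖ₑ ≤ wt k u := by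
  refine le_trans ?_ (wt_mono (Nat.zero_le k) u)
  have h := hasSum_coef u
  rw [← h.tsum_eq]
  refine (enorm_tsum_le_tsum_enorm).trans (le_of_eq (tsum_congr fun n => ?_))
  rw [enorm_smul, h.tsum_eq, pow_zero, one_mul]
  have : ‖toL2 (es n)‖ₑ = 1 := by
    rw [← ofReal_norm, orthonormal_es.1 n, ENNReal.ofReal_one]
  rw [this, mul_one]

theorem wt_es (k : ℕ) (m : ℤ) : wt k (toL2 (es m)) = wf m ^ k := by
  unfold wt
  rw [tsum_eq_single m fun n hn => by rw [coef_es, if_neg hn]; simp]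
  rw [coef_es, if_pos rfl]
  simp

/-- Since the weight `1 + |n|` is submultiplicative, so are the weighted norms. -/
theorem wt_mulOp_le (k : ℕ) (b : Smooth) (u : L2S) : wt k (mulOp b u) ≤ fwt k b * wt k u := by
  have h1 : ∀ n m, wf n ^ k * (‖fourierCoeff b.1 (n - m)‖ₑ * ‖coef u m‖ₑ)
      ≤ (wf (n - m) ^ k * ‖fourierCoeff b.1 (n - m)‖ₑ) * (wf m ^ k * ‖coef u m‖ₑ) := by
    intro n m
    have h := wf_add_le (n - m) m
    rw [sub_add_cancel] at h
    calc _ ≤ (wf (n - m) * wf m) ^ k * (‖fourierCoeff b.1 (n - m)‖ₑ * ‖coef u m‖ₑ) := by gcongr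
      _ = _ := by rw [mul_pow]; ring
  calc wt k (mulOp b u)
      ≤ ∑' n, ∑' m, wf n ^ k * (‖fourierCoeff b.1 (n - m)‖ₑ * ‖coef u m‖ₑ) := by
        refine ENNReal.tsum_le_tsum fun n => ?_
        rw [ENNReal.tsum_mul_left]
        gcongr
        rw [← (hasSum_coef_mulOp u n).tsum_eq]
        refine (enorm_tsum_le_tsum_enorm).trans (le_of_eq (tsum_congr fun m => enorm_mul _ _))
    _ ≤ ∑' n, ∑' m, (wf (n - m) ^ k * ‖fourierCoeff b.1 (n - m)‖ₑ) * (wf m ^ k * ‖coef u m‖ₑ) :=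
        ENNReal.tsum_le_tsum fun n => ENNReal.tsum_le_tsum fun m => h1 n m
    _ = ∑' m, ∑' n, (wf (n - m) ^ k * ‖fourierCoeff b.1 (n - m)‖ₑ) * (wf m ^ k * ‖coef u m‖ₑ) :=
        ENNReal.tsum_comm
    _ = ∑' m, fwt k b * (wf m ^ k * ‖coef u m‖ₑ) := by
        refine tsum_congr fun m => ?_
        rw [ENNReal.tsum_mul_right]
        congr 1
        exact (Equiv.subRight m).tsum_eq fun n => wf n ^ k * ‖fourierCoeff b.1 n‖ₑ
    _ = fwt k b * wt k u := ENNReal.tsum_mul_left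

theorem wt_Λ_le (k : ℕ) (f : Smooth) : wt k (toL2 (Λ f)) ≤ wt (k + 1) (toL2 f) := by
  refine ENNReal.tsum_le_tsum fun n => ?_
  rw [coef_Λ, enorm_mul, pow_succ, mul_assoc]
  gcongr
  rw [← ofReal_norm, Complex.norm_real, Real.norm_of_nonneg (abs_nonneg _), wf]
  exact ENNReal.ofReal_le_ofReal (by linarith)

/-! ### Hilbert bases: diagonal operators, traces -/

section Hilbert

variable {ι H : Type*} [NormedAddCommGroup H] [InnerProductSpace ℂ H]

theorem hasSum_norm_inner_sq (b : HilbertBasis ι ℂ H) (v : H) :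
    HasSum (fun i => ‖⟪b i, v⟫_ℂ‖ ^ 2) (‖v‖ ^ 2) := by
  have h := (b.hasSum_inner_mul_inner v v).mapL Complex.reCLM
  have e : ∀ i, Complex.reCLM (⟪v, b i⟫_ℂ * ⟪b i, v⟫_ℂ) = ‖⟪b i, v⟫_ℂ‖ ^ 2 := by
    intro i
    rw [← inner_conj_symm v (b i), ← Complex.normSq_eq_conj_mul_self, Complex.normSq_eq_norm_sq]
    exact Complex.ofReal_re _
  simp only [e] at h
  have e2 : Complex.reCLM ⟪v, v⟫_ℂ = ‖v‖ ^ 2 := inner_self_eq_norm_sq (𝕜 := ℂ) v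
  rwa [e2] at h

/-- Riesz–Fischer: square summable coefficients are the coefficients of a vector. -/
theorem exists_inner_eq_of_summable_sq (b : HilbertBasis ι ℂ H) {c : ι → ℂ}
    (hc : Summable fun i => ‖c i‖ ^ 2) : ∃ v : H, ∀ i, ⟪b i, v⟫_ℂ = c i := by
  have hm : Memℓp c 2 := by
    refine memℓp_gen ?_
    simpa using hc
  refine ⟨b.repr.symm ⟨c, hm⟩, fun i => ?_⟩
  rw [← b.repr_apply_apply, LinearIsometryEquiv.apply_symm_apply]

theorem norm_le_of_inner_le (b : HilbertBasis ι ℂ H) {u v : H} {C : ℝ} (hC : 0 ≤ C)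
    (h : ∀ i, ‖⟪b i, u⟫_ℂ‖ ≤ C * ‖⟪b i, v⟫_ℂ‖) : ‖u‖ ≤ C * ‖v‖ := by
  have h1 := hasSum_norm_inner_sq b u
  have h2 := (hasSum_norm_inner_sq b v).mul_left (C ^ 2)
  have h3 : ‖u‖ ^ 2 ≤ C ^ 2 * ‖v‖ ^ 2 := by
    refine hasSum_le (fun i => ?_) h1 h2
    rw [← mul_pow]
    exact pow_le_pow_left₀ (norm_nonneg _) (h i) 2
  rw [← mul_pow] at h3
  exact (sq_le_sq₀ (norm_nonneg _) (by positivity)).1 h3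

/-- The bounded operator with a given bounded real diagonal in a Hilbert basis. -/
theorem exists_diagonal (b : HilbertBasis ι ℂ H) {c : ι → ℝ} {C : ℝ} (hc : ∀ i, |c i| ≤ C) :
    ∃ G : H →L[ℂ] H, ∀ u i, ⟪b i, G u⟫_ℂ = (c i : ℂ) * ⟪b i, u⟫_ℂ := by
  have hex : ∀ u : H, ∃ v : H, ∀ i, ⟪b i, v⟫_ℂ = (c i : ℂ) * ⟪b i, u⟫_ℂ := by
    intro u
    refine exists_inner_eq_of_summable_sq b ?_
    refine Summable.of_nonneg_of_le (fun i => by positivity) (fun i => ?_)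
      ((hasSum_norm_inner_sq b u).summable.mul_left (C ^ 2))
    rw [norm_mul, mul_pow, Complex.norm_real, Real.norm_eq_abs]
    exact mul_le_mul_of_nonneg_right (pow_le_pow_left₀ (abs_nonneg _) (hc i) 2) (by positivity)
  choose g hg using hex
  let G : H →ₗ[ℂ] H :=
    { toFun := g
      map_add' := fun u v => ext_of_inner b fun i => by
        rw [inner_add_right, hg, hg, hg, inner_add_right, mul_add]
      map_smul' := fun r u => ext_of_inner b fun i => by
        rw [RingHom.id_apply, inner_smul_right, hg, hg, inner_smul_right]; ring }
  refine ⟨G.mkContinuous |C| fun u => ?_, fun u i => hg u i⟩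
  refine norm_le_of_inner_le b (abs_nonneg _) fun i => ?_
  change ‖⟪b i, g u⟫_ℂ‖ ≤ _
  rw [hg, norm_mul, Complex.norm_real, Real.norm_eq_abs]
  exact mul_le_mul_of_nonneg_right ((hc i).trans (le_abs_self _)) (norm_nonneg _)

theorem isCompactOperator_rankOne (x y : H) :
    IsCompactOperator (InnerProductSpace.rankOne ℂ x y) := by
  rw [InnerProductSpace.rankOne_def']
  exact (isCompactOperator_of_locallyCompactSpace_rng
    (ContinuousLinearMap.toSpanSingleton ℂ x)).comp_clm _

/-- A diagonal operator whose entries tend to zero is compact. -/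
theorem isCompactOperator_of_diagonal [CompleteSpace H] (b : HilbertBasis ι ℂ H) {c : ι → ℝ}
    {G : H →L[ℂ] H} (hG : ∀ u i, ⟪b i, G u⟫_ℂ = (c i : ℂ) * ⟪b i, u⟫_ℂ)
    (hc : Filter.Tendsto c Filter.cofinite (nhds 0)) : IsCompactOperator G := by
  classical
  let F : Finset ι → H →L[ℂ] H := fun s =>
    ∑ i ∈ s, (c i : ℂ) • InnerProductSpace.rankOne ℂ (b i) (b i)
  have hF : ∀ s u i, ⟪b i, F s u⟫_ℂ = if i ∈ s then (c i : ℂ) * ⟪b i, u⟫_ℂ else 0 := by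
    intro s u i
    simp only [F, sum_apply, inner_sum, smul_apply,
      InnerProductSpace.rankOne_apply, inner_smul_right]
    have := orthonormal_iff_ite.1 b.orthonormal i
    simp [this]
  refine isCompactOperator_of_tendsto (F := F) (l := Filter.atTop) ?_
    (Filter.Eventually.of_forall fun s => ?_)
  · rw [Metric.tendsto_nhds]
    intro ε hε
    have hfin : {i | ¬ |c i| < ε / 2}.Finite := by
      have := (Metric.tendsto_nhds.1 hc) (ε / 2) (half_pos hε)
      simpa [Filter.eventually_cofinite] using this
    filter_upwards [Filter.eventually_ge_atTop hfin.toFinset] with s hs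
    rw [dist_eq_norm]
    refine lt_of_le_of_lt ?_ (half_lt_self hε)
    refine ContinuousLinearMap.opNorm_le_bound _ (half_pos hε).le fun u => ?_
    refine norm_le_of_inner_le b (half_pos hε).le fun i => ?_
    rw [sub_apply, inner_sub_right, hF, hG]
    split_ifs with hi
    · rw [sub_self, norm_zero]; positivity
    · rw [zero_sub, norm_neg, norm_mul, Complex.norm_real, Real.norm_eq_abs]
      refine mul_le_mul_of_nonneg_right ?_ (norm_nonneg _)
      by_contra hlt
      exact hi (hs (by simpa using fun h : |c i| < ε / 2 => hlt h.le))
  · induction s using Finset.induction_on with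
    | empty => simpa [F] using (isCompactOperator_zero : IsCompactOperator (0 : H → H))
    | insert i s hi ih =>
      have e : F (insert i s) = (c i : ℂ) • InnerProductSpace.rankOne ℂ (b i) (b i) + F s := by
        simp only [F]
        rw [Finset.sum_insert hi]
      rw [e]
      exact ((isCompactOperator_rankOne (b i) (b i)).smul (c i : ℂ)).add ih

end Hilbert

/-! ### Symmetry of the operators, the ground state `φ₀` -/

theorem inner_Λ (f g : Smooth) : ⟪toL2 (Λ f), toL2 g⟫_ℂ = ⟪toL2 f, toL2 (Λ g)⟫_ℂ := by
  refine (hasSum_coef_mul_coef _ _).unique ?_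
  convert hasSum_coef_mul_coef (toL2 f) (toL2 (Λ g)) using 2 with n
  rw [coef_Λ, coef_Λ, map_mul, Complex.conj_ofReal]
  ring

theorem inner_D (f g : Smooth) : ⟪toL2 (D f), toL2 g⟫_ℂ = ⟪toL2 f, toL2 (D g)⟫_ℂ := by
  refine (hasSum_coef_mul_coef _ _).unique ?_
  convert hasSum_coef_mul_coef (toL2 f) (toL2 (D g)) using 2 with n
  rw [coef_D, coef_D, map_mul, map_intCast]
  ring

namespace PosSmooth

variable (a : PosSmooth)

theorem power_apply (r : ℝ) (x : Circ) : (a.power r).1 x = ((a.toFun x ^ r : ℝ) : ℂ) := rfl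

theorem power_mul_power (r s : ℝ) : a.power r * a.power s = a.power (r + s) := by
  ext x
  change (a.power r).1 x * (a.power s).1 x = (a.power (r + s)).1 x
  rw [power_apply, power_apply, power_apply, Real.rpow_add (a.pos x)]
  push_cast
  rfl

theorem power_zero : a.power 0 = 1 := by
  ext x
  change ((a.toFun x ^ (0 : ℝ) : ℝ) : ℂ) = 1
  rw [Real.rpow_zero, Complex.ofReal_one]

theorem conj_power (r : ℝ) (x : Circ) : conj ((a.power r).1 x) = (a.power r).1 x :=
  Complex.conj_ofReal _

theorem power_half_mul : a.power (1 / 2) * a.power (-(1 / 2)) = 1 := by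
  rw [power_mul_power, add_neg_cancel, power_zero]

theorem power_half_mul_cancel (f : Smooth) : a.power (1 / 2) * (a.power (-(1 / 2)) * f) = f := by
  rw [← mul_assoc, power_half_mul, one_mul]

theorem power_neg_half_mul_cancel (f : Smooth) :
    a.power (-(1 / 2)) * (a.power (1 / 2) * f) = f := by
  rw [← mul_assoc, mul_comm (a.power _) (a.power _), power_half_mul, one_mul]

end PosSmooth

variable (a : PosSmooth)

/-- The function `φ₀ = (2π)^{-1/2} a^{-1/2}`. -/
def phi0 : Smooth := (nrm : ℂ) • a.power (-(1 / 2))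

theorem phi0_eq : phi0 a = a.power (-(1 / 2)) * es 0 := by
  ext x
  change (nrm : ℂ) * (a.power (-(1 / 2))).1 x = (a.power (-(1 / 2))).1 x * (es 0).1 x
  rw [es_apply, fourier_zero]
  ring

theorem Λ_es_zero : Λ (es 0) = 0 := by
  refine toL2_injective (ext_coef fun n => ?_)
  rw [coef_Λ, coef_es, map_zero]
  by_cases h : n = 0
  · simp [h, coef]
  · simp [h, coef]

theorem D_es_zero : D (es 0) = 0 := by
  refine toL2_injective (ext_coef fun n => ?_)
  rw [coef_D, coef_es, map_zero]
  by_cases h : n = 0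
  · simp [h, coef]
  · simp [h, coef]

theorem Λop_apply (f : Smooth) :
    Λop a f = a.power (1 / 2) * Λ (a.power (1 / 2) * f) := rfl

theorem Dop_apply (f : Smooth) :
    Dop a f = a.power (1 / 2) * D (a.power (1 / 2) * f) := rfl

theorem Λop_phi0 : Λop a (phi0 a) = 0 := by
  rw [Λop_apply, phi0_eq, a.power_half_mul_cancel, Λ_es_zero, mul_zero]

theorem Dop_phi0 : Dop a (phi0 a) = 0 := by
  rw [Dop_apply, phi0_eq, a.power_half_mul_cancel, D_es_zero, mul_zero]

theorem inner_Λop (f g : Smooth) :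
    ⟪toL2 (Λop a f), toL2 g⟫_ℂ = ⟪toL2 f, toL2 (Λop a g)⟫_ℂ := by
  rw [Λop_apply, Λop_apply, ← mulOp_toL2, inner_mulOp (a.conj_power _), mulOp_toL2, inner_Λ,
    ← mulOp_toL2, inner_mulOp (a.conj_power _), mulOp_toL2]

theorem inner_Dop (f g : Smooth) :
    ⟪toL2 (Dop a f), toL2 g⟫_ℂ = ⟪toL2 f, toL2 (Dop a g)⟫_ℂ := by
  rw [Dop_apply, Dop_apply, ← mulOp_toL2, inner_mulOp (a.conj_power _), mulOp_toL2, inner_D,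
    ← mulOp_toL2, inner_mulOp (a.conj_power _), mulOp_toL2]

theorem inner_phi0_Λop (f : Smooth) : ⟪toL2 (phi0 a), toL2 (Λop a f)⟫_ℂ = 0 := by
  rw [← inner_Λop, Λop_phi0, map_zero, inner_zero_left]

theorem inner_phi0_Dop (f : Smooth) : ⟪toL2 (phi0 a), toL2 (Dop a f)⟫_ℂ = 0 := by
  rw [← inner_Dop, Dop_phi0, map_zero, inner_zero_left]

/-- The normalization condition `∫ dθ / a = 2π`. -/
def Normalized : Prop :=
  1 / (2 * Real.pi) * (∫ θ in (0 : ℝ)..(2 * Real.pi), 1 / a.toFun (θ : Circ)) = 1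

variable {a}

theorem norm_phi0 (ha : Normalized a) : ‖toL2 (phi0 a)‖ = 1 := by
  have h1 : ∫ x : Circ, 1 / a.toFun x = 2 * Real.pi := by
    have h := AddCircle.intervalIntegral_preimage (2 * Real.pi) 0 (fun x : Circ => 1 / a.toFun x)
    rw [← h, zero_add]
    unfold Normalized at ha
    rwa [one_div, inv_mul_eq_iff_eq_mul₀ Real.two_pi_pos.ne', mul_one] at ha
  have h2 : ⟪toL2 (phi0 a), toL2 (phi0 a)⟫_ℂ = 1 := by
    rw [inner_toL2]
    have e : ∀ x : Circ, (phi0 a).1 x * conj ((phi0 a).1 x)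
        = ((nrm * nrm * (1 / a.toFun x) : ℝ) : ℂ) := by
      intro x
      have e1 : (phi0 a).1 x = ((nrm * a.toFun x ^ (-(1 / 2) : ℝ) : ℝ) : ℂ) := by
        change (nrm : ℂ) * (a.power (-(1 / 2))).1 x = _
        rw [PosSmooth.power_apply]
        push_cast
        rfl
      have e2 : a.toFun x ^ (-(1 / 2) : ℝ) * a.toFun x ^ (-(1 / 2) : ℝ) = 1 / a.toFun x := by
        rw [← Real.rpow_add (a.pos x), one_div (a.toFun x), ← Real.rpow_neg_one (a.toFun x)]
        norm_num
      rw [e1, Complex.conj_ofReal, ← Complex.ofReal_mul, ← e2]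
      congr 1
      ring
    simp only [e]
    rw [integral_complex_ofReal, integral_const_mul, h1, nrm_sq, Complex.ofReal_one]
  have h3 := inner_self_eq_norm_sq (𝕜 := ℂ) (toL2 (phi0 a))
  rw [h2] at h3
  have h4 : ‖toL2 (phi0 a)‖ ^ 2 = 1 := by rw [← h3]; simp
  exact (pow_eq_one_iff_of_nonneg (norm_nonneg _) two_ne_zero).1 h4

theorem inner_phi0_self (ha : Normalized a) : ⟪toL2 (phi0 a), toL2 (phi0 a)⟫_ℂ = 1 := by
  rw [inner_self_eq_norm_sq_to_K, norm_phi0 ha]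
  simp

theorem P₀_apply (ha : Normalized a) (u : L2S) :
    P₀ a u = ⟪toL2 (phi0 a), u⟫_ℂ • toL2 (phi0 a) :=
  Submodule.starProjection_unit_singleton ℂ (norm_phi0 ha) u

variable (a)

/-- The projection `P₀`, acting on smooth functions. -/
def projS : Smooth →ₗ[ℂ] Smooth :=
  ((innerSL ℂ (toL2 (phi0 a))).toLinearMap ∘ₗ toL2).smulRight (phi0 a)

theorem projS_apply (f : Smooth) : projS a f = ⟪toL2 (phi0 a), toL2 f⟫_ℂ • phi0 a := rfl

/-- The operator `Λ_a + P₀` from smooth functions to smooth functions. -/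
def Aop : Smooth →ₗ[ℂ] Smooth := Λop a + projS a

/-- The operator `D_a + P₀` from smooth functions to smooth functions. -/
def Eop : Smooth →ₗ[ℂ] Smooth := Dop a + projS a

theorem Aop_apply (f : Smooth) :
    Aop a f = Λop a f + ⟪toL2 (phi0 a), toL2 f⟫_ℂ • phi0 a := rfl

theorem Eop_apply (f : Smooth) :
    Eop a f = Dop a f + ⟪toL2 (phi0 a), toL2 f⟫_ℂ • phi0 a := rfl

theorem inner_projS (f g : Smooth) :
    ⟪toL2 (projS a f), toL2 g⟫_ℂ = ⟪toL2 f, toL2 (projS a g)⟫_ℂ := by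
  rw [projS_apply, projS_apply, map_smul, map_smul, inner_smul_left, inner_smul_right,
    inner_conj_symm, mul_comm]

theorem inner_Aop (f g : Smooth) :
    ⟪toL2 (Aop a f), toL2 g⟫_ℂ = ⟪toL2 f, toL2 (Aop a g)⟫_ℂ := by
  simp only [Aop, LinearMap.add_apply, map_add, inner_add_left, inner_add_right, inner_projS,
    inner_Λop]

theorem inner_Eop (f g : Smooth) :
    ⟪toL2 (Eop a f), toL2 g⟫_ℂ = ⟪toL2 f, toL2 (Eop a g)⟫_ℂ := by
  simp only [Eop, LinearMap.add_apply, map_add, inner_add_left, inner_add_right, inner_projS,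
    inner_Dop]

variable {a}

theorem toL2_Aop (ha : Normalized a) (f : Smooth) : toL2 (Aop a f) = ΛP a f := by
  change _ = toL2 (Λop a f) + P₀ a (toL2 f)
  rw [P₀_apply ha, Aop_apply, map_add, map_smul]

theorem Aop_phi0 (ha : Normalized a) : Aop a (phi0 a) = phi0 a := by
  rw [Aop_apply, Λop_phi0, inner_phi0_self ha, one_smul, zero_add]

theorem Eop_phi0 (ha : Normalized a) : Eop a (phi0 a) = phi0 a := by
  rw [Eop_apply, Dop_phi0, inner_phi0_self ha, one_smul, zero_add]

/-- `Λ_a² - D_a² = (Λ_a + P₀)² - (D_a + P₀)²`. -/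
theorem Aop_sq_sub_Eop_sq (ha : Normalized a) (f : Smooth) :
    Aop a (Aop a f) - Eop a (Eop a f) = Λop a (Λop a f) - Dop a (Dop a f) := by
  rw [Aop_apply a f, Eop_apply a f, map_add, map_add, map_smul, map_smul, Aop_phi0 ha, Eop_phi0 ha,
    Aop_apply, Eop_apply, inner_phi0_Λop, inner_phi0_Dop, zero_smul, add_zero, add_zero]
  abel

/-- `[D_a + P₀, Λ_a + P₀] = [D_a, Λ_a]`. -/
theorem Eop_Aop_commutator (ha : Normalized a) (f : Smooth) :
    Eop a (Aop a f) - Aop a (Eop a f) = Dop a (Λop a f) - Λop a (Dop a f) := by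
  rw [Aop_apply a f, Eop_apply a f, map_add, map_add, map_smul, map_smul, Aop_phi0 ha, Eop_phi0 ha,
    Aop_apply, Eop_apply, inner_phi0_Λop, inner_phi0_Dop, zero_smul, add_zero, add_zero]
  abel

/-! ### The inverse of `Λ_a + P₀` -/

theorem exists_gOp : ∃ G : L2S →L[ℂ] L2S, ∀ u n,
    coef (G u) n = ((|(n : ℝ)|⁻¹ : ℝ) : ℂ) * coef u n := by
  obtain ⟨G, hG⟩ := exists_diagonal fourierHB (c := fun n : ℤ => |(n : ℝ)|⁻¹) (C := 1) fun n => by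
    rw [abs_of_nonneg (by positivity)]
    by_cases h : n = 0
    · simp [h]
    · refine inv_le_one_of_one_le₀ ?_
      exact_mod_cast Int.one_le_abs h
  refine ⟨G, fun u n => ?_⟩
  have := hG u n
  rwa [fourierHB_apply] at this

/-- The operator `e_n ↦ |n|⁻¹ e_n` for `n ≠ 0`, `e_0 ↦ 0`: the inverse of `Λ` up to constants. -/
def gOp : L2S →L[ℂ] L2S := exists_gOp.choose

theorem coef_gOp (u : L2S) (n : ℤ) : coef (gOp u) n = ((|(n : ℝ)|⁻¹ : ℝ) : ℂ) * coef u n :=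
  exists_gOp.choose_spec u n

theorem inner_gOp (u v : L2S) : ⟪gOp u, v⟫_ℂ = ⟪u, gOp v⟫_ℂ := by
  refine (hasSum_coef_mul_coef _ _).unique ?_
  convert hasSum_coef_mul_coef u (gOp v) using 2 with n
  rw [coef_gOp, coef_gOp, map_mul, Complex.conj_ofReal]
  ring

theorem summable_inv_abs_sq : Summable fun n : ℤ => (|(n : ℝ)|⁻¹) ^ 2 := by
  have h := Real.summable_one_div_int_pow.2 one_lt_two
  convert h using 2 with n
  rw [inv_pow, sq_abs, one_div]

theorem isCompactOperator_gOp : IsCompactOperator gOp := by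
  refine isCompactOperator_of_diagonal fourierHB (c := fun n : ℤ => |(n : ℝ)|⁻¹)
    (fun u n => by rw [fourierHB_apply]; exact coef_gOp u n) ?_
  have h := summable_inv_abs_sq.tendsto_cofinite_zero.sqrt
  rw [Real.sqrt_zero] at h
  exact h.congr fun n => Real.sqrt_sq (by positivity)

variable (a)

/-- The operator `a^{-1/2} (1 - P₀)`. -/
def xOp : L2S →L[ℂ] L2S := mulOp (a.power (-(1 / 2))) ∘L (1 - P₀ a)

/-- The inverse of `Λ_a + P₀`. -/
def qOp : L2S →L[ℂ] L2S :=
  (1 - P₀ a) ∘L mulOp (a.power (-(1 / 2))) ∘L gOp ∘L xOp a + P₀ a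

theorem inner_P₀ (u v : L2S) : ⟪P₀ a u, v⟫_ℂ = ⟪u, P₀ a v⟫_ℂ :=
  Submodule.inner_starProjection_left_eq_right _ u v

theorem xOp_apply (u : L2S) : xOp a u = mulOp (a.power (-(1 / 2))) (u - P₀ a u) := rfl

theorem qOp_apply (u : L2S) : qOp a u =
    mulOp (a.power (-(1 / 2))) (gOp (xOp a u))
      - P₀ a (mulOp (a.power (-(1 / 2))) (gOp (xOp a u))) + P₀ a u := rfl

theorem inner_qOp_eq (u v : L2S) :
    ⟪u, qOp a v⟫_ℂ = ⟪xOp a u, gOp (xOp a v)⟫_ℂ + ⟪u, P₀ a v⟫_ℂ := by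
  rw [qOp_apply, inner_add_right, inner_sub_right, ← inner_P₀, ← inner_sub_left, xOp_apply a u,
    inner_mulOp (a.conj_power _)]

theorem inner_qOp (u v : L2S) : ⟪qOp a u, v⟫_ℂ = ⟪u, qOp a v⟫_ℂ := by
  rw [inner_qOp_eq, ← inner_conj_symm, inner_qOp_eq, map_add, inner_conj_symm, inner_conj_symm,
    inner_gOp, inner_P₀]

theorem isCompactOperator_qOp : IsCompactOperator (qOp a) := by
  have h1 : IsCompactOperator (P₀ a) := by
    refine IsCompactOperator.clm_comp (f := (Submodule.span ℂ {toL2 (phi0 a)}).orthogonalProjectionOnto)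
      ?_ (Submodule.span ℂ {toL2 (phi0 a)}).subtypeL
    exact isCompactOperator_of_locallyCompactSpace_dom _
  exact ((isCompactOperator_gOp.comp_clm (xOp a)).clm_comp
    ((1 - P₀ a) ∘L mulOp (a.power (-(1 / 2))))).add h1

variable {a}

theorem gOp_toL2_Λ (g : Smooth) : gOp (toL2 (Λ g)) = toL2 g - coef (toL2 g) 0 • toL2 (es 0) := by
  refine ext_coef fun n => ?_
  rw [coef_gOp, coef_Λ, coef_sub, coef_smul, coef_es]
  by_cases h : n = 0
  · simp [h]
  · have : ((|(n : ℝ)| : ℝ) : ℂ) ≠ 0 := by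
      rw [Complex.ofReal_ne_zero, abs_ne_zero]
      exact_mod_cast h
    rw [if_neg h, Complex.ofReal_inv, inv_mul_cancel_left₀ this, mul_zero, sub_zero]

theorem xOp_toL2_Aop (ha : Normalized a) (f : Smooth) :
    xOp a (toL2 (Aop a f)) = toL2 (Λ (a.power (1 / 2) * f)) := by
  rw [xOp_apply, P₀_apply ha, Aop_apply, map_add, map_smul, inner_add_right, inner_phi0_Λop,
    inner_smul_right, inner_phi0_self ha, mul_one, zero_add, add_sub_cancel_right, mulOp_toL2,
    Λop_apply, a.power_neg_half_mul_cancel]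

theorem xOp_toL2_Eop (ha : Normalized a) (f : Smooth) :
    xOp a (toL2 (Eop a f)) = toL2 (D (a.power (1 / 2) * f)) := by
  rw [xOp_apply, P₀_apply ha, Eop_apply, map_add, map_smul, inner_add_right, inner_phi0_Dop,
    inner_smul_right, inner_phi0_self ha, mul_one, zero_add, add_sub_cancel_right, mulOp_toL2,
    Dop_apply, a.power_neg_half_mul_cancel]

theorem qOp_toL2_Aop (ha : Normalized a) (f : Smooth) : qOp a (toL2 (Aop a f)) = toL2 f := by
  have h1 : mulOp (a.power (-(1 / 2))) (gOp (xOp a (toL2 (Aop a f))))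
      = toL2 f - coef (toL2 (a.power (1 / 2) * f)) 0 • toL2 (phi0 a) := by
    rw [xOp_toL2_Aop ha, gOp_toL2_Λ, map_sub, map_smul, mulOp_toL2, mulOp_toL2,
      a.power_neg_half_mul_cancel, ← phi0_eq]
  have h2 : P₀ a (toL2 (phi0 a)) = toL2 (phi0 a) := by
    rw [P₀_apply ha, inner_phi0_self ha, one_smul]
  have h3 : P₀ a (toL2 (Aop a f)) = P₀ a (toL2 f) := by
    rw [P₀_apply ha, P₀_apply ha, ← inner_Aop, Aop_phi0 ha]
  rw [qOp_apply, h1, h3, map_sub, map_smul, h2]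
  abel

/-- The form identity `(D_a + P₀) (Λ_a + P₀)⁻¹ (D_a + P₀) = Λ_a + P₀`. -/
theorem inner_Eop_qOp_Eop (ha : Normalized a) (f : Smooth) :
    ⟪toL2 (Eop a f), qOp a (toL2 (Eop a f))⟫_ℂ = ⟪toL2 f, toL2 (Aop a f)⟫_ℂ := by
  have h3 : ⟪toL2 (Eop a f), P₀ a (toL2 (Eop a f))⟫_ℂ
      = ⟪toL2 f, toL2 (projS a f)⟫_ℂ := by
    rw [P₀_apply ha, ← inner_Eop, Eop_phi0 ha, projS_apply, map_smul, inner_smul_right,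
      inner_smul_right, inner_Eop, Eop_phi0 ha]
  have h4 : ⟪toL2 f, toL2 (Λop a f)⟫_ℂ
      = ⟪toL2 (a.power (1 / 2) * f), toL2 (Λ (a.power (1 / 2) * f))⟫_ℂ := by
    rw [Λop_apply, ← mulOp_toL2, ← inner_mulOp (a.conj_power _), mulOp_toL2]
  rw [inner_qOp_eq, h3, xOp_toL2_Eop ha]
  change _ = ⟪toL2 f, toL2 (Λop a f + projS a f)⟫_ℂ
  rw [map_add, inner_add_right, h4]
  congr 1
  refine (hasSum_coef_mul_coef _ _).unique ?_
  convert hasSum_coef_mul_coef (toL2 (a.power (1 / 2) * f))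
    (toL2 (Λ (a.power (1 / 2) * f))) using 2 with n
  rw [coef_gOp, coef_D, coef_Λ, map_mul, map_intCast]
  have h : (n : ℂ) * ((|(n : ℝ)|⁻¹ : ℝ) : ℂ) * n = ((|(n : ℝ)| : ℝ) : ℂ) := by
    by_cases h : n = 0
    · simp [h]
    · have h' : |(n : ℝ)| ≠ 0 := by
        rw [abs_ne_zero]; exact_mod_cast h
      have : (n : ℝ) * |(n : ℝ)|⁻¹ * n = |(n : ℝ)| := by
        rw [mul_right_comm, ← abs_mul_abs_self, mul_assoc, mul_inv_cancel₀ h', mul_one]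
      exact_mod_cast this
  rw [← h]
  ring

theorem wt_gOp_le (k : ℕ) (u : L2S) : wt (k + 1) (gOp u) ≤ 2 * wt k u := by
  unfold wt
  rw [← ENNReal.tsum_mul_left]
  refine ENNReal.tsum_le_tsum fun n => ?_
  rw [coef_gOp, enorm_mul, pow_succ]
  have h : wf n * ‖((|(n : ℝ)|⁻¹ : ℝ) : ℂ)‖ₑ ≤ 2 := by
    rw [← ofReal_norm, Complex.norm_real, Real.norm_of_nonneg (by positivity), wf,
      ← ENNReal.ofReal_mul (by positivity), ← ENNReal.ofReal_ofNat]
    refine ENNReal.ofReal_le_ofReal ?_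
    by_cases h : n = 0
    · simp [h]
    · have h' : 1 ≤ |(n : ℝ)| := by exact_mod_cast Int.one_le_abs h
      rw [← div_eq_mul_inv, div_le_iff₀ (by linarith)]
      linarith
  calc _ = (wf n * ‖((|(n : ℝ)|⁻¹ : ℝ) : ℂ)‖ₑ) * (wf n ^ k * ‖coef u n‖ₑ) := by ring
    _ ≤ _ := by gcongr

theorem wt_zero_gOp_ne_top (u : L2S) : wt 0 (gOp u) ≠ ⊤ := by
  have h1 : Summable fun n : ℤ => ‖coef u n‖ ^ 2 := by
    have := (hasSum_norm_inner_sq fourierHB u).summable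
    simp only [fourierHB_apply] at this
    exact this
  have hs : Summable fun n : ℤ => ‖coef (gOp u) n‖ := by
    refine Summable.of_nonneg_of_le (fun n => norm_nonneg _) (fun n => ?_)
      (summable_inv_abs_sq.add h1)
    rw [coef_gOp, norm_mul, Complex.norm_real, Real.norm_of_nonneg (by positivity)]
    nlinarith [sq_nonneg (|(n : ℝ)|⁻¹ - ‖coef u n‖), sq_nonneg (|(n : ℝ)|⁻¹),
      sq_nonneg ‖coef u n‖]
  have h := hs.tsum_ofReal_ne_top
  unfold wt
  simpa only [pow_zero, one_mul, ofReal_norm] using h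

/-- Elliptic regularity: eigenfunctions of the inverse of `Λ_a + P₀` are smooth. -/
theorem exists_toL2_eq_of_qOp_eq (ha : Normalized a) {u : L2S} {ν : ℂ} (hν : ν ≠ 0)
    (hu : qOp a u = ν • u) : ∃ f : Smooth, toL2 f = u := by
  set v := mulOp (a.power (1 / 2)) u with hv
  have huv : u = mulOp (a.power (-(1 / 2))) v := by
    rw [hv, mulOp_mulOp, mul_comm (a.power _), a.power_half_mul, mulOp_one]
  -- `v = a^{1/2} u` solves `ν v = G (X u) + c e₀` for a constant `c`
  obtain ⟨c, hc⟩ : ∃ c : ℂ, ν • v = gOp (xOp a u) + c • toL2 (es 0) := by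
    refine ⟨⟪toL2 (phi0 a), u⟫_ℂ
      - ⟪toL2 (phi0 a), mulOp (a.power (-(1 / 2))) (gOp (xOp a u))⟫_ℂ, ?_⟩
    have h0 : mulOp (a.power (1 / 2)) (toL2 (phi0 a)) = toL2 (es 0) := by
      rw [mulOp_toL2, phi0_eq, a.power_half_mul_cancel]
    rw [hv, ← map_smul, ← hu, qOp_apply, P₀_apply ha, P₀_apply ha, map_add, map_sub, map_smul,
      map_smul, h0, mulOp_mulOp, a.power_half_mul, mulOp_one, sub_smul]
    abel
  have hstep : ∀ k, wt k (gOp (xOp a u)) ≠ ⊤ → wt k v ≠ ⊤ := by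
    intro k hk
    have : v = ν⁻¹ • (gOp (xOp a u) + c • toL2 (es 0)) := by rw [← hc, inv_smul_smul₀ hν]
    rw [this, wt_smul]
    refine ENNReal.mul_ne_top enorm_ne_top (ne_top_of_le_ne_top ?_ (wt_add_le _ _ _))
    rw [wt_smul]
    exact ENNReal.add_ne_top.2 ⟨hk, ENNReal.mul_ne_top enorm_ne_top (wt_toL2_ne_top _ _)⟩
  have hstep2 : ∀ k, wt k v ≠ ⊤ → wt (k + 1) (gOp (xOp a u)) ≠ ⊤ := by
    intro k hk
    refine ne_top_of_le_ne_top ?_ (wt_gOp_le k _)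
    refine ENNReal.mul_ne_top ENNReal.ofNat_ne_top (ne_top_of_le_ne_top ?_ (wt_mulOp_le _ _ _))
    refine ENNReal.mul_ne_top (fwt_ne_top _ _) ?_
    have e : u - P₀ a u = u + (-⟪toL2 (phi0 a), u⟫_ℂ) • toL2 (phi0 a) := by
      rw [neg_smul, ← sub_eq_add_neg, ← P₀_apply ha]
    change wt k (u - P₀ a u) ≠ ⊤
    rw [e]
    refine ne_top_of_le_ne_top ?_ (wt_add_le _ _ _)
    rw [wt_smul]
    refine ENNReal.add_ne_top.2 ⟨?_, ENNReal.mul_ne_top enorm_ne_top (wt_toL2_ne_top _ _)⟩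
    rw [huv]
    exact ne_top_of_le_ne_top (ENNReal.mul_ne_top (fwt_ne_top _ _) hk) (wt_mulOp_le _ _ _)
  have hall : ∀ k, wt k v ≠ ⊤ := by
    intro k
    induction k with
    | zero => exact hstep 0 (wt_zero_gOp_ne_top _)
    | succ k ih => exact hstep _ (hstep2 k ih)
  obtain ⟨f, hf⟩ := exists_toL2_eq_of_wt hall
  exact ⟨a.power (-(1 / 2)) * f, by rw [huv, ← hf, mulOp_toL2]⟩

/-- The inverse of `Λ_a + P₀` is a Hilbert–Schmidt operator. -/
theorem summable_norm_qOp_sq (ha : Normalized a) {ι : Type*} (b : HilbertBasis ι ℂ L2S) :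
    Summable fun i => ‖qOp a (b i)‖ ^ 2 := by
  let F : ℤ × ι → ℝ := fun p =>
    (|(p.1 : ℝ)|⁻¹) ^ 2 * ‖⟪b p.2, ContinuousLinearMap.adjoint (xOp a) (toL2 (es p.1))⟫_ℂ‖ ^ 2
  have hF1 : ∀ n : ℤ, HasSum (fun i => F (n, i))
      ((|(n : ℝ)|⁻¹) ^ 2 * ‖ContinuousLinearMap.adjoint (xOp a) (toL2 (es n))‖ ^ 2) := fun n =>
    (hasSum_norm_inner_sq b
      (ContinuousLinearMap.adjoint (xOp a) (toL2 (es n)))).mul_left ((|(n : ℝ)|⁻¹) ^ 2)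
  have hF : Summable F := by
    rw [summable_prod_of_nonneg (fun p => by positivity)]
    refine ⟨fun n => (hF1 n).summable, ?_⟩
    simp only [(hF1 _).tsum_eq]
    refine Summable.of_nonneg_of_le (fun n => by positivity) (fun n => ?_)
      (summable_inv_abs_sq.mul_right (‖ContinuousLinearMap.adjoint (xOp a)‖ ^ 2))
    gcongr
    refine (ContinuousLinearMap.le_opNorm _ _).trans (le_of_eq ?_)
    rw [orthonormal_es.1 n, mul_one]
  have hF2 : Summable fun i => ‖gOp (xOp a (b i))‖ ^ 2 := by
    refine hF.prod_symm.prod.congr fun i => ?_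
    have h1 := hasSum_norm_inner_sq fourierHB (gOp (xOp a (b i)))
    rw [← h1.tsum_eq]
    refine tsum_congr fun n => Eq.symm ?_
    change _ = (|(n : ℝ)|⁻¹) ^ 2 *
      ‖⟪b i, ContinuousLinearMap.adjoint (xOp a) (toL2 (es n))⟫_ℂ‖ ^ 2
    rw [fourierHB_apply]
    change ‖coef _ n‖ ^ 2 = _
    rw [coef_gOp, norm_mul, mul_pow, Complex.norm_real, Real.norm_of_nonneg (by positivity), coef,
      ContinuousLinearMap.adjoint_inner_right, norm_inner_symm]
  have hP : Summable fun i => ‖P₀ a (b i)‖ ^ 2 := by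
    have h := (hasSum_norm_inner_sq b (toL2 (phi0 a))).summable
    convert h using 2 with i
    rw [P₀_apply ha, norm_smul, norm_phi0 ha, mul_one, norm_inner_symm]
  set Y : L2S →L[ℂ] L2S := (1 - P₀ a) ∘L mulOp (a.power (-(1 / 2))) with hY
  refine Summable.of_nonneg_of_le (fun i => by positivity) (fun i => ?_)
    (((hF2.mul_left (‖Y‖ ^ 2)).add hP).mul_left 2)
  have h1 : qOp a (b i) = Y (gOp (xOp a (b i))) + P₀ a (b i) := rfl
  have h2 : ‖qOp a (b i)‖ ≤ ‖Y‖ * ‖gOp (xOp a (b i))‖ + ‖P₀ a (b i)‖ := by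
    rw [h1]
    exact (norm_add_le _ _).trans (add_le_add_left (Y.le_opNorm _) _)
  have h3 := pow_le_pow_left₀ (norm_nonneg _) h2 2
  nlinarith [sq_nonneg (‖Y‖ * ‖gOp (xOp a (b i))‖ - ‖P₀ a (b i)‖)]

/-! ### Eigenfunctions and powers -/

/-- A compact symmetric operator has an orthonormal basis of eigenvectors. -/
theorem exists_eigenbasis {H : Type} [NormedAddCommGroup H] [InnerProductSpace ℂ H]
    [CompleteSpace H] {Q : H →L[ℂ] H} (hc : IsCompactOperator Q)
    (hs : (Q : H →ₗ[ℂ] H).IsSymmetric) :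
    ∃ (ι : Type) (b : HilbertBasis ι ℂ H) (ν : ι → ℂ), ∀ i, Q (b i) = ν i • b i := by
  let W : ℂ → Submodule ℂ H := fun μ => Module.End.eigenspace (Q : H →ₗ[ℂ] H) μ
  have hW : ∀ μ x, x ∈ W μ ↔ Q x = μ • x := fun μ x => Module.End.mem_eigenspace_iff
  have hcomp : ∀ μ, CompleteSpace (W μ) := by
    intro μ
    have hcl : IsClosed ((W μ : Submodule ℂ H) : Set H) := by
      have : ((W μ : Submodule ℂ H) : Set H) = {x | Q x = μ • x} := Set.ext fun x => hW μ x
      rw [this]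
      exact isClosed_eq (by fun_prop) (by fun_prop)
    exact hcl.completeSpace_coe
  choose w b hb using fun μ => exists_hilbertBasis ℂ (W μ)
  have hV : OrthogonalFamily ℂ (fun μ => W μ) fun μ => (W μ).subtypeₗᵢ :=
    LinearMap.IsSymmetric.orthogonalFamily_eigenspaces hs
  have hon := hV.orthonormal_sigma_orthonormal (fun μ => (b μ).orthonormal)
  refine ⟨Σ μ, w μ, HilbertBasis.mkOfOrthogonalEqBot hon ?_, fun p => p.1, fun p => ?_⟩
  · rw [Submodule.eq_bot_iff]
    intro x hx
    rw [Submodule.mem_orthogonal] at hx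
    have h1 : x ∈ (⨆ μ, W μ)ᗮ := by
      rw [← Submodule.iInf_orthogonal, Submodule.mem_iInf]
      intro μ
      rw [Submodule.mem_orthogonal']
      intro y hy
      have h := (((b μ).hasSum_repr ⟨y, hy⟩).mapL (W μ).subtypeL).mapL (innerSL ℂ x)
      have h0 : ∀ i, innerSL ℂ x ((W μ).subtypeL ((b μ).repr ⟨y, hy⟩ i • b μ i)) = 0 := by
        intro i
        rw [map_smul, map_smul, innerSL_apply_apply, ← inner_conj_symm]
        have := hx _ (Submodule.subset_span ⟨⟨μ, i⟩, rfl⟩)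
        rw [show ⟪(W μ).subtypeL (b μ i), x⟫_ℂ = 0 from this, map_zero, smul_zero]
      simp only [h0] at h
      exact h.unique hasSum_zero
    rwa [ContinuousLinearMap.orthogonalComplement_iSup_eigenspaces_eq_bot hc hs,
      Submodule.mem_bot] at h1
  · rw [HilbertBasis.coe_mkOfOrthogonalEqBot]
    exact (hW _ _).1 (b p.1 p.2).2

theorem re_inner_qOp_self_nonneg (ha : Normalized a) (u : L2S) : 0 ≤ (⟪u, qOp a u⟫_ℂ).re := by
  rw [inner_qOp_eq, Complex.add_re]
  refine add_nonneg ?_ ?_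
  · have h := (hasSum_coef_mul_coef (xOp a u) (gOp (xOp a u))).mapL Complex.reCLM
    refine h.nonneg fun n => ?_
    rw [coef_gOp, mul_left_comm, ← Complex.normSq_eq_conj_mul_self, ← Complex.ofReal_mul]
    change 0 ≤ (|(n : ℝ)|⁻¹ * Complex.normSq (coef (xOp a u) n))
    have := Complex.normSq_nonneg (coef (xOp a u) n)
    positivity
  · rw [P₀_apply ha, inner_smul_right, ← inner_conj_symm u, Complex.mul_conj, Complex.ofReal_re]
    exact Complex.normSq_nonneg _

theorem qOp_injective (ha : Normalized a) {u : L2S} (hu : qOp a u = 0) : u = 0 := by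
  refine ext_coef fun n => ?_
  rw [coef, coef, inner_zero_right, ← qOp_toL2_Aop ha, inner_qOp, hu, inner_zero_right]

/-- An orthonormal basis `b` of eigenfunctions of `Λ_a + P₀`, together with smooth representatives `v`,
the eigenvalues `lam`, which have a positive lower bound `c`, and the convergence of `∑ λ⁻²`. The
eigenvalues are repeated according to multiplicity and need not be ordered. -/
structure EigenData (a : PosSmooth) where
  ι : Type
  b : HilbertBasis ι ℂ L2S
  v : ι → Smooth
  lam : ι → ℝ
  c : ℝ
  c_pos : 0 < c
  c_le : ∀ i, c ≤ lam i
  toL2_v : ∀ i, toL2 (v i) = b i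
  Aop_v : ∀ i, Aop a (v i) = (lam i : ℂ) • v i
  summable : Summable fun i => ((lam i) ^ 2)⁻¹

theorem exists_eigenData (ha : Normalized a) : Nonempty (EigenData a) := by
  obtain ⟨ι, b, ν, hν⟩ := exists_eigenbasis (isCompactOperator_qOp a)
    (fun u v => inner_qOp a u v)
  have hbi : ∀ i, ⟪b i, b i⟫_ℂ = 1 := fun i => by
    rw [inner_self_eq_norm_sq_to_K, b.orthonormal.1 i]; simp
  have hin : ∀ i, ⟪b i, qOp a (b i)⟫_ℂ = ν i := fun i => by
    rw [hν, inner_smul_right, hbi, mul_one]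
  have hne : ∀ i, ν i ≠ 0 := by
    intro i h0
    have h1 := qOp_injective ha (u := b i) (by rw [hν, h0, zero_smul])
    have h2 := b.orthonormal.1 i
    rw [h1, norm_zero] at h2
    exact zero_ne_one h2
  have hreal : ∀ i, ν i = ((ν i).re : ℂ) := by
    intro i
    refine (Complex.conj_eq_iff_re.1 ?_).symm
    rw [← hin i, inner_conj_symm, inner_qOp]
  have hpos : ∀ i, 0 < (ν i).re := by
    intro i
    have h0 : 0 ≤ (ν i).re := by
      rw [← hin i]
      exact re_inner_qOp_self_nonneg ha _
    refine lt_of_le_of_ne h0 fun h => hne i ?_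
    rw [hreal i, ← h, Complex.ofReal_zero]
  have hle : ∀ i, (ν i).re ≤ ‖qOp a‖ := by
    intro i
    have h1 := (qOp a).le_opNorm (b i)
    rw [hν, norm_smul, b.orthonormal.1 i, mul_one, mul_one] at h1
    exact (Complex.re_le_norm _).trans h1
  choose v hv using fun i => exists_toL2_eq_of_qOp_eq ha (hne i) (hν i)
  refine ⟨⟨ι, b, v, fun i => (ν i).re⁻¹, (‖qOp a‖ + 1)⁻¹, by positivity, fun i => ?_, hv,
    fun i => ?_, ?_⟩⟩
  · exact inv_anti₀ (hpos i) ((hle i).trans (by linarith))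
  · refine toL2_injective ?_
    rw [map_smul, hv, Complex.ofReal_inv, ← hreal, ← sub_eq_zero]
    refine qOp_injective ha ?_
    rw [map_sub, map_smul, qOp_toL2_Aop ha, hν, hv, inv_smul_smul₀ (hne i), sub_self]
  · refine (summable_norm_qOp_sq ha b).congr fun i => ?_
    rw [hν, norm_smul, b.orthonormal.1 i, mul_one, inv_pow, inv_inv, hreal i, Complex.norm_real,
      Real.norm_of_nonneg (hpos i).le, Complex.ofReal_re]

namespace EigenData

variable (E : EigenData a)

theorem lam_pos (i : E.ι) : 0 < E.lam i := E.c_pos.trans_le (E.c_le i)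

theorem inner_b_Aop (i : E.ι) (f : Smooth) :
    ⟪E.b i, toL2 (Aop a f)⟫_ℂ = (E.lam i : ℂ) * ⟪E.b i, toL2 f⟫_ℂ := by
  rw [← E.toL2_v, ← inner_Aop, E.Aop_v, map_smul, inner_smul_left, Complex.conj_ofReal]

theorem inner_b_Aop_pow (i : E.ι) (N : ℕ) (f : Smooth) :
    ⟪E.b i, toL2 ((Aop a ^ N) f)⟫_ℂ = ((E.lam i ^ N : ℝ) : ℂ) * ⟪E.b i, toL2 f⟫_ℂ := by
  induction N with
  | zero => simp
  | succ N ih =>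
    rw [pow_succ', Module.End.mul_apply, E.inner_b_Aop, ih, pow_succ]
    push_cast
    ring

theorem starProjection_b (ha : Normalized a) (i : E.ι) (μ : ℝ) [Decidable (E.lam i = μ)] :
    (eigenspace toL2 (ΛP a) μ).starProjection (E.b i) = if E.lam i = μ then E.b i else 0 := by
  split_ifs with h
  · rw [Submodule.starProjection_eq_self_iff]
    refine Submodule.le_topologicalClosure _ ⟨E.v i, ?_, E.toL2_v i⟩
    change (ΛP a - (μ : ℂ) • toL2) (E.v i) = 0
    rw [LinearMap.sub_apply, LinearMap.smul_apply, ← toL2_Aop ha, E.Aop_v, map_smul, h, sub_self]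
  · rw [Submodule.starProjection_apply_eq_zero_iff]
    unfold eigenspace
    rw [Submodule.orthogonal_closure, Submodule.mem_orthogonal']
    rintro _ ⟨f, hf, rfl⟩
    have hf' : toL2 (Aop a f) = (μ : ℂ) • toL2 f := by
      rw [toL2_Aop ha]
      exact sub_eq_zero.1 hf
    have h1 := E.inner_b_Aop i f
    rw [hf', inner_smul_right] at h1
    have h2 : ((μ : ℂ) - E.lam i) * ⟪E.b i, toL2 f⟫_ℂ = 0 := by rw [sub_mul, h1, sub_self]
    rcases mul_eq_zero.1 h2 with h3 | h3
    · exact absurd (by exact_mod_cast (sub_eq_zero.1 h3).symm) h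
    · exact h3

/-- Powers of `Λ_a + P₀` act diagonally in the basis of eigenfunctions. -/
theorem isPower (ha : Normalized a) {r : ℝ} {u w : L2S}
    (h : ∀ i, ⟪E.b i, w⟫_ℂ = ((E.lam i ^ r : ℝ) : ℂ) * ⟪E.b i, u⟫_ℂ) :
    IsPower toL2 (ΛP a) r u w := by
  classical
  have h1 : HasSum (fun i => (((E.lam i ^ r : ℝ) : ℂ) * ⟪E.b i, u⟫_ℂ) • E.b i) w := by
    have := E.b.hasSum_repr w
    simpa only [E.b.repr_apply_apply, h] using this
  have h2 := ((Equiv.sigmaFiberEquiv E.lam).hasSum_iff.2 h1)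
  refine h2.sigma fun μ => ?_
  have h3 := (E.b.hasSum_repr u).mapL (eigenspace toL2 (ΛP a) μ).starProjection
  simp only [map_smul, E.starProjection_b ha, E.b.repr_apply_apply] at h3
  have h4 : HasSum ({i | E.lam i = μ}.indicator fun i => ⟪E.b i, u⟫_ℂ • E.b i)
      ((eigenspace toL2 (ΛP a) μ).starProjection u) := by
    convert h3 using 2 with i
    by_cases hi : E.lam i = μ
    · simp [hi]
    · simp [hi]
  have h5 := (hasSum_subtype_iff_indicator.2 h4).const_smul ((μ ^ r : ℝ) : ℂ)
  have h6 : (fun x : {i // E.lam i = μ} =>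
      ((fun i => (((E.lam i ^ r : ℝ) : ℂ) * ⟪E.b i, u⟫_ℂ) • E.b i) ∘ Equiv.sigmaFiberEquiv E.lam)
        ⟨μ, x⟩) = fun x : {i // E.lam i = μ} => ((μ ^ r : ℝ) : ℂ) • (⟪E.b x, u⟫_ℂ • E.b x) := by
    funext x
    obtain ⟨i, rfl⟩ := x
    exact mul_smul _ _ _
  rw [h6]
  exact h5

theorem lam_rpow_le (r : ℝ) (i : E.ι) :
    E.lam i ^ r ≤ E.c ^ (r - ⌈r⌉₊) * E.lam i ^ ⌈r⌉₊ := by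
  have hl := E.lam_pos i
  have h1 : E.lam i ^ r = E.lam i ^ (r - ⌈r⌉₊) * E.lam i ^ ⌈r⌉₊ := by
    rw [← Real.rpow_natCast, ← Real.rpow_add hl, sub_add_cancel]
  rw [h1]
  refine mul_le_mul_of_nonneg_right ?_ (pow_pos hl _).le
  exact Real.rpow_le_rpow_of_nonpos E.c_pos (E.c_le i) (sub_nonpos.2 (Nat.le_ceil r))

/-- `(Λ_a + P₀)^r` is defined on smooth functions and bounded there by the integral power with
exponent `⌈r⌉₊`. -/
theorem exists_pow (r : ℝ) : ∃ C : ℝ, 0 ≤ C ∧ ∀ f : Smooth, ∃ w : L2S,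
    (∀ i, ⟪E.b i, w⟫_ℂ = ((E.lam i ^ r : ℝ) : ℂ) * ⟪E.b i, toL2 f⟫_ℂ) ∧
      ‖w‖ ≤ C * ‖toL2 ((Aop a ^ ⌈r⌉₊) f)‖ := by
  have hC : 0 ≤ E.c ^ (r - ⌈r⌉₊) := (Real.rpow_pos_of_pos E.c_pos _).le
  refine ⟨E.c ^ (r - ⌈r⌉₊), hC, fun f => ?_⟩
  have hle : ∀ i, ‖((E.lam i ^ r : ℝ) : ℂ) * ⟪E.b i, toL2 f⟫_ℂ‖
      ≤ E.c ^ (r - ⌈r⌉₊) * ‖⟪E.b i, toL2 ((Aop a ^ ⌈r⌉₊) f)⟫_ℂ‖ := by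
    intro i
    have hl := E.lam_pos i
    rw [E.inner_b_Aop_pow, norm_mul, norm_mul, ← mul_assoc, Complex.norm_real, Complex.norm_real,
      Real.norm_of_nonneg (Real.rpow_pos_of_pos hl _).le, Real.norm_of_nonneg (pow_pos hl _).le]
    refine mul_le_mul_of_nonneg_right ?_ (norm_nonneg _)
    exact E.lam_rpow_le r i
  obtain ⟨w, hw⟩ := exists_inner_eq_of_summable_sq E.b
    (c := fun i => ((E.lam i ^ r : ℝ) : ℂ) * ⟪E.b i, toL2 f⟫_ℂ) (by
      refine Summable.of_nonneg_of_le (fun i => by positivity) (fun i => ?_)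
        ((hasSum_norm_inner_sq E.b (toL2 ((Aop a ^ ⌈r⌉₊) f))).summable.mul_left
          ((E.c ^ (r - ⌈r⌉₊)) ^ 2))
      rw [← mul_pow]
      exact pow_le_pow_left₀ (norm_nonneg _) (hle i) 2)
  exact ⟨w, hw, norm_le_of_inner_le E.b hC fun i => by rw [hw]; exact hle i⟩

end EigenData

/-! ### Smoothing kernels -/

/-- Traces of the operators `∑ ⟨·, yₙ⟩ xₙ`: the diagonal sums to `∑ ⟨yₙ, xₙ⟩` in every basis. -/
theorem hasSum_diagonal {κ ι H : Type*} [NormedAddCommGroup H] [InnerProductSpace ℂ H]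
    (β : HilbertBasis ι ℂ H) {T : H → H} {x y : κ → H} (hxy : Summable fun n => ‖x n‖ * ‖y n‖)
    (hT : ∀ u, HasSum (fun n => ⟪y n, u⟫_ℂ • x n) (T u)) :
    HasSum (fun i => ⟪β i, T (β i)⟫_ℂ) (∑' n, ⟪y n, x n⟫_ℂ) := by
  let F : κ × ι → ℂ := fun p => ⟪y p.1, β p.2⟫_ℂ * ⟪β p.2, x p.1⟫_ℂ
  have h1 : ∀ n, HasSum (fun i => F (n, i)) ⟪y n, x n⟫_ℂ := fun n =>
    β.hasSum_inner_mul_inner (y n) (x n)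
  -- the Cauchy–Schwarz inequality for sequences
  have h2 : ∀ n, Summable (fun i => ‖F (n, i)‖) ∧ ∑' i, ‖F (n, i)‖ ≤ ‖x n‖ * ‖y n‖ := by
    intro n
    have hF : ∀ i, ‖F (n, i)‖ = ‖⟪β i, y n⟫_ℂ‖ * ‖⟪β i, x n⟫_ℂ‖ := fun i => by
      rw [norm_mul, norm_inner_symm]
    simp only [hF]
    by_cases hx : x n = 0
    · simp [hx]
    by_cases hy : y n = 0
    · simp [hy]
    have hx' := norm_pos_iff.2 hx
    have hy' := norm_pos_iff.2 hy
    set t := ‖x n‖ / ‖y n‖ with ht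
    have ht0 : 0 < t := div_pos hx' hy'
    have hs := (((hasSum_norm_inner_sq β (y n)).mul_left (t / 2)).add
      ((hasSum_norm_inner_sq β (x n)).mul_left (t⁻¹ / 2)))
    have hle : ∀ i, ‖⟪β i, y n⟫_ℂ‖ * ‖⟪β i, x n⟫_ℂ‖
        ≤ t / 2 * ‖⟪β i, y n⟫_ℂ‖ ^ 2 + t⁻¹ / 2 * ‖⟪β i, x n⟫_ℂ‖ ^ 2 := by
      intro i
      have h := mul_nonneg (inv_pos.2 ht0).le
        (sq_nonneg (t * ‖⟪β i, y n⟫_ℂ‖ - ‖⟪β i, x n⟫_ℂ‖))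
      have e : t⁻¹ * (t * ‖⟪β i, y n⟫_ℂ‖ - ‖⟪β i, x n⟫_ℂ‖) ^ 2
          = t * ‖⟪β i, y n⟫_ℂ‖ ^ 2 - 2 * (‖⟪β i, y n⟫_ℂ‖ * ‖⟪β i, x n⟫_ℂ‖)
            + t⁻¹ * ‖⟪β i, x n⟫_ℂ‖ ^ 2 := by
        field_simp
        ring
      linarith
    have hsum : Summable fun i => ‖⟪β i, y n⟫_ℂ‖ * ‖⟪β i, x n⟫_ℂ‖ :=
      Summable.of_nonneg_of_le (fun i => by positivity) hle hs.summable
    refine ⟨hsum, (hasSum_le hle hsum.hasSum hs).trans (le_of_eq ?_)⟩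
    rw [ht]
    field_simp
    ring
  have hF : Summable F := by
    refine Summable.of_norm ?_
    rw [summable_prod_of_nonneg (fun p => norm_nonneg _)]
    exact ⟨fun n => (h2 n).1, Summable.of_nonneg_of_le
      (fun n => tsum_nonneg fun i => norm_nonneg _) (fun n => (h2 n).2) hxy⟩
  have h3 : ∑' n, ⟪y n, x n⟫_ℂ = ∑' p, F p := (hF.hasSum.prod_fiberwise h1).tsum_eq
  have h4 : ∀ i, HasSum (fun n => F (n, i)) ⟪β i, T (β i)⟫_ℂ := by
    intro i
    have h := (hT (β i)).mapL (innerSL ℂ (β i))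
    simp only [map_smul, innerSL_apply_apply, smul_eq_mul] at h
    exact h
  rw [h3]
  exact ((Equiv.prodComm ι κ).hasSum_iff.2 hF.hasSum).prod_fiberwise h4

theorem hasTrace_of_hasSum {κ H : Type} [NormedAddCommGroup H] [InnerProductSpace ℂ H]
    [CompleteSpace H] (e : κ ≃ ℕ) {T : H →L[ℂ] H} {x y : κ → H}
    (hxy : Summable fun n => ‖x n‖ * ‖y n‖)
    (hT : ∀ u, HasSum (fun n => ⟪y n, u⟫_ℂ • x n) (T u)) :
    HasTrace T (∑' n, ⟪y n, x n⟫_ℂ) := by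
  refine ⟨⟨x ∘ e.symm, y ∘ e.symm, e.symm.summable_iff.2 hxy, fun u => ?_⟩,
    fun ι β => hasSum_diagonal β hxy hT⟩
  exact e.symm.hasSum_iff.2 (hT u)

/-- A matrix indexed by `ℤ × ℤ` whose entries decay faster than any power of the indices. -/
def Rapid (K : ℤ × ℤ → ℂ) : Prop :=
  ∀ N : ℕ, ∃ C : ℝ, ∀ p, ‖K p‖ * ((1 + |(p.1 : ℝ)|) * (1 + |(p.2 : ℝ)|)) ^ N ≤ C

theorem summable_one_add_abs_sq : Summable fun n : ℤ => ((1 + |(n : ℝ)|) ^ 2)⁻¹ := by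
  refine Summable.of_nonneg_of_le (fun n => by positivity) (fun n => ?_)
    (summable_inv_abs_sq.add (hasSum_ite_eq (0 : ℤ) (1 : ℝ)).summable)
  by_cases h : n = 0
  · simp [h]
  · rw [if_neg h, add_zero, inv_pow]
    have : 0 < |(n : ℝ)| := by rw [abs_pos]; exact_mod_cast h
    refine inv_anti₀ (by positivity) ?_
    gcongr
    linarith

theorem Rapid.summable {K : ℤ × ℤ → ℂ} (hK : Rapid K) (N : ℕ) :
    Summable fun p => ‖K p‖ * ((1 + |(p.1 : ℝ)|) * (1 + |(p.2 : ℝ)|)) ^ N := by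
  obtain ⟨C, hC⟩ := hK (N + 2)
  have h := (summable_one_add_abs_sq.mul_of_nonneg summable_one_add_abs_sq
    (fun n => by positivity) (fun n => by positivity)).mul_left C
  refine Summable.of_nonneg_of_le (fun p => by positivity) (fun p => ?_) h
  have h1 := hC p
  set z := (1 + |(p.1 : ℝ)|) * (1 + |(p.2 : ℝ)|) with hz
  have hz0 : 0 < z := by positivity
  rw [← mul_inv, ← mul_pow, ← hz, ← div_eq_mul_inv, le_div_iff₀ (by positivity), mul_assoc,
    ← pow_add]
  exact h1

theorem Rapid.summable_norm {K : ℤ × ℤ → ℂ} (hK : Rapid K) : Summable fun p => ‖K p‖ := by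
  simpa using hK.summable 0

/-- If `σ(m, n)` grows at most like `|m n|` and vanishes unless `m` and `n` have opposite signs, the
matrix `σ(m, n) b̂(m - n)` is rapidly decaying. -/
theorem rapid_kernel (b : Smooth) {σ : ℤ → ℤ → ℂ}
    (h1 : ∀ m n, ‖σ m n‖ ≤ 2 * (|(m : ℝ)| * |(n : ℝ)|)) (h0 : ∀ m n, 0 ≤ m * n → σ m n = 0) :
    Rapid fun p => σ p.1 p.2 * fourierCoeff b.1 (p.1 - p.2) := by
  intro N
  set k := 2 * (N + 1) with hk
  have hb : ∀ l : ℤ, (1 + |(l : ℝ)|) ^ k * ‖fourierCoeff b.1 l‖ ≤ (fwt k b).toReal := by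
    intro l
    rw [← ENNReal.ofReal_le_iff_le_toReal (fwt_ne_top k b), ENNReal.ofReal_mul (by positivity),
      ofReal_norm, ENNReal.ofReal_pow (by positivity)]
    exact ENNReal.le_tsum l
  refine ⟨2 * (fwt k b).toReal, fun p => ?_⟩
  obtain ⟨m, n⟩ := p
  by_cases hmn : 0 ≤ m * n
  · simp [h0 m n hmn]
  have hsum : |((m - n : ℤ) : ℝ)| = |(m : ℝ)| + |(n : ℝ)| := by
    have h : m * n < 0 := not_le.1 hmn
    push_cast
    rcases mul_neg_iff.1 h with ⟨hm, hn⟩ | ⟨hm, hn⟩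
    · have hm' : (0 : ℝ) < m := by exact_mod_cast hm
      have hn' : (n : ℝ) < 0 := by exact_mod_cast hn
      rw [abs_of_pos hm', abs_of_neg hn', abs_of_pos (by linarith), sub_eq_add_neg]
    · have hm' : (m : ℝ) < 0 := by exact_mod_cast hm
      have hn' : (0 : ℝ) < n := by exact_mod_cast hn
      rw [abs_of_neg hm', abs_of_pos hn', abs_of_neg (by linarith)]
      ring
  have hm0 := abs_nonneg (m : ℝ)
  have hn0 := abs_nonneg (n : ℝ)
  have hz : (1 + |(m : ℝ)|) * (1 + |(n : ℝ)|) ≤ (1 + |((m - n : ℤ) : ℝ)|) ^ 2 := by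
    rw [hsum]
    nlinarith [mul_nonneg hm0 hn0]
  have hσ : ‖σ m n‖ ≤ 2 * ((1 + |(m : ℝ)|) * (1 + |(n : ℝ)|)) := by
    refine (h1 m n).trans ?_
    nlinarith [mul_nonneg hm0 hn0]
  change ‖σ m n * fourierCoeff b.1 (m - n)‖ * ((1 + |(m : ℝ)|) * (1 + |(n : ℝ)|)) ^ N ≤ _
  rw [norm_mul]
  calc ‖σ m n‖ * ‖fourierCoeff b.1 (m - n)‖ * ((1 + |(m : ℝ)|) * (1 + |(n : ℝ)|)) ^ N
      ≤ 2 * ((1 + |(m : ℝ)|) * (1 + |(n : ℝ)|)) * ‖fourierCoeff b.1 (m - n)‖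
        * ((1 + |(m : ℝ)|) * (1 + |(n : ℝ)|)) ^ N := by gcongr
    _ = 2 * (((1 + |(m : ℝ)|) * (1 + |(n : ℝ)|)) ^ (N + 1) * ‖fourierCoeff b.1 (m - n)‖) := by ring
    _ ≤ 2 * (((1 + |((m - n : ℤ) : ℝ)|) ^ 2) ^ (N + 1) * ‖fourierCoeff b.1 (m - n)‖) := by gcongr
    _ ≤ 2 * (fwt k b).toReal := by
        rw [← pow_mul]
        exact mul_le_mul_of_nonneg_left (hb _) zero_le_two

theorem norm_coef_le (u : L2S) (n : ℤ) : ‖coef u n‖ ≤ ‖u‖ := by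
  have h := norm_inner_le_norm (𝕜 := ℂ) (toL2 (es n)) u
  rwa [orthonormal_es.1 n, one_mul] at h

/-- An operator with a rapidly decaying matrix is an absolutely convergent sum of operators of rank
one. -/
theorem Rapid.hasSum {K : ℤ × ℤ → ℂ} (hK : Rapid K) {u w : L2S}
    (h : ∀ m, HasSum (fun n => K (m, n) * coef u n) (coef w m)) :
    HasSum (fun p => (K p * coef u p.2) • toL2 (es p.1)) w := by
  have hs : Summable fun p : ℤ × ℤ => (K p * coef u p.2) • toL2 (es p.1) := by
    refine Summable.of_norm_bounded (hK.summable_norm.mul_right ‖u‖) fun p => ?_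
    rw [norm_smul, orthonormal_es.1, mul_one, norm_mul]
    exact mul_le_mul_of_nonneg_left (norm_coef_le _ _) (norm_nonneg _)
  convert hs.hasSum
  refine ext_coef fun l => ?_
  have h1 : HasSum (fun p : ℤ × ℤ => (K p * coef u p.2) * coef (toL2 (es p.1)) l)
      (coef (∑' p : ℤ × ℤ, (K p * coef u p.2) • toL2 (es p.1)) l) := by
    have := hs.hasSum.mapL (innerSL ℂ (toL2 (es l)))
    simp only [map_smul, smul_eq_mul] at this
    exact this
  have h2 := h1.prod_fiberwise fun m => (h m).mul_right (coef (toL2 (es m)) l)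
  refine (HasSum.unique h2 ?_).symm
  have h3 := hasSum_single (f := fun m => coef w m * coef (toL2 (es m)) l) l fun m hm => by
    simp only [coef_es, if_neg hm.symm, mul_zero]
  rwa [coef_es, if_pos rfl, mul_one] at h3

variable (a)

/-- The matrix of `Λ a Λ - D a D` in the exponentials. Here `a.power 1` is `a`, as an element of the
algebra of smooth complex functions. -/
def kerR (p : ℤ × ℤ) : ℂ :=
  ((|(p.1 : ℝ)| * |(p.2 : ℝ)| - p.1 * p.2 : ℝ) : ℂ) * fourierCoeff (a.power 1).1 (p.1 - p.2)

/-- The matrix of `D a Λ - Λ a D`. -/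
def kerS (p : ℤ × ℤ) : ℂ :=
  ((p.1 * |(p.2 : ℝ)| - |(p.1 : ℝ)| * p.2 : ℝ) : ℂ) * fourierCoeff (a.power 1).1 (p.1 - p.2)

theorem abs_mul_abs_of_mul_nonneg {m n : ℤ} (h : 0 ≤ m * n) :
    |(m : ℝ)| * |(n : ℝ)| = m * n ∧ (m : ℝ) * |(n : ℝ)| = |(m : ℝ)| * n := by
  have h' : (0 : ℝ) ≤ m * n := by exact_mod_cast h
  refine ⟨by rw [← abs_mul, abs_of_nonneg h'], ?_⟩
  rcases mul_nonneg_iff.1 h' with ⟨hm, hn⟩ | ⟨hm, hn⟩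
  · rw [abs_of_nonneg hm, abs_of_nonneg hn]
  · rw [abs_of_nonpos hm, abs_of_nonpos hn]; ring

theorem rapid_kerR : Rapid (kerR a) := by
  refine rapid_kernel (a.power 1)
    (σ := fun m n => ((|(m : ℝ)| * |(n : ℝ)| - m * n : ℝ) : ℂ)) (fun m n => ?_) fun m n h => ?_
  · rw [Complex.norm_real]
    refine (norm_sub_le _ _).trans (le_of_eq ?_)
    simp only [norm_mul, Real.norm_eq_abs, abs_abs]
    ring
  · rw [(abs_mul_abs_of_mul_nonneg h).1, sub_self, Complex.ofReal_zero]

theorem rapid_kerS : Rapid (kerS a) := by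
  refine rapid_kernel (a.power 1)
    (σ := fun m n => ((m * |(n : ℝ)| - |(m : ℝ)| * n : ℝ) : ℂ)) (fun m n => ?_) fun m n h => ?_
  · rw [Complex.norm_real]
    refine (norm_sub_le _ _).trans (le_of_eq ?_)
    simp only [norm_mul, Real.norm_eq_abs, abs_abs]
    ring
  · rw [(abs_mul_abs_of_mul_nonneg h).2, sub_self, Complex.ofReal_zero]

/-- The function `a^{1/2} e_m`. -/
def xs (m : ℤ) : Smooth := a.power (1 / 2) * es m

theorem inner_xs (n : ℤ) (f : Smooth) :
    ⟪toL2 (xs a n), toL2 f⟫_ℂ = coef (toL2 (a.power (1 / 2) * f)) n := by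
  rw [xs, ← mulOp_toL2, inner_mulOp (a.conj_power _), mulOp_toL2]
  rfl

theorem power_half_mul_half (f : Smooth) :
    a.power (1 / 2) * (a.power (1 / 2) * f) = a.power 1 * f := by
  rw [← mul_assoc, a.power_mul_power]
  norm_num

theorem hasSum_of_kernel {K : ℤ × ℤ → ℂ} (hK : Rapid K) {f L : Smooth}
    (h : ∀ m, HasSum (fun n => K (m, n) * coef (toL2 (a.power (1 / 2) * f)) n) (coef (toL2 L) m)) :
    HasSum (fun p => (K p * ⟪toL2 (xs a p.2), toL2 f⟫_ℂ) • toL2 (xs a p.1))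
      (toL2 (a.power (1 / 2) * L)) := by
  have h1 := (hK.hasSum h).mapL (mulOp (a.power (1 / 2)))
  simp only [map_smul, mulOp_toL2] at h1
  simp only [inner_xs]
  exact h1

/-- The expansion of `Λ_a² - D_a²` in operators of rank one. -/
theorem hasSum_kerR (f : Smooth) :
    HasSum (fun p => (kerR a p * ⟪toL2 (xs a p.2), toL2 f⟫_ℂ) • toL2 (xs a p.1))
      (toL2 (Λop a (Λop a f) - Dop a (Dop a f))) := by
  set g := a.power (1 / 2) * f with hg
  have e : Λop a (Λop a f) - Dop a (Dop a f)
      = a.power (1 / 2) * (Λ (a.power 1 * Λ g) - D (a.power 1 * D g)) := by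
    rw [Λop_apply, Λop_apply, Dop_apply, Dop_apply, power_half_mul_half, power_half_mul_half,
      mul_sub]
  rw [e]
  refine hasSum_of_kernel a (rapid_kerR a) fun m => ?_
  have h1 := (hasSum_coef_mulOp (b := a.power 1) (toL2 (Λ g)) m).mul_left ((|(m : ℝ)| : ℝ) : ℂ)
  have h2 := (hasSum_coef_mulOp (b := a.power 1) (toL2 (D g)) m).mul_left (m : ℂ)
  rw [mulOp_toL2, ← coef_Λ] at h1
  rw [mulOp_toL2, ← coef_D] at h2
  rw [map_sub, coef_sub]
  refine (h1.sub h2).congr_fun fun n => ?_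
  rw [coef_Λ, coef_D, kerR]
  push_cast
  ring

/-- The expansion of `[D_a, Λ_a]` in operators of rank one. -/
theorem hasSum_kerS (f : Smooth) :
    HasSum (fun p => (kerS a p * ⟪toL2 (xs a p.2), toL2 f⟫_ℂ) • toL2 (xs a p.1))
      (toL2 (Dop a (Λop a f) - Λop a (Dop a f))) := by
  set g := a.power (1 / 2) * f with hg
  have e : Dop a (Λop a f) - Λop a (Dop a f)
      = a.power (1 / 2) * (D (a.power 1 * Λ g) - Λ (a.power 1 * D g)) := by
    rw [Λop_apply, Λop_apply, Dop_apply, Dop_apply, power_half_mul_half, power_half_mul_half,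
      mul_sub]
  rw [e]
  refine hasSum_of_kernel a (rapid_kerS a) fun m => ?_
  have h1 := (hasSum_coef_mulOp (b := a.power 1) (toL2 (Λ g)) m).mul_left (m : ℂ)
  have h2 := (hasSum_coef_mulOp (b := a.power 1) (toL2 (D g)) m).mul_left ((|(m : ℝ)| : ℝ) : ℂ)
  rw [mulOp_toL2, ← coef_D] at h1
  rw [mulOp_toL2, ← coef_Λ] at h2
  rw [map_sub, coef_sub]
  refine (h1.sub h2).congr_fun fun n => ?_
  rw [coef_Λ, coef_D, kerS]
  push_cast
  ring

variable {a}

theorem wt_Aop_le (ha : Normalized a) (k : ℕ) :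
    ∃ C : ℝ≥0∞, C ≠ ⊤ ∧ ∀ f, wt k (toL2 (Aop a f)) ≤ C * wt (k + 1) (toL2 f) := by
  refine ⟨fwt k (a.power (1 / 2)) * fwt (k + 1) (a.power (1 / 2)) + wt k (toL2 (phi0 a)),
    ENNReal.add_ne_top.2 ⟨ENNReal.mul_ne_top (fwt_ne_top _ _) (fwt_ne_top _ _),
      wt_toL2_ne_top _ _⟩, fun f => ?_⟩
  rw [Aop_apply, map_add, map_smul, add_mul]
  refine (wt_add_le _ _ _).trans (add_le_add ?_ ?_)
  · rw [Λop_apply, ← mulOp_toL2, mul_assoc]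
    refine (wt_mulOp_le _ _ _).trans (mul_le_mul_right ?_ _)
    refine (wt_Λ_le _ _).trans ?_
    rw [← mulOp_toL2]
    exact wt_mulOp_le _ _ _
  · rw [wt_smul, mul_comm]
    refine mul_le_mul_right (le_trans ?_ (enorm_le_wt (k + 1) (toL2 f))) _
    rw [← ofReal_norm, ← ofReal_norm]
    refine ENNReal.ofReal_le_ofReal ((norm_inner_le_norm _ _).trans (le_of_eq ?_))
    rw [norm_phi0 ha, one_mul]

theorem wt_Aop_pow_le (ha : Normalized a) (N k : ℕ) :
    ∃ C : ℝ≥0∞, C ≠ ⊤ ∧ ∀ f, wt k (toL2 ((Aop a ^ N) f)) ≤ C * wt (k + N) (toL2 f) := by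
  induction N generalizing k with
  | zero => exact ⟨1, ENNReal.one_ne_top, fun f => by simp⟩
  | succ N ih =>
    obtain ⟨C, hC, h⟩ := wt_Aop_le ha k
    obtain ⟨C', hC', h'⟩ := ih (k + 1)
    refine ⟨C * C', ENNReal.mul_ne_top hC hC', fun f => ?_⟩
    rw [pow_succ', Module.End.mul_apply, mul_assoc]
    refine (h _).trans (mul_le_mul_right ((h' f).trans ?_) _)
    rw [show k + 1 + N = k + (N + 1) by ring]

/-- The norms of `(Λ_a + P₀)^N a^{1/2} e_m` grow polynomially in `m`. -/
theorem norm_Aop_pow_xs_le (ha : Normalized a) (N : ℕ) :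
    ∃ C : ℝ, 0 ≤ C ∧ ∀ m, ‖toL2 ((Aop a ^ N) (xs a m))‖ ≤ C * (1 + |(m : ℝ)|) ^ N := by
  obtain ⟨C, hC, h⟩ := wt_Aop_pow_le ha N 0
  refine ⟨(C * fwt N (a.power (1 / 2))).toReal, ENNReal.toReal_nonneg, fun m => ?_⟩
  have hC' := ENNReal.mul_ne_top hC (fwt_ne_top N (a.power (1 / 2)))
  rw [← ENNReal.ofReal_le_ofReal_iff (by positivity), ENNReal.ofReal_mul ENNReal.toReal_nonneg,
    ENNReal.ofReal_toReal hC', ofReal_norm, ENNReal.ofReal_pow (by positivity)]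
  refine (enorm_le_wt 0 _).trans ((h _).trans ?_)
  rw [mul_assoc, zero_add]
  refine mul_le_mul_right ?_ _
  rw [xs, ← mulOp_toL2]
  refine (wt_mulOp_le _ _ _).trans (le_of_eq ?_)
  rw [wt_es, wf]

/-- The operator `(Λ_a + P₀)^r (Λ_a² - D_a²)` extends to a trace class operator. -/
theorem EigenData.exists_traceClass (ha : Normalized a) (E : EigenData a) (r : ℝ) :
    ∃ (T : L2S →L[ℂ] L2S) (t : ℂ), HasTrace T t ∧ ∀ i f, ⟪E.b i, T (toL2 f)⟫_ℂ
      = ((E.lam i ^ r : ℝ) : ℂ) * ⟪E.b i, toL2 (Λop a (Λop a f) - Dop a (Dop a f))⟫_ℂ := by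
  obtain ⟨C, hC0, hC⟩ := E.exists_pow r
  choose w hw hwn using fun m => hC (xs a m)
  obtain ⟨C1, hC1, h1⟩ := norm_Aop_pow_xs_le ha ⌈r⌉₊
  obtain ⟨C2, hC2, h2⟩ := norm_Aop_pow_xs_le ha 0
  set N := ⌈r⌉₊ with hN
  have hsum : Summable fun p : ℤ × ℤ => ‖kerR a p • w p.1‖ * ‖toL2 (xs a p.2)‖ := by
    refine Summable.of_nonneg_of_le (fun p => by positivity) (fun p => ?_)
      (((rapid_kerR a).summable N).mul_left (C * C1 * C2))
    have e1 : ‖w p.1‖ ≤ C * (C1 * (1 + |(p.1 : ℝ)|) ^ N) :=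
      (hwn p.1).trans (mul_le_mul_of_nonneg_left (h1 _) hC0)
    have e2 : ‖toL2 (xs a p.2)‖ ≤ C2 * (1 + |(p.2 : ℝ)|) ^ N := by
      refine (h2 p.2).trans (mul_le_mul_of_nonneg_left ?_ hC2)
      rw [pow_zero]
      exact one_le_pow₀ (by linarith [abs_nonneg (p.2 : ℝ)])
    rw [norm_smul]
    calc ‖kerR a p‖ * ‖w p.1‖ * ‖toL2 (xs a p.2)‖
        ≤ ‖kerR a p‖ * (C * (C1 * (1 + |(p.1 : ℝ)|) ^ N)) * (C2 * (1 + |(p.2 : ℝ)|) ^ N) := by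
          gcongr
      _ = _ := by rw [mul_pow]; ring
  have hsum' : Summable fun p : ℤ × ℤ =>
      InnerProductSpace.rankOne ℂ (kerR a p • w p.1) (toL2 (xs a p.2)) := by
    refine Summable.of_norm ?_
    simpa only [InnerProductSpace.norm_rankOne] using hsum
  have hT : ∀ u, HasSum (fun p : ℤ × ℤ => ⟪toL2 (xs a p.2), u⟫_ℂ • (kerR a p • w p.1))
      ((∑' p : ℤ × ℤ, InnerProductSpace.rankOne ℂ (kerR a p • w p.1) (toL2 (xs a p.2))) u) := by
    intro u
    exact hsum'.hasSum.mapL (ContinuousLinearMap.apply ℂ L2S u)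
  refine ⟨_, _, hasTrace_of_hasSum (Denumerable.eqv (ℤ × ℤ)) hsum hT, fun i f => ?_⟩
  have h3 := (hT (toL2 f)).mapL (innerSL ℂ (E.b i))
  have h4 := ((hasSum_kerR a f).mapL (innerSL ℂ (E.b i))).mul_left ((E.lam i ^ r : ℝ) : ℂ)
  refine h3.unique ?_
  refine h4.congr_fun fun p => ?_
  simp only [map_smul, innerSL_apply_apply, smul_eq_mul, hw]
  ring

/-! ### The trace as a double sum over pairs of eigenvalues -/

namespace EigenData

variable (E : EigenData a)

/-- The matrix `⟨φ_m, (D_a + P₀) φ_n⟩`. -/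
def mat (m n : E.ι) : ℂ := ⟪E.b m, toL2 (Eop a (E.v n))⟫_ℂ

theorem norm_mat_comm (m n : E.ι) : ‖E.mat m n‖ = ‖E.mat n m‖ := by
  rw [mat, mat, ← E.toL2_v, ← E.toL2_v, ← inner_Eop, norm_inner_symm]

/-- The weights `|⟨φ_m, (D_a + P₀) φ_n⟩|² / (λ_m λ_n)`. -/
def weight (m n : E.ι) : ℝ := ‖E.mat m n‖ ^ 2 / (E.lam m * E.lam n)

theorem weight_nonneg (m n : E.ι) : 0 ≤ E.weight m n :=
  div_nonneg (by positivity) (mul_pos (E.lam_pos m) (E.lam_pos n)).le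

theorem weight_comm (m n : E.ι) : E.weight m n = E.weight n m := by
  rw [weight, weight, norm_mat_comm, mul_comm]

theorem qOp_b (ha : Normalized a) (m : E.ι) :
    qOp a (E.b m) = ((E.lam m)⁻¹ : ℂ) • E.b m := by
  have h := qOp_toL2_Aop ha (E.v m)
  have h0 : (E.lam m : ℂ) ≠ 0 := by exact_mod_cast (E.lam_pos m).ne'
  rw [E.Aop_v, map_smul, map_smul, E.toL2_v] at h
  rw [← h, inv_smul_smul₀ h0, h]

/-- The weights form a doubly stochastic matrix. -/
theorem hasSum_weight (ha : Normalized a) (n : E.ι) : HasSum (fun m => E.weight m n) 1 := by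
  have h := inner_Eop_qOp_Eop ha (E.v n)
  have h1 : ⟪E.b n, E.b n⟫_ℂ = 1 := by
    rw [inner_self_eq_norm_sq_to_K, E.b.orthonormal.1 n]; simp
  rw [E.Aop_v, map_smul, inner_smul_right, E.toL2_v, h1, mul_one] at h
  have h2 := (E.b.hasSum_inner_mul_inner (toL2 (Eop a (E.v n)))
    (qOp a (toL2 (Eop a (E.v n))))).mapL Complex.reCLM
  rw [h] at h2
  have h3 := h2.mul_right (E.lam n)⁻¹
  change HasSum _ (E.lam n * (E.lam n)⁻¹) at h3
  rw [mul_inv_cancel₀ (E.lam_pos n).ne'] at h3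
  refine h3.congr_fun fun m => ?_
  rw [← inner_qOp, E.qOp_b ha, inner_smul_left, ← inner_conj_symm _ (E.b m), map_inv₀,
    Complex.conj_ofReal, mul_left_comm, ← Complex.normSq_eq_conj_mul_self, ← Complex.ofReal_inv,
    ← Complex.ofReal_mul, Complex.normSq_eq_norm_sq]
  change _ = (E.lam m)⁻¹ * ‖E.mat m n‖ ^ 2 * (E.lam n)⁻¹
  rw [weight, div_eq_mul_inv, mul_inv]
  ring

theorem norm_mat_sq_le (ha : Normalized a) (m n : E.ι) :
    ‖E.mat m n‖ ^ 2 ≤ E.lam m * E.lam n := by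
  have h := le_hasSum (E.hasSum_weight ha n) m fun i _ => E.weight_nonneg i n
  rwa [weight, div_le_one (mul_pos (E.lam_pos m) (E.lam_pos n))] at h

theorem norm_mat_le (ha : Normalized a) (m n : E.ι) :
    ‖E.mat m n‖ ≤ E.c⁻¹ * (E.lam m * E.lam n) := by
  have h := E.norm_mat_sq_le ha m n
  have hc := E.c_pos
  have hz : E.c ^ 2 ≤ E.lam m * E.lam n := by
    rw [sq]
    exact mul_le_mul (E.c_le m) (E.c_le n) hc.le (E.lam_pos m).le
  refine (sq_le_sq₀ (norm_nonneg _)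
    (mul_pos (inv_pos.2 hc) (mul_pos (E.lam_pos m) (E.lam_pos n))).le).1 (h.trans ?_)
  set z := E.lam m * E.lam n with hzdef
  have hz0 : 0 < z := mul_pos (E.lam_pos m) (E.lam_pos n)
  rw [mul_pow, inv_pow, ← div_eq_inv_mul, le_div_iff₀ (by positivity)]
  nlinarith

/-- The matrix of the commutator of `D_a + P₀` and `Λ_a + P₀`. -/
theorem mat_mul_sub (ha : Normalized a) (m n : E.ι) :
    E.mat m n * ((E.lam n : ℂ) - E.lam m)
      = ⟪E.b m, toL2 (Dop a (Λop a (E.v n)) - Λop a (Dop a (E.v n)))⟫_ℂ := by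
  rw [← Eop_Aop_commutator ha, map_sub, inner_sub_right, E.inner_b_Aop, E.Aop_v, map_smul, map_smul,
    inner_smul_right, mat]
  ring

theorem norm_inner_xs_le (ha : Normalized a) (N : ℕ) :
    ∃ C : ℝ, 0 ≤ C ∧ ∀ i q, ‖⟪E.b i, toL2 (xs a q)⟫_ℂ‖
      ≤ (E.lam i ^ N)⁻¹ * (C * (1 + |(q : ℝ)|) ^ N) := by
  obtain ⟨C, hC, h⟩ := norm_Aop_pow_xs_le ha N
  refine ⟨C, hC, fun i q => ?_⟩
  have hl : 0 < E.lam i ^ N := pow_pos (E.lam_pos i) N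
  rw [← div_eq_inv_mul, le_div_iff₀ hl]
  have h1 := norm_inner_le_norm (𝕜 := ℂ) (E.b i) (toL2 ((Aop a ^ N) (xs a q)))
  rw [E.inner_b_Aop_pow, E.b.orthonormal.1 i, one_mul, norm_mul, Complex.norm_real,
    Real.norm_of_nonneg hl.le, mul_comm] at h1
  exact h1.trans (h q)

/-- The commutator `[D_a, Λ_a]` is smoothing: its matrix decays rapidly in both eigenvalues. -/
theorem norm_commutator_le (ha : Normalized a) (N N' : ℕ) : ∃ C : ℝ, 0 ≤ C ∧ ∀ m n,
    ‖⟪E.b m, toL2 (Dop a (Λop a (E.v n)) - Λop a (Dop a (E.v n)))⟫_ℂ‖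
      ≤ C * ((E.lam m ^ N)⁻¹ * (E.lam n ^ N')⁻¹) := by
  obtain ⟨C, hC, h⟩ := E.norm_inner_xs_le ha N
  obtain ⟨C', hC', h'⟩ := E.norm_inner_xs_le ha N'
  have hs := (rapid_kerS a).summable (N + N')
  refine ⟨(∑' p, ‖kerS a p‖ * ((1 + |(p.1 : ℝ)|) * (1 + |(p.2 : ℝ)|)) ^ (N + N')) * (C * C'),
    mul_nonneg (tsum_nonneg fun p => by positivity) (mul_nonneg hC hC'), fun m n => ?_⟩
  have hm := pow_pos (E.lam_pos m) N
  have hn := pow_pos (E.lam_pos n) N'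
  have h1 := (hasSum_kerS a (E.v n)).mapL (innerSL ℂ (E.b m))
  have h2 := hs.hasSum.mul_right (C * C' * ((E.lam m ^ N)⁻¹ * (E.lam n ^ N')⁻¹))
  rw [mul_assoc]
  refine h1.norm_le_of_bounded h2 fun p => ?_
  rw [map_smul, innerSL_apply_apply, E.toL2_v, norm_smul, norm_mul, norm_inner_symm _ (E.b n)]
  have hp1 : 1 ≤ 1 + |(p.1 : ℝ)| := by linarith [abs_nonneg (p.1 : ℝ)]
  have hp2 : 1 ≤ 1 + |(p.2 : ℝ)| := by linarith [abs_nonneg (p.2 : ℝ)]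
  calc ‖kerS a p‖ * ‖⟪E.b n, toL2 (xs a p.2)⟫_ℂ‖ * ‖⟪E.b m, toL2 (xs a p.1)⟫_ℂ‖
      ≤ ‖kerS a p‖ * ((E.lam n ^ N')⁻¹ * (C' * (1 + |(p.2 : ℝ)|) ^ N'))
        * ((E.lam m ^ N)⁻¹ * (C * (1 + |(p.1 : ℝ)|) ^ N)) := by
          gcongr
          · exact h' n p.2
          · exact h m p.1
    _ = ‖kerS a p‖ * ((1 + |(p.1 : ℝ)|) ^ N * (1 + |(p.2 : ℝ)|) ^ N')
        * (C * C' * ((E.lam m ^ N)⁻¹ * (E.lam n ^ N')⁻¹)) := by ring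
    _ ≤ ‖kerS a p‖ * ((1 + |(p.1 : ℝ)|) ^ (N + N') * (1 + |(p.2 : ℝ)|) ^ (N + N'))
        * (C * C' * ((E.lam m ^ N)⁻¹ * (E.lam n ^ N')⁻¹)) := by
          gcongr
          · exact Nat.le_add_right _ _
          · exact Nat.le_add_left _ _
    _ = _ := by rw [mul_pow]

/-- One of the two factors `⟨φ_m, (D_a + P₀) φ_n⟩` in the weight combines with `λ_n - λ_m` to a matrix
entry of the commutator, whose rapid decay absorbs the power `λ_n^s` and the other factor. -/
theorem summable_weight_mul (ha : Normalized a) (s : ℝ) :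
    Summable fun p : E.ι × E.ι =>
      E.weight p.2 p.1 * (E.lam p.1 ^ s * (E.lam p.1 - E.lam p.2)) := by
  set M := ⌈s - 1⌉₊ with hM
  obtain ⟨C, hC, h⟩ := E.norm_commutator_le ha 2 (M + 3)
  have hs := (E.summable.mul_of_nonneg E.summable
    (fun i => by positivity) (fun i => by positivity)).mul_left (E.c⁻¹ * C * E.c ^ (s - 1 - M))
  refine hs.of_norm_bounded fun p => ?_
  obtain ⟨n, m⟩ := p
  have hn := E.lam_pos n
  have hm := E.lam_pos m
  have hc := E.c_pos
  have e1 : ‖E.mat m n‖ * |E.lam n - E.lam m| ≤ C * ((E.lam m ^ 2)⁻¹ * (E.lam n ^ (M + 3))⁻¹) := by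
    have := h m n
    rwa [← E.mat_mul_sub ha, norm_mul, ← Complex.ofReal_sub, Complex.norm_real,
      Real.norm_eq_abs] at this
  have e2 : E.lam n ^ s = E.lam n ^ (s - 1) * E.lam n := by
    rw [← Real.rpow_add_one hn.ne', sub_add_cancel]
  have e3 := E.lam_rpow_le (s - 1) n
  have e4 := E.norm_mat_le ha m n
  have e5 : 0 < E.lam n ^ (s - 1) := Real.rpow_pos_of_pos hn _
  have e6 : 0 < E.c ^ (s - 1 - M) := Real.rpow_pos_of_pos hc _
  change ‖E.weight m n * (E.lam n ^ s * (E.lam n - E.lam m))‖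
    ≤ E.c⁻¹ * C * E.c ^ (s - 1 - M) * ((E.lam n ^ 2)⁻¹ * (E.lam m ^ 2)⁻¹)
  rw [norm_mul, norm_mul, Real.norm_of_nonneg (E.weight_nonneg m n),
    Real.norm_of_nonneg (Real.rpow_pos_of_pos hn s).le, Real.norm_eq_abs, weight, e2]
  calc ‖E.mat m n‖ ^ 2 / (E.lam m * E.lam n)
        * (E.lam n ^ (s - 1) * E.lam n * |E.lam n - E.lam m|)
      = ‖E.mat m n‖ * (‖E.mat m n‖ * |E.lam n - E.lam m|) * (E.lam m)⁻¹ * E.lam n ^ (s - 1) := by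
        field_simp
    _ ≤ (E.c⁻¹ * (E.lam m * E.lam n)) * (C * ((E.lam m ^ 2)⁻¹ * (E.lam n ^ (M + 3))⁻¹))
        * (E.lam m)⁻¹ * (E.c ^ (s - 1 - M) * E.lam n ^ M) := by
        gcongr
    _ = E.c⁻¹ * C * E.c ^ (s - 1 - M) * ((E.lam n ^ 2)⁻¹ * (E.lam m ^ 2)⁻¹) := by
        field_simp
        ring

theorem inner_b_sq_sub_sq (ha : Normalized a) (n : E.ι) :
    ⟪E.b n, toL2 (Λop a (Λop a (E.v n)) - Dop a (Dop a (E.v n)))⟫_ℂ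
      = ((E.lam n ^ 2 - ‖toL2 (Eop a (E.v n))‖ ^ 2 : ℝ) : ℂ) := by
  have h1 : ⟪E.b n, E.b n⟫_ℂ = 1 := by
    rw [inner_self_eq_norm_sq_to_K, E.b.orthonormal.1 n]; simp
  rw [← Aop_sq_sub_Eop_sq ha, map_sub, inner_sub_right, E.inner_b_Aop, E.inner_b_Aop, E.toL2_v, h1,
    ← E.toL2_v, ← inner_Eop, inner_self_eq_norm_sq_to_K]
  push_cast
  rw [mul_one, ← sq]
  rfl

/-- The diagonal entries of `(Λ_a + P₀)^{s-1} (Λ_a² - D_a²)` in terms of the weights. -/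
theorem hasSum_weight_mul (ha : Normalized a) (s : ℝ) (n : E.ι) :
    HasSum (fun m => E.weight m n * (E.lam n ^ s * (E.lam n - E.lam m)))
      (E.lam n ^ (s - 1) * (E.lam n ^ 2 - ‖toL2 (Eop a (E.v n))‖ ^ 2)) := by
  have hn := E.lam_pos n
  have h1 := (E.hasSum_weight ha n).mul_right (E.lam n ^ s * E.lam n)
  have h2 := (hasSum_norm_inner_sq E.b (toL2 (Eop a (E.v n)))).mul_right (E.lam n ^ (s - 1))
  have e2 : E.lam n ^ s = E.lam n ^ (s - 1) * E.lam n := by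
    rw [← Real.rpow_add_one hn.ne', sub_add_cancel]
  have h3 := h1.sub h2
  have e3 : 1 * (E.lam n ^ s * E.lam n) - ‖toL2 (Eop a (E.v n))‖ ^ 2 * E.lam n ^ (s - 1)
      = E.lam n ^ (s - 1) * (E.lam n ^ 2 - ‖toL2 (Eop a (E.v n))‖ ^ 2) := by
    rw [e2]; ring
  rw [e3] at h3
  refine h3.congr_fun fun m => ?_
  change _ = E.weight m n * (E.lam n ^ s * E.lam n) - ‖E.mat m n‖ ^ 2 * E.lam n ^ (s - 1)
  have hm := E.lam_pos m
  rw [weight, e2]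
  field_simp

/-- The symmetrized expression `½ ∑ w_{mn} (λ_n^s - λ_m^s) (λ_n - λ_m)` of the trace. -/
theorem hasSum_symmetrized (ha : Normalized a) (s : ℝ) : ∃ t : ℝ,
    HasSum (fun n => E.lam n ^ (s - 1) * (E.lam n ^ 2 - ‖toL2 (Eop a (E.v n))‖ ^ 2)) t ∧
    HasSum (fun p : E.ι × E.ι => E.weight p.2 p.1 *
      ((E.lam p.1 ^ s - E.lam p.2 ^ s) * (E.lam p.1 - E.lam p.2))) (2 * t) := by
  have hs := (E.summable_weight_mul ha s).hasSum
  refine ⟨_, hs.prod_fiberwise fun n => E.hasSum_weight_mul ha s n, ?_⟩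
  have hs' := (Equiv.prodComm E.ι E.ι).hasSum_iff.2 hs
  rw [two_mul]
  refine (hs.add hs').congr_fun fun p => ?_
  change _ = E.weight p.2 p.1 * (E.lam p.1 ^ s * (E.lam p.1 - E.lam p.2))
    + E.weight p.1 p.2 * (E.lam p.2 ^ s * (E.lam p.2 - E.lam p.1))
  rw [E.weight_comm p.1 p.2]
  ring

end EigenData

theorem rpow_sub_mul_sub_pos {x y s : ℝ} (hx : 0 < x) (hy : 0 < y) (hs : 0 < s) (hxy : x ≠ y) :
    0 < (x ^ s - y ^ s) * (x - y) := by
  rcases lt_or_gt_of_ne hxy with h | h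
  · have := Real.rpow_lt_rpow hx.le h hs
    nlinarith
  · have := Real.rpow_lt_rpow hy.le h hs
    nlinarith

theorem rpow_sub_mul_sub_neg {x y s : ℝ} (hx : 0 < x) (hy : 0 < y) (hs : s < 0) (hxy : x ≠ y) :
    (x ^ s - y ^ s) * (x - y) < 0 := by
  rcases lt_or_gt_of_ne hxy with h | h
  · have := Real.rpow_lt_rpow_of_neg hx h hs
    nlinarith
  · have := Real.rpow_lt_rpow_of_neg hy h hs
    nlinarith

/-! ### The equality case on the Fourier side -/

/-- A commutator that vanishes on the eigenfunctions vanishes on all smooth functions, by symmetry. -/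
theorem EigenData.commutator_eq_zero (E : EigenData a)
    (h : ∀ m n, ⟪E.b m, toL2 (Dop a (Λop a (E.v n)) - Λop a (Dop a (E.v n)))⟫_ℂ = 0) (f : Smooth) :
    Dop a (Λop a f) - Λop a (Dop a f) = 0 := by
  have h1 : ∀ n, toL2 (Dop a (Λop a (E.v n)) - Λop a (Dop a (E.v n))) = 0 := fun n =>
    ext_of_inner E.b fun m => by rw [h, inner_zero_right]
  refine toL2_injective (ext_of_inner E.b fun n => ?_)
  have h2 := congrArg (fun u => ⟪u, toL2 f⟫_ℂ) (h1 n)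
  simp only [map_sub, inner_sub_left, inner_zero_left, inner_Dop, inner_Λop, E.toL2_v] at h2
  rw [map_sub, inner_sub_right, map_zero, inner_zero_right, ← neg_sub, h2, neg_zero]

/-- If `D_a` and `Λ_a` commute then `a` is a trigonometric polynomial of degree at most one. -/
theorem fourierCoeff_eq_zero_of_commutator
    (h : ∀ f, Dop a (Λop a f) - Λop a (Dop a f) = 0) {k : ℤ} (hk : 2 ≤ k) :
    fourierCoeff (a.power 1).1 k = 0 := by
  have hΛ : Λ (es (-1)) = es (-1) := by
    refine toL2_injective (ext_coef fun n => ?_)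
    rw [coef_Λ, coef_es]
    by_cases hn : n = -1
    · simp [hn]
    · simp [hn]
  have hD : D (es (-1)) = (-1 : ℂ) • es (-1) := by
    refine toL2_injective (ext_coef fun n => ?_)
    rw [coef_D, map_smul, coef_smul, coef_es]
    by_cases hn : n = -1
    · simp [hn]
    · simp [hn]
  have h1 := h (a.power (-(1 / 2)) * es (-1))
  rw [Λop_apply, Dop_apply, Λop_apply, Dop_apply, power_half_mul_half, power_half_mul_half,
    a.power_half_mul_cancel, hΛ, hD, mul_smul_comm, map_smul, ← mul_sub] at h1
  have h2 := congrArg (a.power (-(1 / 2)) * ·) h1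
  simp only [mul_zero, a.power_neg_half_mul_cancel] at h2
  have h3 := congrArg (fun f => coef (toL2 f) (k - 1)) h2
  simp only [map_sub, map_smul, coef_sub, coef_smul, coef_Λ, coef_D, map_zero] at h3
  rw [neg_one_mul, sub_neg_eq_add, coef_mul_es, show k - 1 - -1 = k by ring] at h3
  have hk1 : (0 : ℝ) < ((k - 1 : ℤ) : ℝ) := by exact_mod_cast (by omega : 0 < k - 1)
  rw [abs_of_pos hk1, Complex.ofReal_intCast, ← add_mul, coef, inner_zero_right] at h3
  rcases mul_eq_zero.1 h3 with h4 | h4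
  · exfalso
    have : (((k - 1 : ℤ) : ℝ) + ((k - 1 : ℤ) : ℝ)) = 0 := by exact_mod_cast h4
    linarith
  · exact h4

/-- The matrix of `Λ a Λ - D a D` is supported on pairs `(m, n)` of opposite signs, for which
`|m - n| ≥ 2`. -/
theorem sq_sub_sq_eq_zero_of_fourierCoeff
    (h : ∀ k : ℤ, 2 ≤ |k| → fourierCoeff (a.power 1).1 k = 0) (f : Smooth) :
    Λop a (Λop a f) - Dop a (Dop a f) = 0 := by
  have hK : ∀ p, kerR a p = 0 := by
    rintro ⟨m, n⟩
    by_cases hmn : 0 ≤ m * n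
    · rw [kerR]
      simp only
      rw [(abs_mul_abs_of_mul_nonneg hmn).1, sub_self, Complex.ofReal_zero, zero_mul]
    · rw [kerR, h, mul_zero]
      rcases mul_neg_iff.1 (not_le.1 hmn) with ⟨hm, hn⟩ | ⟨hm, hn⟩
      · exact (by omega : 2 ≤ m - n).trans (le_abs_self _)
      · exact (by omega : 2 ≤ -(m - n)).trans (neg_le_abs _)
  have h1 := hasSum_kerR a f
  simp only [hK, zero_mul, zero_smul] at h1
  refine toL2_injective ?_
  rw [h1.unique hasSum_zero, map_zero]

/-- The trace exists and has the sign of `s`; it vanishes for some `s ≠ 0` only if `a` is a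
trigonometric polynomial of degree at most one, and then it vanishes identically. -/
theorem exists_trace (ha : Normalized a) : ∃ τ : ℝ → ℝ,
    (∀ s, ∃ T : L2S →L[ℂ] L2S, IsSteklovProduct a s T ∧ HasTrace T (τ s)) ∧
    (∀ s, 0 < s → 0 ≤ τ s) ∧ (∀ s, s < 0 → τ s ≤ 0) ∧
    ((∃ s, s ≠ 0 ∧ τ s = 0) → ∀ k : ℤ, 2 ≤ k → fourierCoeff (a.power 1).1 k = 0) ∧
    ((∀ k : ℤ, 2 ≤ |k| → fourierCoeff (a.power 1).1 k = 0) → ∀ s, τ s = 0) := by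
  obtain ⟨E⟩ := exists_eigenData ha
  choose τ h1 h2 using E.hasSum_symmetrized ha
  have hpos : ∀ s : ℝ, 0 < s → ∀ p : E.ι × E.ι, 0 ≤ E.weight p.2 p.1 *
      ((E.lam p.1 ^ s - E.lam p.2 ^ s) * (E.lam p.1 - E.lam p.2)) := by
    intro s hs p
    refine mul_nonneg (E.weight_nonneg _ _) ?_
    by_cases h : E.lam p.1 = E.lam p.2
    · simp [h]
    · exact (rpow_sub_mul_sub_pos (E.lam_pos _) (E.lam_pos _) hs h).le
  have hneg : ∀ s : ℝ, s < 0 → ∀ p : E.ι × E.ι, 0 ≤ -(E.weight p.2 p.1 *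
      ((E.lam p.1 ^ s - E.lam p.2 ^ s) * (E.lam p.1 - E.lam p.2))) := by
    intro s hs p
    rw [← mul_neg]
    refine mul_nonneg (E.weight_nonneg _ _) ?_
    by_cases h : E.lam p.1 = E.lam p.2
    · simp [h]
    · exact neg_nonneg.2 (rpow_sub_mul_sub_neg (E.lam_pos _) (E.lam_pos _) hs h).le
  refine ⟨τ, fun s => ?_, fun s hs => ?_, fun s hs => ?_, ?_, fun h s => ?_⟩
  · obtain ⟨T, t, hT, hin⟩ := E.exists_traceClass ha (s - 1)
    refine ⟨T, fun f => E.isPower ha fun i => hin i f, ?_⟩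
    convert hT
    have h3 := hT.2 E.ι E.b
    have h4 := (h1 s).mapL Complex.ofRealCLM
    refine h4.unique ?_
    refine h3.congr_fun fun n => ?_
    have h5 := hin n (E.v n)
    rw [E.inner_b_sq_sub_sq ha, E.toL2_v, ← Complex.ofReal_mul] at h5
    rw [h5]
    rfl
  · have := (h2 s).nonneg (hpos s hs)
    linarith
  · have := (h2 s).neg.nonneg (hneg s hs)
    linarith
  · rintro ⟨s, hs, hs0⟩
    have h3 := h2 s
    rw [hs0, mul_zero] at h3
    -- all terms of the symmetrized sum have the same sign, hence vanish
    have h4 : ∀ p : E.ι × E.ι, E.weight p.2 p.1 *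
        ((E.lam p.1 ^ s - E.lam p.2 ^ s) * (E.lam p.1 - E.lam p.2)) = 0 := by
      rcases lt_or_gt_of_ne hs with h | h
      · have h5 := h3.neg
        rw [neg_zero] at h5
        have h6 := (hasSum_zero_iff_of_nonneg (hneg s h)).1 h5
        exact fun p => neg_eq_zero.1 (congrFun h6 p)
      · exact fun p => congrFun ((hasSum_zero_iff_of_nonneg (hpos s h)).1 h3) p
    refine fun k hk => fourierCoeff_eq_zero_of_commutator (E.commutator_eq_zero fun m n => ?_) hk
    rw [← E.mat_mul_sub ha]
    by_cases hmn : E.lam n = E.lam m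
    · rw [hmn, sub_self, mul_zero]
    · have h5 : (E.lam n ^ s - E.lam m ^ s) * (E.lam n - E.lam m) ≠ 0 := by
        rcases lt_or_gt_of_ne hs with h | h
        · exact (rpow_sub_mul_sub_neg (E.lam_pos _) (E.lam_pos _) h hmn).ne
        · exact (rpow_sub_mul_sub_pos (E.lam_pos _) (E.lam_pos _) h hmn).ne'
      have h6 := (mul_eq_zero.1 (h4 (n, m))).resolve_right h5
      have h7 : ‖E.mat m n‖ ^ 2 = 0 :=
        (div_eq_zero_iff.1 h6).resolve_right (mul_pos (E.lam_pos _) (E.lam_pos _)).ne'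
      rw [norm_eq_zero.1 (pow_eq_zero_iff two_ne_zero |>.1 h7), zero_mul]
  · have h3 : ∀ n, E.lam n ^ (s - 1) * (E.lam n ^ 2 - ‖toL2 (Eop a (E.v n))‖ ^ 2) = 0 := by
      intro n
      have h4 := E.inner_b_sq_sub_sq ha n
      rw [sq_sub_sq_eq_zero_of_fourierCoeff h, map_zero, inner_zero_right] at h4
      rw [show E.lam n ^ 2 - ‖toL2 (Eop a (E.v n))‖ ^ 2 = 0 by exact_mod_cast h4.symm, mul_zero]
    have h4 := h1 s
    simp only [h3] at h4
    exact h4.unique hasSum_zero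

/-! ### Conformal transformations of the disk -/

/-- The conformal transformation `z ↦ (z + α) / (1 + ᾱ z)` of the disk. -/
def mob (α z : ℂ) : ℂ := (z + α) / (1 + conj α * z)

theorem mob_den_ne_zero {α z : ℂ} (hα : ‖α‖ < 1) (hz : ‖z‖ ≤ 1) : 1 + conj α * z ≠ 0 := by
  intro h
  have h1 : ‖conj α * z‖ = 1 := by
    rw [show conj α * z = -1 by linear_combination h, norm_neg, norm_one]
  rw [norm_mul, RCLike.norm_conj] at h1
  nlinarith [norm_nonneg α, norm_nonneg z]

theorem one_sub_norm_sq_pos {α : ℂ} (hα : ‖α‖ < 1) : 0 < 1 - ‖α‖ ^ 2 := by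
  nlinarith [norm_nonneg α]

theorem conj_mul_self_eq (α : ℂ) : conj α * α = ((‖α‖ ^ 2 : ℝ) : ℂ) := by
  rw [← Complex.normSq_eq_conj_mul_self, Complex.normSq_eq_norm_sq]

theorem one_sub_conj_mul_mob {α z : ℂ} (hα : ‖α‖ < 1) (hz : ‖z‖ ≤ 1) :
    1 - conj α * mob α z = ((1 - ‖α‖ ^ 2 : ℝ) : ℂ) / (1 + conj α * z) := by
  have h := mob_den_ne_zero hα hz
  have h2 := conj_mul_self_eq α
  rw [mob]
  field_simp
  push_cast at h2 ⊢
  linear_combination -h2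

theorem one_sub_norm_mob_sq {α z : ℂ} (hα : ‖α‖ < 1) (hz : ‖z‖ ≤ 1) :
    1 - ‖mob α z‖ ^ 2 = (1 - ‖z‖ ^ 2) * (1 - ‖α‖ ^ 2) / ‖1 + conj α * z‖ ^ 2 := by
  have h : 0 < ‖1 + conj α * z‖ ^ 2 := by
    have := norm_pos_iff.2 (mob_den_ne_zero hα hz)
    positivity
  rw [mob, norm_div, div_pow, eq_div_iff h.ne', sub_mul, div_mul_cancel₀ _ h.ne', one_mul]
  have e : ((‖1 + conj α * z‖ ^ 2 - ‖z + α‖ ^ 2 : ℝ) : ℂ)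
      = (((1 - ‖z‖ ^ 2) * (1 - ‖α‖ ^ 2) : ℝ) : ℂ) := by
    push_cast
    simp only [← Complex.conj_mul', map_add, map_mul, map_one, Complex.conj_conj]
    ring
  exact_mod_cast e

theorem norm_mob_le {α z : ℂ} (hα : ‖α‖ < 1) (hz : ‖z‖ ≤ 1) : ‖mob α z‖ ≤ 1 := by
  have h := one_sub_norm_mob_sq hα hz
  have h1 := one_sub_norm_sq_pos hα
  have h2 : 0 ≤ 1 - ‖z‖ ^ 2 := by nlinarith [norm_nonneg z]
  have h3 : 0 ≤ 1 - ‖mob α z‖ ^ 2 := by rw [h]; positivity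
  nlinarith [norm_nonneg (mob α z)]

theorem norm_mob_lt {α z : ℂ} (hα : ‖α‖ < 1) (hz : ‖z‖ < 1) : ‖mob α z‖ < 1 := by
  have h := one_sub_norm_mob_sq hα hz.le
  have h1 := one_sub_norm_sq_pos hα
  have h2 := one_sub_norm_sq_pos hz
  have h4 := norm_pos_iff.2 (mob_den_ne_zero hα hz.le)
  have h3 : 0 < 1 - ‖mob α z‖ ^ 2 := by rw [h]; positivity
  nlinarith [norm_nonneg (mob α z)]

theorem norm_mob_eq {α z : ℂ} (hα : ‖α‖ < 1) (hz : ‖z‖ = 1) : ‖mob α z‖ = 1 := by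
  have h := one_sub_norm_mob_sq hα hz.le
  rw [hz, one_pow, sub_self, zero_mul, zero_div, sub_eq_zero] at h
  exact (pow_eq_one_iff_of_nonneg (norm_nonneg _) two_ne_zero).1 h.symm

theorem mob_neg_mob {α z : ℂ} (hα : ‖α‖ < 1) (hz : ‖z‖ ≤ 1) : mob (-α) (mob α z) = z := by
  have h := mob_den_ne_zero hα hz
  have h1 := one_sub_conj_mul_mob hα hz
  have h3 : ((1 - ‖α‖ ^ 2 : ℝ) : ℂ) ≠ 0 := by exact_mod_cast (one_sub_norm_sq_pos hα).ne'
  have h2 := conj_mul_self_eq α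
  rw [mob, map_neg, neg_mul, ← sub_eq_add_neg, ← sub_eq_add_neg, h1, mob, div_sub' h,
    div_div_div_cancel_right₀ h, div_eq_iff h3]
  push_cast at h2 ⊢
  linear_combination -z * h2

theorem mob_mob_neg {α z : ℂ} (hα : ‖α‖ < 1) (hz : ‖z‖ ≤ 1) : mob α (mob (-α) z) = z := by
  have h := mob_neg_mob (α := -α) (by rwa [norm_neg]) hz
  rwa [neg_neg] at h

theorem hasDerivAt_mob {α z : ℂ} (hα : ‖α‖ < 1) (hz : ‖z‖ ≤ 1) :
    HasDerivAt (mob α) (((1 - ‖α‖ ^ 2 : ℝ) : ℂ) / (1 + conj α * z) ^ 2) z := by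
  have h := mob_den_ne_zero hα hz
  have h1 : HasDerivAt (fun z : ℂ => z + α) 1 z := (hasDerivAt_id z).add_const α
  have h2 : HasDerivAt (fun z : ℂ => 1 + conj α * z) (conj α) z := by
    simpa using ((hasDerivAt_id z).const_mul (conj α)).const_add 1
  have h3 := h1.div h2 h
  have e : (1 * (1 + conj α * z) - (z + α) * conj α) = ((1 - ‖α‖ ^ 2 : ℝ) : ℂ) := by
    have h2 := conj_mul_self_eq α
    push_cast at h2 ⊢
    linear_combination -h2
  rw [e] at h3
  exact h3

theorem isConformalDisk_mob {α : ℂ} (hα : ‖α‖ < 1) : IsConformalDisk (mob α) := by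
  have hα' : ‖-α‖ < 1 := by rwa [norm_neg]
  refine ⟨fun z hz => ?_, fun z hz => ?_, ?_⟩
  · rw [mem_closedBall_zero_iff] at hz
    exact (hasDerivAt_mob hα hz).continuousAt.continuousWithinAt
  · rw [mem_ball_zero_iff] at hz
    exact (hasDerivAt_mob hα hz.le).differentiableAt.differentiableWithinAt
  · refine Set.InvOn.bijOn (f' := mob (-α)) ⟨fun z hz => ?_, fun z hz => ?_⟩ (fun z hz => ?_)
      fun z hz => ?_
    · rw [mem_ball_zero_iff] at hz
      exact mob_neg_mob hα hz.le
    · rw [mem_ball_zero_iff] at hz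
      exact mob_mob_neg hα hz.le
    · rw [mem_ball_zero_iff] at hz ⊢
      exact norm_mob_lt hα hz
    · rw [mem_ball_zero_iff] at hz ⊢
      exact norm_mob_lt hα' hz

/-- Conformal transformations of the disk fixing the origin are rotations. After division by the
right power of `z` the function has modulus one on the boundary and no zeros, so it is constant by
the maximum principle applied to it and to its inverse. -/
theorem exists_rotation {f : ℂ → ℂ} (hf : IsConformalDisk f) (h0 : f 0 = 0)
    (h1 : ∀ z, ‖z‖ = 1 → ‖f z‖ = 1) : ∃ η : ℂ, ‖η‖ = 1 ∧ ∀ z, ‖z‖ ≤ 1 → f z = η * z := by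
  obtain ⟨hc, hd, -, hinj, -⟩ := hf
  have hball : Metric.ball (0 : ℂ) 1 ∈ nhds (0 : ℂ) := Metric.ball_mem_nhds 0 one_pos
  have han : AnalyticAt ℂ f 0 := hd.analyticAt hball
  have hne : ∀ z, ‖z‖ ≤ 1 → z ≠ 0 → f z ≠ 0 := by
    intro z hz hz0 hfz
    rcases hz.lt_or_eq with h | h
    · exact hz0 (hinj (mem_ball_zero_iff.2 h) (Metric.mem_ball_self one_pos) (hfz.trans h0.symm))
    · have := h1 z h
      rw [hfz, norm_zero] at this
      exact zero_ne_one this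
  have hnot : ¬ ∀ᶠ z in nhds (0 : ℂ), f z = 0 := by
    intro h
    obtain ⟨ε, hε, hε'⟩ := Metric.eventually_nhds_iff.1 h
    set δ : ℝ := min (ε / 2) (1 / 2) with hδ
    have hδ0 : 0 < δ := lt_min (by linarith) (by norm_num)
    have hn : ‖(δ : ℂ)‖ = δ := by rw [Complex.norm_real, Real.norm_of_nonneg hδ0.le]
    refine hne (δ : ℂ) ?_ (by exact_mod_cast hδ0.ne') (hε' ?_)
    · rw [hn]; exact (min_le_right _ _).trans (by norm_num)
    · rw [dist_zero_right, hn]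
      exact (min_le_left _ _).trans_lt (by linarith)
  obtain ⟨n, g, hg, hg0, hfg⟩ := han.exists_eventuallyEq_pow_smul_nonzero_iff.2 hnot
  simp only [sub_zero, smul_eq_mul] at hfg
  set h : ℂ → ℂ := fun z => if z = 0 then g 0 else f z / z ^ n with hh
  have hhg : h =ᶠ[nhds 0] g := by
    filter_upwards [hfg] with z hz
    by_cases hz0 : z = 0
    · simp [hh, hz0]
    · simp only [hh, if_neg hz0]
      rw [hz, mul_div_cancel_left₀ _ (pow_ne_zero n hz0)]
  have hfh : ∀ z, z ≠ 0 → h =ᶠ[nhds z] fun z => f z / z ^ n := by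
    intro z hz
    filter_upwards [isOpen_ne.mem_nhds hz] with w hw
    simp only [hh]
    exact if_neg hw
  have hhn : ∀ z, ‖z‖ ≤ 1 → h z ≠ 0 := by
    intro z hz
    by_cases hz0 : z = 0
    · simpa [hh, hz0] using hg0
    · simp only [hh, if_neg hz0]
      exact div_ne_zero (hne z hz hz0) (pow_ne_zero n hz0)
  have hhd : DiffContOnCl ℂ h (Metric.ball 0 1) := by
    refine ⟨fun z hz => ?_, fun z hz => ?_⟩
    · by_cases hz0 : z = 0
      · subst hz0
        exact (hg.differentiableAt.congr_of_eventuallyEq hhg).differentiableWithinAt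
      · refine (DifferentiableAt.congr_of_eventuallyEq ?_ (hfh z hz0)).differentiableWithinAt
        exact ((hd z hz).differentiableAt (Metric.isOpen_ball.mem_nhds hz)).div
          (differentiableAt_id.pow n) (pow_ne_zero n hz0)
    · rw [closure_ball (0 : ℂ) one_ne_zero] at hz ⊢
      by_cases hz0 : z = 0
      · subst hz0
        exact (hg.continuousAt.congr hhg.symm).continuousWithinAt
      · have h2 : ContinuousWithinAt (fun z => f z / z ^ n) (Metric.closedBall 0 1) z :=
          (hc z hz).div (continuousWithinAt_id.pow n) (pow_ne_zero n hz0)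
        exact h2.congr_of_eventuallyEq ((hfh z hz0).filter_mono nhdsWithin_le_nhds)
          (by simp only [hh, if_neg hz0])
  have hh1 : ∀ z ∈ frontier (Metric.ball (0 : ℂ) 1), ‖h z‖ = 1 := by
    intro z hz
    rw [frontier_ball (0 : ℂ) one_ne_zero, mem_sphere_zero_iff_norm] at hz
    have hz0 : z ≠ 0 := by
      rintro rfl
      rw [norm_zero] at hz
      exact zero_ne_one hz
    simp only [hh, if_neg hz0]
    rw [norm_div, norm_pow, hz, h1 z hz, one_pow, div_one]
  have hcl : ∀ z : ℂ, ‖z‖ ≤ 1 → z ∈ closure (Metric.ball (0 : ℂ) 1) := by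
    intro z hz
    rwa [closure_ball (0 : ℂ) one_ne_zero, mem_closedBall_zero_iff]
  have hle : ∀ z : ℂ, ‖z‖ ≤ 1 → ‖h z‖ ≤ 1 := fun z hz =>
    Complex.norm_le_of_forall_mem_frontier_norm_le Metric.isBounded_ball hhd
      (fun z hz => (hh1 z hz).le) (hcl z hz)
  have hge : ∀ z : ℂ, ‖z‖ ≤ 1 → 1 ≤ ‖h z‖ := by
    intro z hz
    have hinv : DiffContOnCl ℂ (fun z => (h z)⁻¹) (Metric.ball 0 1) :=
      hhd.inv fun z hz => hhn z (by
        rwa [closure_ball (0 : ℂ) one_ne_zero, mem_closedBall_zero_iff] at hz)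
    have h2 := Complex.norm_le_of_forall_mem_frontier_norm_le Metric.isBounded_ball hinv
      (C := 1) (fun z hz => by rw [norm_inv, hh1 z hz, inv_one]) (hcl z hz)
    rw [norm_inv] at h2
    exact (inv_le_one₀ (norm_pos_iff.2 (hhn z hz))).1 h2
  have hη : ‖h 0‖ = 1 := le_antisymm (hle 0 (by simp)) (hge 0 (by simp))
  have hconst : ∀ z : ℂ, ‖z‖ ≤ 1 → h z = h 0 := by
    intro z hz
    refine Complex.eqOn_closedBall_of_isMaxOn_norm hhd (fun w hw => ?_)
      (mem_closedBall_zero_iff.2 hz)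
    change ‖h w‖ ≤ ‖h 0‖
    rw [hη]
    exact hle w (mem_ball_zero_iff.1 hw).le
  have hfz : ∀ z : ℂ, ‖z‖ ≤ 1 → z ≠ 0 → f z = h 0 * z ^ n := by
    intro z hz hz0
    rw [← hconst z hz]
    simp only [hh, if_neg hz0]
    rw [div_mul_cancel₀ _ (pow_ne_zero n hz0)]
  have hn0 : n ≠ 0 := by
    intro hn
    have h2 := hfg.self_of_nhds
    rw [h0, hn, pow_zero, one_mul] at h2
    exact hg0 h2.symm
  -- injectivity forces the zero to be simple
  have hn1 : n = 1 := by
    by_contra hn1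
    have hprim := Complex.isPrimitiveRoot_exp n hn0
    set ζ := Complex.exp (2 * Real.pi * Complex.I / n) with hζ
    have hζ1 : ‖ζ‖ = 1 := Complex.norm_eq_one_of_pow_eq_one hprim.pow_eq_one hn0
    have hhalf : ‖(1 / 2 : ℂ)‖ = 1 / 2 := by simp
    have hζhalf : ‖ζ * (1 / 2 : ℂ)‖ = 1 / 2 := by rw [norm_mul, hζ1, hhalf, one_mul]
    have hζ0 : ζ * (1 / 2 : ℂ) ≠ 0 := by
      rw [← norm_pos_iff, hζhalf]; norm_num
    have heq : f (ζ * (1 / 2 : ℂ)) = f (1 / 2 : ℂ) := by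
      rw [hfz _ (by rw [hζhalf]; norm_num) hζ0, hfz _ (by rw [hhalf]; norm_num) (by norm_num),
        mul_pow, hprim.pow_eq_one, one_mul]
    have h3 := hinj (mem_ball_zero_iff.2 (by rw [hζhalf]; norm_num))
      (mem_ball_zero_iff.2 (by rw [hhalf]; norm_num)) heq
    have h4 : ζ = 1 := by linear_combination 2 * h3
    exact hn1 (hprim.eq_orderOf.trans (by rw [h4, orderOf_one]))
  refine ⟨h 0, hη, fun z hz => ?_⟩
  by_cases hz0 : z = 0
  · rw [hz0, h0, mul_zero]
  · rw [hfz z hz hz0, hn1, pow_one]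

/-- Every conformal transformation of the disk is a Möbius transformation. -/
theorem exists_eq_mob {Φ : ℂ → ℂ} (hΦ : IsConformalDisk Φ) (h1 : ∀ z, ‖z‖ = 1 → ‖Φ z‖ = 1) :
    ∃ η α : ℂ, ‖η‖ = 1 ∧ ‖α‖ < 1 ∧ ∀ z, ‖z‖ ≤ 1 → Φ z = η * mob α z := by
  obtain ⟨z₀, hz₀, hΦ0⟩ := hΦ.2.2.surjOn (Metric.mem_ball_self (x := (0 : ℂ)) one_pos)
  rw [mem_ball_zero_iff] at hz₀
  have hm := isConformalDisk_mob hz₀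
  have hcomp : IsConformalDisk (Φ ∘ mob z₀) := by
    refine ⟨hΦ.1.comp hm.1 fun z hz => ?_, hΦ.2.1.comp hm.2.1 hm.2.2.mapsTo,
      hΦ.2.2.comp hm.2.2⟩
    rw [mem_closedBall_zero_iff] at hz ⊢
    exact norm_mob_le hz₀ hz
  obtain ⟨η, hη, h⟩ := exists_rotation hcomp
    (by simp only [Function.comp, mob, mul_zero, zero_add, add_zero, div_one]; exact hΦ0)
    (fun z hz => h1 _ (norm_mob_eq hz₀ hz))
  have hz₀' : ‖-z₀‖ < 1 := by rwa [norm_neg]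
  refine ⟨η, -z₀, hη, hz₀', fun z hz => ?_⟩
  rw [← h _ (norm_mob_le hz₀' hz), Function.comp, mob_mob_neg hz₀ hz]

theorem norm_exp_I_mul (t : ℝ) : ‖Complex.exp (Complex.I * t)‖ = 1 := by
  rw [mul_comm, Complex.norm_exp_ofReal_mul_I]

theorem exists_exp_eq {w : ℂ} (hw : ‖w‖ = 1) : ∃ t : ℝ, Complex.exp (Complex.I * t) = w := by
  refine ⟨w.arg, ?_⟩
  have := Complex.norm_mul_exp_arg_mul_I w
  rwa [hw, Complex.ofReal_one, one_mul, mul_comm] at this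

theorem hasDerivAt_exp_I_mul (θ : ℝ) :
    HasDerivAt (fun θ : ℝ => Complex.exp (Complex.I * θ))
      (Complex.I * Complex.exp (Complex.I * θ)) θ := by
  have h1 : HasDerivAt (fun θ : ℝ => Complex.I * (θ : ℂ)) Complex.I θ := by
    simpa using (Complex.ofRealCLM.hasDerivAt (x := θ)).const_mul Complex.I
  have h2 := h1.cexp
  rwa [mul_comm] at h2

/-- The derivative of the boundary map of a conformal transformation, as a function of the image
point. -/
theorem exists_abs_deriv_eq {Φ : ℂ → ℂ} (hΦ : IsConformalDisk Φ) {ψ : ℝ → ℝ}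
    (hψ : Differentiable ℝ ψ)
    (h : ∀ θ : ℝ, Complex.exp (Complex.I * ψ θ) = Φ (Complex.exp (Complex.I * θ))) :
    ∃ γ : ℂ, ∀ t : ℝ, ∃ θ : ℝ, Complex.exp (Complex.I * t) = Complex.exp (Complex.I * ψ θ) ∧
      |deriv ψ θ| = ‖1 - γ * Complex.exp (Complex.I * t)‖ ^ 2 / (1 - ‖γ‖ ^ 2) := by
  obtain ⟨η, α, hη, hα, hΦe⟩ := exists_eq_mob hΦ fun z hz => by
    obtain ⟨θ, rfl⟩ := exists_exp_eq hz
    rw [← h, norm_exp_I_mul]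
  have hα' : ‖-α‖ < 1 := by rwa [norm_neg]
  have hηη : conj η * η = 1 := by rw [conj_mul_self_eq, hη]; simp
  refine ⟨conj α * conj η, fun t => ?_⟩
  set w := Complex.exp (Complex.I * t) with hw
  have hw1 : ‖w‖ = 1 := norm_exp_I_mul t
  have hηw : ‖conj η * w‖ = 1 := by rw [norm_mul, RCLike.norm_conj, hη, hw1, one_mul]
  obtain ⟨θ, hθ⟩ := exists_exp_eq (norm_mob_eq hα' hηw)
  set z := Complex.exp (Complex.I * θ) with hz
  have hz1 : ‖z‖ = 1 := norm_exp_I_mul θ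
  have hmz : mob α z = conj η * w := by rw [hθ, mob_mob_neg hα hηw.le]
  have hwψ : Complex.exp (Complex.I * ψ θ) = w := by
    rw [h, ← hz, hΦe z hz1.le, hmz, ← mul_assoc, mul_comm η, hηη, one_mul]
  refine ⟨θ, hwψ.symm, ?_⟩
  have hd1 : HasDerivAt (fun θ : ℝ => Complex.exp (Complex.I * ψ θ))
      (Complex.I * w * ((deriv ψ θ : ℝ) : ℂ)) θ := by
    have h2 := (hasDerivAt_exp_I_mul (ψ θ)).scomp θ (hψ θ).hasDerivAt
    rw [hwψ, Complex.real_smul, mul_comm] at h2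
    exact h2
  have hd2 : HasDerivAt (fun θ : ℝ => Complex.exp (Complex.I * ψ θ))
      (η * (((1 - ‖α‖ ^ 2 : ℝ) : ℂ) / (1 + conj α * z) ^ 2 * (Complex.I * z))) θ := by
    have h2 := ((hasDerivAt_mob hα hz1.le).comp θ (hasDerivAt_exp_I_mul θ)).const_mul η
    refine h2.congr_of_eventuallyEq (Filter.Eventually.of_forall fun θ => ?_)
    simp only [Function.comp]
    rw [h, hΦe _ (norm_exp_I_mul θ).le]
  have hpos := one_sub_norm_sq_pos hα
  have h3 := congrArg norm (hd1.unique hd2)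
  simp only [norm_mul, Complex.norm_I, hw1, hη, hz1, norm_div, norm_pow, Complex.norm_real,
    one_mul, mul_one, Real.norm_eq_abs, abs_of_pos hpos] at h3
  have h4 := congrArg norm (one_sub_conj_mul_mob hα hz1.le)
  rw [hmz, ← mul_assoc, norm_div, Complex.norm_real, Real.norm_of_nonneg hpos.le] at h4
  have h5 := norm_pos_iff.2 (mob_den_ne_zero hα hz1.le)
  rw [h3, h4, norm_mul, RCLike.norm_conj, RCLike.norm_conj, hη, mul_one]
  field_simp

/-! ### Trigonometric polynomials of degree one -/

theorem fourier_one_coe (θ : ℝ) :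
    (fourier 1 (θ : Circ) : ℂ) = Complex.exp (Complex.I * θ) := by
  have hi : (Real.pi : ℂ) ≠ 0 := by exact_mod_cast Real.pi_ne_zero
  rw [fourier_coe_apply]
  congr 1
  push_cast
  field_simp

theorem coe_eq_coe_of_exp_eq {s t : ℝ}
    (h : Complex.exp (Complex.I * s) = Complex.exp (Complex.I * t)) : (s : Circ) = (t : Circ) := by
  rw [← fourier_one_coe, ← fourier_one_coe, fourier_one, fourier_one] at h
  exact AddCircle.injective_toCircle Real.two_pi_pos.ne' (Subtype.ext h)

theorem nrm_ne_zero : (nrm : ℂ) ≠ 0 := by exact_mod_cast nrm_pos.ne'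

theorem power_one_apply (x : Circ) : (a.power 1).1 x = a.toFun x := by
  rw [PosSmooth.power_apply, Real.rpow_one]

theorem fourierCoeff_eq_zero_of_eq {p q r : ℂ}
    (h : ∀ x : Circ, (a.toFun x : ℂ) = p + q * fourier 1 x + r * fourier (-1) x) {k : ℤ}
    (hk : 2 ≤ |k|) : fourierCoeff (a.power 1).1 k = 0 := by
  have e : a.power 1 = ((nrm : ℂ)⁻¹ * p) • es 0 + ((nrm : ℂ)⁻¹ * q) • es 1
      + ((nrm : ℂ)⁻¹ * r) • es (-1) := by
    ext x
    change (a.power 1).1 x = ((nrm : ℂ)⁻¹ * p) * (es 0).1 x + ((nrm : ℂ)⁻¹ * q) * (es 1).1 x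
      + ((nrm : ℂ)⁻¹ * r) * (es (-1)).1 x
    have := nrm_ne_zero
    rw [power_one_apply, h, es_apply, es_apply, es_apply, fourier_zero]
    field_simp
  have h0 : k ≠ 0 ∧ k ≠ 1 ∧ k ≠ -1 := by
    refine ⟨?_, ?_, ?_⟩ <;> rintro rfl <;> norm_num at hk
  have h1 := coef_toL2 (a.power 1) k
  rw [e, map_add, map_add, map_smul, map_smul, map_smul, coef_add, coef_add, coef_smul, coef_smul,
    coef_smul, coef_es, coef_es, coef_es, if_neg h0.1, if_neg h0.2.1, if_neg h0.2.2, ← e] at h1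
  have hne : (2 * Real.pi * nrm : ℂ) ≠ 0 :=
    mul_ne_zero (by exact_mod_cast Real.two_pi_pos.ne') nrm_ne_zero
  simp only [mul_zero, add_zero] at h1
  exact (mul_eq_zero.1 h1.symm).resolve_left hne

theorem fourierCoeff_neg (k : ℤ) :
    fourierCoeff (a.power 1).1 (-k) = conj (fourierCoeff (a.power 1).1 k) := by
  rw [fourierCoeff, fourierCoeff, ← integral_conj]
  refine integral_congr_ae (Filter.Eventually.of_forall fun x => ?_)
  simp only [smul_eq_mul, map_mul, a.conj_power, fourier_neg, neg_neg, Complex.conj_conj]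

theorem exists_eq_of_fourierCoeff_eq_zero
    (h : ∀ k : ℤ, 2 ≤ k → fourierCoeff (a.power 1).1 k = 0) :
    ∃ (c : ℝ) (b : ℂ), ∀ θ : ℝ, a.toFun (θ : Circ)
      = c + 2 * (b * Complex.exp (Complex.I * θ)).re := by
  set F : ℤ → ℂ := fourierCoeff (a.power 1).1 with hF
  have hF0 : F 0 = ((F 0).re : ℂ) := by
    have := fourierCoeff_neg (a := a) 0
    rw [neg_zero] at this
    exact (Complex.conj_eq_iff_re.1 this.symm).symm
  have hFk : ∀ k : ℤ, k ≠ 0 → k ≠ 1 → k ≠ -1 → F k = 0 := by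
    intro k h0 h1 h2
    by_cases hk : 2 ≤ k
    · exact h k hk
    · have h3 : F (-k) = 0 := h (-k) (by omega)
      have h4 := fourierCoeff_neg (a := a) (-k)
      rw [neg_neg] at h4
      change F k = conj (F (-k)) at h4
      rw [h4, h3, map_zero]
  have e : a.power 1 = (2 * Real.pi * nrm : ℂ) •
      (F 0 • es 0 + F 1 • es 1 + F (-1) • es (-1)) := by
    refine toL2_injective (ext_coef fun k => ?_)
    rw [coef_toL2, map_smul, coef_smul, map_add, map_add, map_smul, map_smul, map_smul, coef_add,
      coef_add, coef_smul, coef_smul, coef_smul, coef_es, coef_es, coef_es]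
    congr 1
    change F k = _
    by_cases h0 : k = 0
    · simp [h0]
    by_cases h1 : k = 1
    · simp [h1]
    by_cases h2 : k = -1
    · simp [h2]
    simp [h0, h1, h2, hFk k h0 h1 h2]
  refine ⟨(F 0).re, F 1, fun θ => ?_⟩
  have h1 : (a.power 1).1 (θ : Circ) = (2 * Real.pi * nrm : ℂ) * (F 0 * (es 0).1 (θ : Circ)
      + F 1 * (es 1).1 (θ : Circ) + F (-1) * (es (-1)).1 (θ : Circ)) := by
    conv_lhs => rw [e]
    rfl
  have h2 : F (-1) = conj (F 1) := fourierCoeff_neg 1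
  rw [power_one_apply, es_apply, es_apply, es_apply, fourier_zero, fourier_neg, fourier_one_coe,
    h2, hF0] at h1
  set z := Complex.exp (Complex.I * θ)
  have h3 := Complex.add_conj (F 1 * z)
  rw [map_mul] at h3
  have h4 : (a.toFun (θ : Circ) : ℂ) = (((F 0).re + 2 * (F 1 * z).re : ℝ) : ℂ) := by
    rw [h1]
    push_cast at h3 ⊢
    rw [← h3]
    linear_combination (((F 0).re : ℂ) + F 1 * z + conj (F 1) * conj z) * nrm_sq_complex
  exact_mod_cast h4

theorem norm_one_sub_sq (w : ℂ) : ‖1 - w‖ ^ 2 = 1 + ‖w‖ ^ 2 - 2 * w.re := by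
  rw [Complex.sq_norm, Complex.sq_norm, Complex.normSq_apply, Complex.normSq_apply]
  simp only [Complex.sub_re, Complex.sub_im, Complex.one_re, Complex.one_im]
  ring

/-- A positive trigonometric polynomial of degree at most one is a multiple of `|1 - γ e^{iθ}|²`
with `|γ| < 1`. -/
theorem exists_factorization {c : ℝ} {b : ℂ}
    (h : ∀ θ : ℝ, a.toFun (θ : Circ) = c + 2 * (b * Complex.exp (Complex.I * θ)).re) :
    ∃ (A : ℝ) (γ : ℂ), 0 < A ∧ ‖γ‖ < 1 ∧
      ∀ θ : ℝ, a.toFun (θ : Circ) = A * ‖1 - γ * Complex.exp (Complex.I * θ)‖ ^ 2 := by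
  have hc : 2 * ‖b‖ < c := by
    by_cases hb : b = 0
    · have h0 := h 0
      rw [hb, zero_mul, Complex.zero_re, mul_zero, add_zero] at h0
      rw [hb, norm_zero, mul_zero, ← h0]
      exact a.pos _
    · have hb' : (‖b‖ : ℂ) ≠ 0 := by exact_mod_cast (norm_pos_iff.2 hb).ne'
      have hn : ‖-(conj b) / (‖b‖ : ℂ)‖ = 1 := by
        rw [norm_div, norm_neg, RCLike.norm_conj, Complex.norm_real, norm_norm,
          div_self (norm_pos_iff.2 hb).ne']
      obtain ⟨θ, hθ⟩ := exists_exp_eq hn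
      have h1 := h θ
      have h2 : b * (-(conj b) / (‖b‖ : ℂ)) = ((-‖b‖ : ℝ) : ℂ) := by
        rw [mul_div_assoc', div_eq_iff hb', mul_neg, mul_comm, conj_mul_self_eq]
        push_cast
        ring
      rw [hθ, h2, Complex.ofReal_re] at h1
      have := a.pos (θ : Circ)
      linarith
  have hb0 := norm_nonneg b
  -- `A` is the larger root of `A² - c A + |b|² = 0`
  set κ := Real.sqrt (c ^ 2 - 4 * ‖b‖ ^ 2) with hκ
  have hκ2 : κ ^ 2 = c ^ 2 - 4 * ‖b‖ ^ 2 := Real.sq_sqrt (by nlinarith)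
  have hκ0 : 0 ≤ κ := Real.sqrt_nonneg _
  set A := (c + κ) / 2 with hA
  have hA0 : 0 < A := by rw [hA]; linarith
  have hAb : ‖b‖ < A := by rw [hA]; linarith
  have hA' : (A : ℂ) ≠ 0 := by exact_mod_cast hA0.ne'
  refine ⟨A, -b / A, hA0, ?_, fun θ => ?_⟩
  · rw [norm_div, norm_neg, Complex.norm_real, Real.norm_of_nonneg hA0.le, div_lt_one hA0]
    exact hAb
  · have e : -b / (A : ℂ) * Complex.exp (Complex.I * θ)
        = ((-A⁻¹ : ℝ) : ℂ) * (b * Complex.exp (Complex.I * θ)) := by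
      push_cast
      field_simp
    rw [h, norm_one_sub_sq, e, Complex.re_ofReal_mul, norm_mul, norm_mul, norm_exp_I_mul,
      Complex.norm_real, norm_neg, Real.norm_of_nonneg (inv_pos.2 hA0).le]
    have hAq : A ^ 2 + ‖b‖ ^ 2 = c * A := by rw [hA]; nlinarith
    field_simp
    linear_combination -hAq

/-- The mean value of the Poisson kernel. -/
theorem integral_inv_norm_one_sub_sq {γ : ℂ} (hγ : ‖γ‖ < 1) :
    ∫ θ in (0 : ℝ)..(2 * Real.pi), 1 / ‖1 - γ * Complex.exp (Complex.I * θ)‖ ^ 2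
      = 2 * Real.pi / (1 - ‖γ‖ ^ 2) := by
  have hpos := one_sub_norm_sq_pos hγ
  have hden : ∀ z : ℂ, ‖z‖ ≤ 1 → 1 - γ * z ≠ 0 := by
    intro z hz
    have := mob_den_ne_zero (α := -conj γ) (z := z) (by rwa [norm_neg, RCLike.norm_conj]) hz
    simpa [sub_eq_add_neg] using this
  have hd : DiffContOnCl ℂ (fun z : ℂ => (1 - γ * z)⁻¹) (Metric.ball 0 |1|) := by
    rw [abs_one]
    refine DifferentiableOn.diffContOnCl fun z hz => ?_
    rw [closure_ball (0 : ℂ) one_ne_zero, mem_closedBall_zero_iff] at hz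
    have hda : DifferentiableAt ℂ (fun z : ℂ => 1 - γ * z) z := by fun_prop
    exact (hda.inv (hden z hz)).differentiableWithinAt
  have h1 := hd.circleAverage
  rw [Real.circleAverage_def, mul_zero, sub_zero, inv_one] at h1
  have hcm : ∀ θ : ℝ, circleMap 0 1 θ = Complex.exp (Complex.I * θ) := fun θ => by
    simp [circleMap, mul_comm]
  simp only [hcm] at h1
  have hcont : Continuous fun θ : ℝ => (1 - γ * Complex.exp (Complex.I * θ))⁻¹ :=
    Continuous.inv₀ (by fun_prop) fun θ => hden _ (norm_exp_I_mul θ).le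
  have h2 : ∫ θ in (0 : ℝ)..(2 * Real.pi), ((1 - γ * Complex.exp (Complex.I * θ))⁻¹).re
      = 2 * Real.pi := by
    have h3 := Complex.reCLM.intervalIntegral_comp_comm
      (hcont.intervalIntegrable (μ := volume) 0 (2 * Real.pi))
    refine h3.trans ?_
    rw [inv_smul_eq_iff₀ Real.two_pi_pos.ne'] at h1
    rw [h1]
    simp
  have h4 : ∀ θ : ℝ, 1 / ‖1 - γ * Complex.exp (Complex.I * θ)‖ ^ 2
      = (1 - ‖γ‖ ^ 2)⁻¹ * (2 * ((1 - γ * Complex.exp (Complex.I * θ))⁻¹).re - 1) := by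
    intro θ
    set w := γ * Complex.exp (Complex.I * θ) with hw
    have hwn : ‖w‖ = ‖γ‖ := by rw [hw, norm_mul, norm_exp_I_mul, mul_one]
    have h5 : ‖1 - w‖ ≠ 0 := norm_ne_zero_iff.2 (hden _ (norm_exp_I_mul θ).le)
    have h6 : ((1 - w)⁻¹).re = (1 - w.re) / ‖1 - w‖ ^ 2 := by
      rw [Complex.inv_re, Complex.sq_norm, Complex.sub_re, Complex.one_re]
    have h7 := norm_one_sub_sq w
    have hpos' : 1 - ‖w‖ ^ 2 ≠ 0 := by rw [hwn]; exact hpos.ne'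
    rw [h6, ← hwn]
    field_simp
    linarith
  simp only [h4]
  rw [intervalIntegral.integral_const_mul, intervalIntegral.integral_sub,
    intervalIntegral.integral_const_mul, h2, intervalIntegral.integral_const]
  · rw [smul_eq_mul]
    field_simp
    ring
  · exact (Complex.continuous_re.comp hcont).const_mul 2 |>.intervalIntegrable _ _
  · exact continuous_const.intervalIntegrable _ _

theorem im_I_mul_div (u : ℂ) (hu : 1 + u ≠ 0) :
    1 - 2 * (Complex.I * u / (1 + u)).im = (1 - ‖u‖ ^ 2) / ‖1 + u‖ ^ 2 := by
  have h : Complex.normSq (1 + u) ≠ 0 := fun h => hu (Complex.normSq_eq_zero.1 h)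
  rw [Complex.div_im, Complex.sq_norm, Complex.sq_norm]
  have e : Complex.normSq (1 + u) = (1 + u.re) * (1 + u.re) + u.im * u.im := by
    rw [Complex.normSq_apply]
    simp
  simp only [Complex.mul_re, Complex.mul_im, Complex.I_re, Complex.I_im, Complex.add_re,
    Complex.add_im, Complex.one_re, Complex.one_im]
  field_simp
  rw [e, Complex.normSq_apply]
  ring

/-- The functions `|1 - ᾱ e^{iθ}|² / (1 - |α|²)` are conformally equivalent to `1`, by means of the
Möbius transformation `mob α`. -/
theorem conformallyEquivalent_one {α : ℂ} (hα : ‖α‖ < 1) (h : ∀ θ : ℝ, a.toFun (θ : Circ)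
      = ‖1 - conj α * Complex.exp (Complex.I * θ)‖ ^ 2 / (1 - ‖α‖ ^ 2)) :
    ConformallyEquivalent a.toFun fun _ => 1 := by
  have hpos := one_sub_norm_sq_pos hα
  let q : ℝ → ℂ := fun θ => 1 + conj α * Complex.exp (Complex.I * θ)
  have hq0 : ∀ θ, q θ ≠ 0 := fun θ => mob_den_ne_zero hα (norm_exp_I_mul θ).le
  have hu : ∀ θ : ℝ, ‖conj α * Complex.exp (Complex.I * θ)‖ = ‖α‖ := fun θ => by
    rw [norm_mul, norm_exp_I_mul, mul_one, RCLike.norm_conj]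
  have hslit : ∀ θ, q θ ∈ Complex.slitPlane := by
    intro θ
    refine Or.inl ?_
    have h1 := (abs_le.1 (Complex.abs_re_le_norm (conj α * Complex.exp (Complex.I * θ)))).1
    rw [hu] at h1
    simp only [q, Complex.add_re, Complex.one_re]
    linarith
  let ψ : ℝ → ℝ := fun θ => θ - 2 * (Complex.log (q θ)).im
  have hψ : ∀ θ, HasDerivAt ψ ((1 - ‖α‖ ^ 2) / ‖q θ‖ ^ 2) θ := by
    intro θ
    have h1 : HasDerivAt q (conj α * (Complex.I * Complex.exp (Complex.I * θ))) θ :=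
      ((hasDerivAt_exp_I_mul θ).const_mul _).const_add 1
    have h2 := Complex.imCLM.hasFDerivAt.comp_hasDerivAt θ (h1.clog_real (hslit θ))
    have h3 := (hasDerivAt_id θ).sub (h2.const_mul 2)
    have e : (1 : ℝ) - 2 * Complex.imCLM
        (conj α * (Complex.I * Complex.exp (Complex.I * θ)) / q θ)
        = (1 - ‖α‖ ^ 2) / ‖q θ‖ ^ 2 := by
      rw [mul_left_comm, ← hu θ]
      exact im_I_mul_div _ (hq0 θ)
    rw [e] at h3
    exact h3
  have hexp : ∀ θ : ℝ, Complex.exp (Complex.I * ψ θ) = mob α (Complex.exp (Complex.I * θ)) := by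
    intro θ
    have h1 : Complex.I * (ψ θ : ℂ) = Complex.I * θ
        + (conj (Complex.log (q θ)) - Complex.log (q θ)) := by
      have h2 := Complex.sub_conj (Complex.log (q θ))
      simp only [ψ]
      push_cast at h2 ⊢
      linear_combination h2
    have hz := conj_mul_self_eq (Complex.exp (Complex.I * θ))
    rw [norm_exp_I_mul, one_pow, Complex.ofReal_one] at hz
    rw [h1, Complex.exp_add, Complex.exp_sub, Complex.exp_conj, Complex.exp_log (hq0 θ), mob,
      mul_div_assoc']
    congr 1
    simp only [q, map_add, map_mul, map_one, Complex.conj_conj]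
    linear_combination α * hz
  refine ⟨mob α, ψ, Or.inl (isConformalDisk_mob hα), fun θ => (hψ θ).differentiableAt, hexp,
    fun θ => ?_⟩
  have hqpos : 0 < ‖q θ‖ := norm_pos_iff.2 (hq0 θ)
  rw [(hψ θ).deriv, abs_of_pos (by positivity), h, hexp,
    one_sub_conj_mul_mob hα (norm_exp_I_mul θ).le, norm_div, Complex.norm_real,
    Real.norm_of_nonneg hpos.le]
  change (1 : ℝ) = _ * (((1 - ‖α‖ ^ 2) / ‖q θ‖) ^ 2 / (1 - ‖α‖ ^ 2))
  field_simp

theorem conformallyEquivalent_one_of_fourierCoeff (ha : Normalized a)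
    (h : ∀ k : ℤ, 2 ≤ k → fourierCoeff (a.power 1).1 k = 0) :
    ConformallyEquivalent a.toFun fun _ => 1 := by
  obtain ⟨c, b, hcb⟩ := exists_eq_of_fourierCoeff_eq_zero h
  obtain ⟨A, γ, hA, hγ, h1⟩ := exists_factorization hcb
  have hpos := one_sub_norm_sq_pos hγ
  have hA1 : A = (1 - ‖γ‖ ^ 2)⁻¹ := by
    unfold Normalized at ha
    have e : ∀ θ : ℝ, 1 / a.toFun (θ : Circ)
        = A⁻¹ * (1 / ‖1 - γ * Complex.exp (Complex.I * θ)‖ ^ 2) := fun θ => by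
      rw [h1, one_div, one_div, mul_inv]
    simp only [e] at ha
    rw [intervalIntegral.integral_const_mul, integral_inv_norm_one_sub_sq hγ] at ha
    have := Real.pi_pos
    field_simp at ha
    refine eq_inv_of_mul_eq_one_left ?_
    linarith
  refine conformallyEquivalent_one (α := conj γ) (by rwa [RCLike.norm_conj]) fun θ => ?_
  rw [h1, hA1, Complex.conj_conj, RCLike.norm_conj, div_eq_inv_mul]

theorem fourierCoeff_eq_zero_of_conformallyEquivalent
    (h : ConformallyEquivalent a.toFun fun _ => 1) {k : ℤ} (hk : 2 ≤ |k|) :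
    fourierCoeff (a.power 1).1 k = 0 := by
  obtain ⟨Ψ, ψ, hΨ, hψ, hexp, h1⟩ := h
  have ha : ∀ θ, a.toFun (ψ θ : Circ) = |deriv ψ θ| := by
    intro θ
    have h2 := h1 θ
    have h3 : |deriv ψ θ| ≠ 0 := by
      intro h0
      rw [h0, inv_zero, zero_mul] at h2
      exact one_ne_zero h2
    rw [eq_inv_mul_iff_mul_eq₀ h3, mul_one] at h2
    exact h2.symm
  obtain ⟨γ, hγ⟩ : ∃ γ : ℂ, ∀ t : ℝ, a.toFun (t : Circ)
      = ‖1 - γ * Complex.exp (Complex.I * t)‖ ^ 2 / (1 - ‖γ‖ ^ 2) := by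
    rcases hΨ with hΨ | hΨ
    · obtain ⟨γ, hγ⟩ := exists_abs_deriv_eq hΨ hψ hexp
      refine ⟨γ, fun t => ?_⟩
      obtain ⟨θ, h2, h3⟩ := hγ t
      rw [coe_eq_coe_of_exp_eq h2, ha, h3]
    · have hconj : ∀ r : ℝ, conj (Complex.exp (Complex.I * r))
          = Complex.exp (Complex.I * ((-r : ℝ) : ℂ)) := by
        intro r
        rw [← Complex.exp_conj, map_mul, Complex.conj_I, Complex.conj_ofReal]
        push_cast
        ring_nf
      obtain ⟨γ, hγ⟩ := exists_abs_deriv_eq (ψ := fun θ => -ψ θ) hΨ hψ.neg fun θ => by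
        rw [← hexp, hconj]
      refine ⟨conj γ, fun t => ?_⟩
      obtain ⟨θ, h2, h3⟩ := hγ (-t)
      rw [← hconj, ← hconj] at h2
      rw [coe_eq_coe_of_exp_eq (star_injective h2), ha, RCLike.norm_conj]
      have h4 : deriv (fun θ => -ψ θ) θ = -deriv ψ θ := deriv.fun_neg
      rw [h4, abs_neg] at h3
      rw [h3, ← hconj, ← RCLike.norm_conj (1 - conj γ * _)]
      simp only [map_sub, map_mul, map_one, Complex.conj_conj]
  set B : ℝ := (1 - ‖γ‖ ^ 2)⁻¹ with hB
  refine fourierCoeff_eq_zero_of_eq (p := ((B * (1 + ‖γ‖ ^ 2) : ℝ) : ℂ)) (q := -B * γ)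
    (r := -B * conj γ) (fun x => ?_) hk
  induction x using QuotientAddGroup.induction_on with
  | H t =>
    rw [hγ, norm_one_sub_sq, fourier_neg, fourier_one_coe, norm_mul, norm_exp_I_mul, mul_one,
      div_eq_inv_mul, ← hB]
    have h5 := Complex.add_conj (γ * Complex.exp (Complex.I * t))
    rw [map_mul] at h5
    push_cast at h5 ⊢
    linear_combination (B : ℂ) * h5

end SteklovCircle

end

theorem lemma4p1 (a : SteklovCircle.PosSmooth)
    (ha : 1 / (2 * Real.pi) *
      (∫ θ in (0 : ℝ)..(2 * Real.pi), 1 / a.toFun (θ : SteklovCircle.Circ)) = 1) :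
    ∃ τ : ℝ → ℝ,
      (∀ s : ℝ, ∃ T : SteklovCircle.L2S →L[ℂ] SteklovCircle.L2S,
        SteklovCircle.IsSteklovProduct a s T ∧ SteklovCircle.HasTrace T (τ s)) ∧
      (∀ s : ℝ, 0 < s → 0 ≤ τ s) ∧
      (∀ s : ℝ, s < 0 → τ s ≤ 0) ∧
      ((∃ s : ℝ, s ≠ 0 ∧ τ s = 0) ↔
        SteklovCircle.ConformallyEquivalent a.toFun (fun _ => 1)) := by
  obtain ⟨τ, h1, h2, h3, h4, h5⟩ := SteklovCircle.exists_trace ha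
  refine ⟨τ, h1, h2, h3, fun h => ?_, fun h => ⟨1, one_ne_zero, ?_⟩⟩
  · exact SteklovCircle.conformallyEquivalent_one_of_fourierCoeff ha (h4 h)
  · exact h5 (fun k hk => SteklovCircle.fourierCoeff_eq_zero_of_conformallyEquivalent h hk) 1
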